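/- A *bw-graph* is a finite connected graph $G$ (multiple edges allowed) embedded in $\mathbf C$ whose vertices are coloured black and white so that every edge joins a white and a black vertex, and which contains exactly one cycle; this cycle consists of two edges, and the bounded region that it encloses contains no vertex and no edge of $G$. A bw-graph is *real* if it is invariant, including the colours, under complex conjugation. Two real bw-graphs are identified if one is mapped to the other, respecting colours, by a homeomorphism of $\mathbf C$ that commutes with conjugation and preserves the orientation of $\mathbf R$. (Up to this identification, a real bw-graph is given by the counterclockwise cyclic orders of the edges around the vertices, the bounded face, the action of conjugation on the edges, and the left-to-right order of the real vertices.) Let $G$ be a real bw-graph. The two vertices of its cycle are real. $G$ is *white-sided* (*black-sided*) if its rightmost real vertex is white (black). Let $\Sigma_w$ and $\Sigma_b$ be the sequences of the degrees of the real white and of the real black vertices, respectively, from left to right. Let $\mathrm{lev}(G)$ be the total number of disorders of $\Sigma_w$ and $\Sigma_b$, where a disorder of a sequence $(s_1,\dots,s_m)$ is a pair $i<j$ with $s_i>s_j$. Let $\mathrm{pol}(G)$ be the number of real vertices of degree larger than $1$ that lie to the left of the cycle, the left vertex of the cycle included. The *sign* of $G$ is $\varepsilon(G)=(-1)^{\mathrm{lev}(G)+\mathrm{pol}(G)}$.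 **Theorem.** Let $d$ be a positive integer and let $\Lambda_w,\Lambda_b$ be partitions of $d$. Let $W$ (respectively $B$) be the finite set of classes of white-sided (respectively black-sided) real bw-graphs in which the degrees of the white vertices form $\Lambda_w$ and the degrees of the black vertices form $\Lambda_b$. Then $$\sum_{G\in W}\varepsilon(G)=\sum_{G\in B}\varepsilon(G).$$ -/

import Mathlib

/-!
# Real black-and-white simple graphs

A connected graph embedded in the oriented plane `ℂ` is given, up to homeomorphism, by its
rotation system (the counterclockwise cyclic order of the edges around every vertex) and by its
unbounded face.  We label the edges by `Fin d`.  As the vertices are coloured alternately, every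
edge has exactly one white and one black end, so the rotation system consists of two permutations
of the set of edges, one for the white ends and one for the black ends; the white (black) vertices
are the cycles of the first (second) permutation.  This is the usual description of a bipartite
map by a pair of permutations.
-/

/-- The two colours of vertices. -/
inductive BWColour where
  | white : BWColour
  | black : BWColour
  deriving DecidableEq

instance : Fintype BWColour :=
  ⟨{BWColour.white, BWColour.black}, fun k => by cases k <;> simp⟩

/-- A rotation system on the set of edges `Fin d`: `rot k e` is the edge that follows `e`
counterclockwise around the end of `e` of colour `k`. -/
abbrev BWRotation (d : ℕ) : Type := BWColour → Equiv.Perm (Fin d)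

/-- A vertex is recorded by its colour and by the set of the edges that are incident to it. -/
abbrev BWVertex (d : ℕ) : Type := BWColour × Finset (Fin d)

namespace BWVertex

/-- The degree of a vertex.  (An edge of a bipartite graph is never a loop.) -/
def degree {d : ℕ} (v : BWVertex d) : ℕ := v.2.card

/-- The image of a vertex under a bijection of the edges. -/
def relabel {d : ℕ} (τ : Equiv.Perm (Fin d)) (v : BWVertex d) : BWVertex d :=
  (v.1, v.2.map τ.toEmbedding)

end BWVertex

namespace BWRotation

variable {d : ℕ}

/-- `v` is a vertex: its edges form a cycle (possibly of length one) of the permutation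
that belongs to its colour. -/
def IsVertex (rot : BWRotation d) (v : BWVertex d) : Prop :=
  ∃ e, ∀ f, f ∈ v.2 ↔ (rot v.1).SameCycle e f

/-- The graph on the vertices in which parallel edges are merged: two vertices are adjacent when
they have different colours and share an edge. -/
def skeleton (rot : BWRotation d) : SimpleGraph {v : BWVertex d // rot.IsVertex v} where
  Adj u v := u.1.1 ≠ v.1.1 ∧ ∃ e, e ∈ u.1.2 ∧ e ∈ v.1.2
  symm := ⟨fun _ _ h => ⟨h.1.symm, h.2.imp fun _ he => ⟨he.2, he.1⟩⟩⟩
  loopless := ⟨fun _ h => h.1 rfl⟩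

/-- Two edges are parallel: they have the same white end and the same black end. -/
def Parallel (rot : BWRotation d) (e f : Fin d) : Prop := ∀ k, (rot k).SameCycle e f

open Classical in
/-- The multiset of the degrees of the vertices of colour `k`. -/
noncomputable def degrees (rot : BWRotation d) (k : BWColour) : Multiset ℕ :=
  (Finset.univ.filter fun v : BWVertex d => rot.IsVertex v ∧ v.1 = k).val.map BWVertex.degree

end BWRotation

open BWColour

/-- A black and white simple graph (with labelled edges): a connected bipartite plane graph
with exactly one cycle, which has length two and bounds a face.

The composition `rot white * rot black` permutes the edges, and its cycles are the faces (an edge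
followed from its white to its black end has the face on its right); a fixed point `e` is
a face whose boundary consists of the two edges `e` and `rot black e` only.  The edge `hole`
marks the bounded face in this way.  A connected graph with exactly one cycle has as many vertices
as edges, hence by Euler's formula two faces and genus zero, for every rotation system: planarity
is automatic, and the unbounded face is the other one. -/
structure BWGraph (d : ℕ) where
  /-- The cyclic orders of the edges around the vertices. -/
  rot : BWRotation d
  /-- The graph is connected. -/
  connected : rot.skeleton.Connected
  /-- There is no cycle of length greater than two. -/
  acyclic : rot.skeleton.IsAcyclic
  /-- The edge that marks the bounded face. -/
  hole : Fin d
  /-- The edges `hole` and `rot black hole` form a cycle of length two ... -/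
  hole_ne : rot black hole ≠ hole
  /-- ... which is the boundary of a face ... -/
  hole_face : rot white (rot black hole) = hole
  /-- ... and there is no other cycle of length two. -/
  parallel : ∀ e f, e ≠ f → rot.Parallel e f →
    (e = hole ∧ f = rot black hole) ∨ (e = rot black hole ∧ f = hole)

/-- A real black and white simple graph (with labelled edges), together with its position
relative to the oriented real line. -/
structure RealBWGraph (d : ℕ) extends BWGraph d where
  /-- The action of complex conjugation on the edges. -/
  conj : Equiv.Perm (Fin d)
  conj_conj : ∀ e, conj (conj e) = e
  /-- Conjugation preserves the colours and reverses the orientation of the plane. -/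
  conj_rot : ∀ k e, conj (rot k e) = (rot k).symm (conj e)
  /-- Conjugation maps the bounded face to itself (and hence the unbounded face as well): the face
  is the sector from `hole` counterclockwise to `rot black hole` at a black vertex, and
  conjugation maps it to the sector from `conj (rot black hole)` to `conj hole`. -/
  conj_hole : conj hole = rot black hole
  /-- The vertices on the real line, from left to right. -/
  spine : List (BWVertex d)
  spine_nodup : spine.Nodup
  /-- A vertex lies on the real line exactly when it is invariant under conjugation. -/
  mem_spine : ∀ v, v ∈ spine ↔ rot.IsVertex v ∧ v.relabel conj = v
  /-- Two consecutive real vertices are the ends of an edge on the real line (that is, of an edge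
  invariant under conjugation), or they are the two vertices of the cycle (and the real segment
  between them lies in the bounded face). -/
  spine_chain : spine.IsChain fun u v => ∃ e, e ∈ u.2 ∧ e ∈ v.2 ∧ (conj e = e ∨ e = hole)

/-- The number of disorders of a sequence `l`: the number of pairs of positions `i < j` with
`l i > l j`. -/
def disorders : List ℕ → ℕ
  | [] => 0
  | a :: l => l.countP (fun b => b < a) + disorders l

namespace RealBWGraph

variable {d : ℕ}

/-- The degrees of the real vertices of colour `k`, from left to right. -/
def realDegrees (G : RealBWGraph d) (k : BWColour) : List ℕ :=
  (G.spine.filter fun v => v.1 = k).map BWVertex.degree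

/-- The number of level disorders. -/
def lev (G : RealBWGraph d) : ℕ :=
  disorders (G.realDegrees white) + disorders (G.realDegrees black)

/-- The number of real vertices of degree larger than `1` to the left of the cycle, including the
left vertex of the cycle (which is the first real vertex incident to the edge `hole`). -/
def pol (G : RealBWGraph d) : ℕ :=
  (G.spine.take (G.spine.findIdx (fun v => G.hole ∈ v.2) + 1)).countP fun v => 1 < v.degree

/-- The sign of a real graph. -/
def sign (G : RealBWGraph d) : ℤ := (-1) ^ (G.lev + G.pol)

/-- The rightmost real vertex has colour `k`. -/
def Sided (k : BWColour) (G : RealBWGraph d) : Prop :=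
  ∃ v, G.spine.getLast? = some v ∧ v.1 = k

/-- `τ` is an isomorphism from `G` to `H`.  (A conjugation equivariant homeomorphism of the plane
may exchange the two half planes; it can then be composed with conjugation, so only orientation
preserving ones have to be considered.) -/
structure IsIso (G H : RealBWGraph d) (τ : Equiv.Perm (Fin d)) : Prop where
  rot : ∀ k e, H.rot k (τ e) = τ (G.rot k e)
  hole : H.hole = τ G.hole
  conj : ∀ e, H.conj (τ e) = τ (G.conj e)
  spine : H.spine = G.spine.map (BWVertex.relabel τ)

theorem relabel_relabel (τ ρ : Equiv.Perm (Fin d)) (v : BWVertex d) :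
    (v.relabel τ).relabel ρ = v.relabel (ρ * τ) := by
  simp only [BWVertex.relabel, Finset.map_map]
  rfl

theorem relabel_one (v : BWVertex d) : v.relabel 1 = v := by
  refine Prod.ext rfl ?_
  ext e
  simp only [BWVertex.relabel, Finset.mem_map_equiv]
  rfl

theorem degree_relabel (τ : Equiv.Perm (Fin d)) (v : BWVertex d) :
    (v.relabel τ).degree = v.degree := by
  simp [BWVertex.relabel, BWVertex.degree]

theorem relabel_injective (τ : Equiv.Perm (Fin d)) :
    Function.Injective (BWVertex.relabel τ) := by
  intro u v h
  have h2 := congrArg (BWVertex.relabel τ⁻¹) h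
  simpa [relabel_relabel, relabel_one] using h2

theorem IsIso.refl (G : RealBWGraph d) : IsIso G G 1 where
  rot _ _ := rfl
  hole := rfl
  conj _ := rfl
  spine := by
    have h : BWVertex.relabel (1 : Equiv.Perm (Fin d)) = id := funext relabel_one
    rw [h, List.map_id]

theorem IsIso.trans {G H K : RealBWGraph d} {τ ρ : Equiv.Perm (Fin d)} (h : IsIso G H τ)
    (h' : IsIso H K ρ) : IsIso G K (ρ * τ) where
  rot k e := by simp [h.rot, h'.rot]
  hole := by simp [h.hole, h'.hole]
  conj e := by simp [h.conj, h'.conj]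
  spine := by
    rw [h'.spine, h.spine, List.map_map]
    exact List.map_congr_left fun v _ => relabel_relabel τ ρ v

theorem IsIso.symm {G H : RealBWGraph d} {τ : Equiv.Perm (Fin d)} (h : IsIso G H τ) :
    IsIso H G τ⁻¹ where
  rot k e := by
    have := h.rot k (τ⁻¹ e)
    simp at this
    simp [this]
  hole := by simp [h.hole]
  conj e := by
    have := h.conj (τ⁻¹ e)
    simp at this
    simp [this]
  spine := by
    have h1 : (BWVertex.relabel τ⁻¹ ∘ BWVertex.relabel τ) = id :=
      funext fun v => by simp [relabel_relabel, relabel_one]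
    rw [h.spine, List.map_map, h1, List.map_id]

/-- Isomorphism of real black and white simple graphs. -/
instance isoSetoid (d : ℕ) : Setoid (RealBWGraph d) where
  r G H := ∃ τ, IsIso G H τ
  iseqv :=
    { refl := fun G => ⟨1, IsIso.refl G⟩
      symm := fun ⟨τ, h⟩ => ⟨τ⁻¹, h.symm⟩
      trans := fun ⟨τ, h⟩ ⟨ρ, h'⟩ => ⟨ρ * τ, h.trans h'⟩ }

theorem IsIso.realDegrees_eq {G H : RealBWGraph d} {τ : Equiv.Perm (Fin d)} (h : IsIso G H τ)
    (k : BWColour) : G.realDegrees k = H.realDegrees k := by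
  unfold realDegrees
  rw [h.spine, List.filter_map, List.map_map]
  exact (List.map_congr_left fun v _ => degree_relabel τ v).symm

theorem IsIso.pol_eq {G H : RealBWGraph d} {τ : Equiv.Perm (Fin d)} (h : IsIso G H τ) :
    G.pol = H.pol := by
  have h1 : ((fun v : BWVertex d => decide (H.hole ∈ v.2)) ∘ BWVertex.relabel τ) =
      fun v => decide (G.hole ∈ v.2) := by
    funext v
    simp [BWVertex.relabel, h.hole]
  have h2 : ((fun v : BWVertex d => decide (1 < v.degree)) ∘ BWVertex.relabel τ) =
      fun v => decide (1 < v.degree) := by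
    funext v
    simp [degree_relabel]
  unfold pol
  rw [h.spine, List.findIdx_map, h1, ← List.map_take, List.countP_map, h2]

theorem IsIso.sign_eq {G H : RealBWGraph d} {τ : Equiv.Perm (Fin d)} (h : IsIso G H τ) :
    G.sign = H.sign := by
  simp only [sign, lev, h.realDegrees_eq, h.pol_eq]

theorem IsIso.sided {G H : RealBWGraph d} {τ : Equiv.Perm (Fin d)} (h : IsIso G H τ)
    {k : BWColour} (hG : Sided k G) : Sided k H := by
  obtain ⟨v, hv, hk⟩ := hG
  exact ⟨v.relabel τ, by simp [h.spine, hv], hk⟩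

theorem IsIso.isVertex {G H : RealBWGraph d} {τ : Equiv.Perm (Fin d)} (h : IsIso G H τ)
    {v : BWVertex d} (hv : G.rot.IsVertex v) : H.rot.IsVertex (v.relabel τ) := by
  obtain ⟨e, he⟩ := hv
  have hc : H.rot v.1 = τ * G.rot v.1 * τ⁻¹ := by
    ext f
    have := h.rot v.1 (τ⁻¹ f)
    simp at this
    simp [this]
  refine ⟨τ e, fun f => ?_⟩
  change f ∈ v.2.map τ.toEmbedding ↔ (H.rot v.1).SameCycle (τ e) f
  rw [hc, Equiv.Perm.sameCycle_conj]
  have h1 : τ⁻¹ (τ e) = e := by simp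
  rw [h1, ← he, Finset.mem_map_equiv]
  rfl

theorem IsIso.degrees_eq {G H : RealBWGraph d} {τ : Equiv.Perm (Fin d)} (h : IsIso G H τ)
    (k : BWColour) : G.rot.degrees k = H.rot.degrees k := by
  classical
  have key : (Finset.univ.filter fun v : BWVertex d => H.rot.IsVertex v ∧ v.1 = k) =
      (Finset.univ.filter fun v : BWVertex d => G.rot.IsVertex v ∧ v.1 = k).map
        ⟨BWVertex.relabel τ, relabel_injective τ⟩ := by
    ext v
    simp only [Finset.mem_filter, Finset.mem_univ, true_and, Finset.mem_map,
      Function.Embedding.coeFn_mk]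
    constructor
    · rintro ⟨hv, hk⟩
      exact ⟨v.relabel τ⁻¹, ⟨h.symm.isVertex hv, hk⟩, by simp [relabel_relabel, relabel_one]⟩
    · rintro ⟨u, ⟨hu, hk⟩, rfl⟩
      exact ⟨h.isVertex hu, hk⟩
  have e1 : H.rot.degrees k =
      (Finset.univ.filter fun v : BWVertex d => H.rot.IsVertex v ∧ v.1 = k).val.map
        BWVertex.degree := by
    unfold BWRotation.degrees
    congr!
  have e2 : G.rot.degrees k =
      (Finset.univ.filter fun v : BWVertex d => G.rot.IsVertex v ∧ v.1 = k).val.map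
        BWVertex.degree := by
    unfold BWRotation.degrees
    congr!
  rw [e1, e2, key, Finset.map_val, Multiset.map_map]
  exact Multiset.map_congr rfl fun v _ => (degree_relabel τ v).symm

/-- There are only finitely many graphs with a given number of edges, so that the sums below are
finite sums. -/
instance finite (d : ℕ) : Finite (RealBWGraph d) := by
  let F : RealBWGraph d → BWRotation d × Fin d × Equiv.Perm (Fin d) ×
      {l : List (BWVertex d) // l.Nodup} :=
    fun G => (G.rot, G.hole, G.conj, ⟨G.spine, G.spine_nodup⟩)
  refine Finite.of_injective F ?_
  rintro ⟨⟨r, _, _, o, _, _, _⟩, c, _, _, _, s, _, _, _⟩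
    ⟨⟨r', _, _, o', _, _, _⟩, c', _, _, _, s', _, _, _⟩ h
  simp only [F, Prod.mk.injEq, Subtype.mk.injEq] at h
  obtain ⟨rfl, rfl, rfl, rfl⟩ := h
  rfl

/-- The isomorphism classes of real black and white simple graphs with `d` edges. -/
abbrev IsoClass (d : ℕ) : Type := Quotient (isoSetoid d)

namespace IsoClass

/-- The sign of an isomorphism class. -/
def sign : IsoClass d → ℤ := Quotient.lift RealBWGraph.sign fun _ _ ⟨_, h⟩ => h.sign_eq

/-- The rightmost real vertex has colour `k`. -/
def Sided (k : BWColour) : IsoClass d → Prop :=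
  Quotient.lift (RealBWGraph.Sided k) fun _ _ ⟨_, h⟩ =>
    propext ⟨fun hG => h.sided hG, fun hH => h.symm.sided hH⟩

/-- The degrees of the vertices of colour `k`. -/
noncomputable def degrees (k : BWColour) : IsoClass d → Multiset ℕ :=
  Quotient.lift (fun G => G.rot.degrees k) fun _ _ ⟨_, h⟩ => h.degrees_eq k

end IsoClass

/-- The isomorphism classes whose white and black vertices have the degrees `Λw` and `Λb`. -/
def classes (Λw Λb : d.Partition) : Set (IsoClass d) :=
  {q | q.degrees white = Λw.parts ∧ q.degrees black = Λb.parts}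

/-- The white-sided ones among them. -/
def whiteSided (Λw Λb : d.Partition) : Set (IsoClass d) :=
  {q | q ∈ classes Λw Λb ∧ q.Sided white}

/-- The black-sided ones among them. -/
def blackSided (Λw Λb : d.Partition) : Set (IsoClass d) :=
  {q | q ∈ classes Λw Λb ∧ q.Sided black}

/-- The sum of the signs of the elements of a (finite) set of isomorphism classes. -/
noncomputable def signedCount (M : Set (IsoClass d)) : ℤ := ∑ᶠ q ∈ M, q.sign

end RealBWGraph

/-!
The idea of the proof is to turn the signed count of graphs into a coefficient of a generating
function, and to evaluate the latter with anticommuting operators, which take care of the disorders.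

*Graphs and codes.* A real bw-graph is determined by its part in the closed upper half plane: the
real vertices form an alternating chain, interrupted by the two edges of the cycle, and a plane
forest hangs on their edges into the open upper half plane.  Hence isomorphism classes correspond
to codes (`BWCode`), which list the degrees of the real vertices on both sides of the bounded face
and the degrees of the forest in depth-first order.  Every graph has a code
(`RealBWGraph.exists_presentation`); the code determines the class (`Presentation.exists_isIso`)
and is determined by it (`Presentation.code_unique`); and every code that satisfies the obvious
conditions on parities and on the number of edges occurs (`BWCode.Valid.exists_graph`).  Sign,
degrees and the colour of the rightmost vertex can be read off from the code.

*Generating functions.* Let `x c` be the generating function of plane trees with a root of colour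
`c`, each taken together with its mirror image, where the degrees are marked by variables.  A real
vertex with `k` edges into the upper half plane has the weight `(x c.other) ^ k`, times the variable
of its degree.  To record the sign of the disorders, one attaches to every colour and degree an
operator (`vertexOp`), such that different operators of the same colour anticommute, operators of
different colours commute, and all squares are `1`.  The product of the operators of the real
vertices, evaluated by `evalOp`, is the sign of the disorders (`evalOp_prod`).  So the signed count
is a coefficient of a sum of products of weighted sums of operators (`RealBWGraph.signedCount_eq`),
one product for every number of real vertices to the left and to the right of the cycle
(`SpineAlgebra.term`).

*The identity.* The weighted sums satisfy the relations collected in `SpineAlgebra`.  Vertices with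
degrees of different parity contribute anticommuting sums, and the functional equation
`forestSeries_singleton` of the generating functions of trees yields the value of the square of the
sum `R` for the rightmost vertex.  Now the cycle can be moved along the real line without changing
the term, unless it gets to an end (`SpineAlgebra.term_slide`).  With an even number of real
vertices, the remaining terms are symmetric in the two colours (`SpineAlgebra.sum_term_even`).  With
an odd number this is wrong, but the sums telescope (`SpineAlgebra.sum_term_odd`): exchanging the
colours changes the sum over all numbers of real vertices up to a bound only by a remainder
(`SpineAlgebra.sum_sum_term`).  If the bound is large, the remainder involves more real vertices
than there are edges and does not contribute (`coeff_evalOp_remainder`).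
-/


/-! ### Colours -/

namespace BWColour

/-- The other colour. -/
def other : BWColour → BWColour
  | white => black
  | black => white

@[simp] theorem other_other (c : BWColour) : c.other.other = c := by cases c <;> rfl

@[simp] theorem other_ne (c : BWColour) : c.other ≠ c := by cases c <;> decide

@[simp] theorem ne_other (c : BWColour) : c ≠ c.other := by cases c <;> decide

theorem eq_or_eq_other (c k : BWColour) : k = c ∨ k = c.other := by
  cases c <;> cases k <;> simp [other]

theorem ne_iff_eq_other {c k : BWColour} : k ≠ c ↔ k = c.other := by
  cases c <;> cases k <;> simp [other]

end BWColour

/-! ### Codes of real graphs -/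

/-- The combinatorial code of a real graph: the degrees of its vertices in the closed upper half
plane, in an order from which the graph can be rebuilt. -/
structure BWCode where
  /-- The colour of the right vertex of the cycle. -/
  cR : BWColour
  /-- The degrees of the real vertices to the left of the bounded face, read leftwards. -/
  DL : List ℕ
  /-- The degrees of the real vertices to the right of the bounded face, read rightwards. -/
  DR : List ℕ
  /-- The degrees of the vertices in the open upper half plane, in depth-first order. -/
  w : List ℕ

namespace BWCode

/-- The degrees `D` can be those of the real vertices on one side of the bounded face, read away
from it.  Here `t = 1` if the first vertex lies on the cycle and `t = 0` otherwise.  A real vertex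
has an even number of non-real edges off the cycle, one or two cycle or real edges towards the
face, and one real edge away from it unless it is the last one. -/
def SideOK : ℕ → List ℕ → Prop
  | _, [] => False
  | t, [s] => ∃ k, s = 2 * k + 1 + t
  | t, s :: s' :: D => (∃ k, s = 2 * k + 2 + t) ∧ SideOK 0 (s' :: D)

/-- The colours of the far ends of the edges that lead from the real vertices on one side into
the upper half plane. -/
def slotCols : ℕ → BWColour → List ℕ → List BWColour
  | _, _, [] => []
  | t, c, [s] => List.replicate ((s - 1 - t) / 2) c.other
  | t, c, s :: s' :: D =>
    List.replicate ((s - 2 - t) / 2) c.other ++ slotCols 0 c.other (s' :: D)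

/-- The word `w` lists the degrees of the vertices of a plane forest in depth-first order, where
`st` lists the colours of the roots.  (Every vertex has one edge towards its root, or, if it is a
root, one edge by which the tree is attached.) -/
def Luk : List BWColour → List ℕ → Prop
  | [], [] => True
  | [], _ :: _ => False
  | _ :: _, [] => False
  | c :: st, s :: w => 1 ≤ s ∧ Luk (List.replicate (s - 1) c.other ++ st) w

/-- The vertices with the degrees `D` and alternating colours, starting with the colour `c`. -/
def altern : BWColour → List ℕ → List (BWColour × ℕ)
  | _, [] => []
  | c, s :: D => (c, s) :: altern c.other D

/-- The coloured vertices of the plane forest that is described by `Luk`. -/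
def forestVerts : List BWColour → List ℕ → List (BWColour × ℕ)
  | c :: st, s :: w => (c, s) :: forestVerts (List.replicate (s - 1) c.other ++ st) w
  | _, _ => []

/-- The colours of the roots of the plane forest in the open upper half plane: the far ends of the
edges that lead there from the real vertices, first on the left and then on the right of the
bounded face. -/
def stack (C : BWCode) : List BWColour :=
  slotCols 1 C.cR.other C.DL ++ slotCols 1 C.cR C.DR

/-- The colours and degrees of the real vertices, from left to right. -/
def spine (C : BWCode) : List (BWColour × ℕ) :=
  (altern C.cR.other C.DL).reverse ++ altern C.cR C.DR

/-- The code belongs to a real graph with `d` edges.  A graph with exactly one cycle has as many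
edges as vertices, and a vertex off the real line is counted together with its mirror image. -/
def Valid (d : ℕ) (C : BWCode) : Prop :=
  SideOK 1 C.DL ∧ SideOK 1 C.DR ∧ Luk C.stack C.w ∧ C.DL.length + C.DR.length + 2 * C.w.length = d

end BWCode

/-! ### Tables of cyclic lists -/

section Tables

variable {E : Type*}

/-- The permutation `σ` runs through the list `l` cyclically. -/
def Cyc [DecidableEq E] (σ : Equiv.Perm E) (l : List E) : Prop :=
  l.Nodup ∧ ∀ x ∈ l, σ x = l.formPerm x

/-- The closed list of edges around a real vertex, obtained from the list `U` of those in the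
closed upper half plane by reflection. -/
def dbl [DecidableEq E] (conj : Equiv.Perm E) (U : List E) : List E :=
  U ++ ((U.filter fun x => conj x ≠ x).map conj).reverse

/-- `HSide conj t x c D S sl`: the real vertices on one side of the bounded face, read away from
it, have the degrees `D`, and the edges around them in the closed upper half plane are listed in
the table `S`.  The first vertex has the colour `c`, the list of its edges begins with `x`, and
`t = 1` if it lies on the cycle.  The edges in the open upper half plane off the cycle are
collected in `sl`, together with the colours of their far ends. -/
inductive HSide (conj : Equiv.Perm E) : ℕ → E → BWColour → List ℕ → List (BWColour × List E) →
    List (E × BWColour) → Prop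
  | last (t : ℕ) (x : E) (c : BWColour) (as : List E) (h : ∀ a ∈ as, conj a ≠ a) :
      HSide conj t x c [2 * as.length + 1 + t] [(c, x :: as)] (as.map fun a => (a, c.other))
  | cons (t : ℕ) (x y : E) (c : BWColour) (as : List E) (D : List ℕ)
      (S : List (BWColour × List E)) (sl : List (E × BWColour)) (h : ∀ a ∈ as, conj a ≠ a)
      (hy : conj y = y) (hS : HSide conj 0 y c.other D S sl) :
      HSide conj t x c ((2 * as.length + 2 + t) :: D) ((c, x :: (as ++ [y])) :: S)
        ((as.map fun a => (a, c.other)) ++ sl)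

/-- `HRun conj st w T`: the plane forest that hangs on the edges of the stack `st` (each given with
the colour of its far end) has the vertices `T`, in depth-first order, with the degrees `w`.  A
vertex is given by its colour and by the list of its edges, beginning with the one towards the
root. -/
inductive HRun (conj : Equiv.Perm E) : List (E × BWColour) → List ℕ →
    List (BWColour × List E) → Prop
  | nil : HRun conj [] [] []
  | cons (e : E) (c : BWColour) (ch : List E) (st : List (E × BWColour)) (w : List ℕ)
      (T : List (BWColour × List E)) (h : ∀ a ∈ ch, conj a ≠ a)
      (hT : HRun conj ((ch.map fun a => (a, c.other)) ++ st) w T) :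
      HRun conj ((e, c) :: st) ((ch.length + 1) :: w) ((c, e :: ch) :: T)

/-- The edges at the vertices of colour `c`. -/
def tableAt (c : BWColour) (S : List (BWColour × List E)) : List E :=
  (S.filter fun v => v.1 = c).flatMap fun v => v.2

/-- The edges which do not come first in their lists. -/
def tails (S : List (BWColour × List E)) : List E := S.flatMap fun v => v.2.tail

/-- The edges on a stack whose far ends have colour `c`. -/
def stackAt (c : BWColour) (st : List (E × BWColour)) : List E :=
  (st.filter fun a => a.2 = c).map Prod.fst

theorem tableAt_append (c : BWColour) (S T : List (BWColour × List E)) :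
    tableAt c (S ++ T) = tableAt c S ++ tableAt c T := by simp [tableAt]

theorem tails_append (S T : List (BWColour × List E)) :
    tails (S ++ T) = tails S ++ tails T := by simp [tails]

theorem stackAt_append (c : BWColour) (S T : List (E × BWColour)) :
    stackAt c (S ++ T) = stackAt c S ++ stackAt c T := by simp [stackAt]

theorem tableAt_cons (c : BWColour) (v : BWColour × List E) (S : List (BWColour × List E)) :
    tableAt c (v :: S) = (if v.1 = c then v.2 else []) ++ tableAt c S := by
  by_cases h : v.1 = c <;> simp [tableAt, h]

theorem tails_cons (v : BWColour × List E) (S : List (BWColour × List E)) :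
    tails (v :: S) = v.2.tail ++ tails S := by simp [tails]

theorem stackAt_cons (c : BWColour) (a : E × BWColour) (S : List (E × BWColour)) :
    stackAt c (a :: S) = (if a.2 = c then [a.1] else []) ++ stackAt c S := by
  by_cases h : a.2 = c <;> simp [stackAt, h]

theorem stackAt_map (c k : BWColour) (as : List E) :
    stackAt c (as.map fun a => (a, k)) = if k = c then as else [] := by
  by_cases h : k = c <;> simp [stackAt, h, List.filter_map, Function.comp_def]

/-- On each side, every edge that leads away from the bounded face occurs once at its near end,
and, unless it is a slot, once at its far end. -/
theorem HSide.tableAt_perm {conj : Equiv.Perm E} {t : ℕ} {x : E} {c : BWColour} {D : List ℕ}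
    {S : List (BWColour × List E)} {sl : List (E × BWColour)} (h : HSide conj t x c D S sl)
    (k : BWColour) :
    ((tableAt k S : Multiset E)) + (stackAt k sl : Multiset E) =
      (if c = k then {x} else 0) + (tails S : Multiset E) := by
  induction h with
  | last t x c as h =>
    rw [tableAt_cons, tails_cons, stackAt_map]
    rcases BWColour.eq_or_eq_other c k with rfl | rfl <;>
      simp [tableAt, tails]
  | cons t x y c as D S sl h hy hS ih =>
    rw [tableAt_cons, tails_cons, stackAt_append, stackAt_map]
    rcases BWColour.eq_or_eq_other c k with rfl | rfl
    · simp only [BWColour.other_ne, if_true, if_false, List.nil_append, zero_add] at ih ⊢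
      rw [← Multiset.coe_add, ← Multiset.coe_add, add_assoc, ih, ← Multiset.cons_coe,
        ← Multiset.singleton_add, add_assoc]
      rfl
    · simp only [BWColour.ne_other, if_true, if_false, List.nil_append, zero_add] at ih ⊢
      rw [← Multiset.coe_add, add_left_comm, ih, ← Multiset.coe_add, List.tail_cons,
        ← Multiset.coe_add, add_assoc]
      rfl

/-- Every edge of the forest occurs once at its near end and once at its far end. -/
theorem HRun.tableAt_perm {conj : Equiv.Perm E} {st : List (E × BWColour)} {w : List ℕ}
    {T : List (BWColour × List E)} (h : HRun conj st w T) (k : BWColour) :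
    ((tableAt k T : Multiset E)) = (stackAt k st : Multiset E) + (tails T : Multiset E) := by
  induction h with
  | nil => rfl
  | cons e c ch st w T h hT ih =>
    rw [stackAt_append, stackAt_map, ← Multiset.coe_add] at ih
    rw [tableAt_cons, tails_cons, stackAt_cons, ← Multiset.coe_add, ← Multiset.coe_add,
      ← Multiset.coe_add, ih]
    rcases BWColour.eq_or_eq_other c k with rfl | rfl
    · simp only [BWColour.other_ne, if_true, if_false, List.tail_cons, Multiset.coe_nil, zero_add]
      rw [← Multiset.cons_coe, ← Multiset.singleton_add]
      simp only [add_assoc, add_left_comm, Multiset.coe_singleton]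
    · simp only [BWColour.ne_other, if_true, if_false, List.tail_cons, Multiset.coe_nil, zero_add]
      simp only [add_assoc, add_left_comm]

theorem HSide.ne_nil {conj : Equiv.Perm E} {t : ℕ} {x : E} {c : BWColour} {D : List ℕ}
    {S : List (BWColour × List E)} {sl : List (E × BWColour)} (h : HSide conj t x c D S sl) :
    ∃ l S', (∃ U, l = x :: U) ∧ S = (c, l) :: S' := by
  cases h with
  | last => exact ⟨_, _, ⟨_, rfl⟩, rfl⟩
  | cons => exact ⟨_, _, ⟨_, rfl⟩, rfl⟩

theorem HSide.slot_nonreal {conj : Equiv.Perm E} {t : ℕ} {x : E} {c : BWColour} {D : List ℕ}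
    {S : List (BWColour × List E)} {sl : List (E × BWColour)} (h : HSide conj t x c D S sl) :
    ∀ a ∈ sl, conj a.1 ≠ a.1 := by
  induction h with
  | last t x c as h => simpa using h
  | cons t x y c as D S sl h hy hS ih =>
    simp only [List.mem_append, List.mem_map]
    rintro a (⟨b, hb, rfl⟩ | ha)
    · exact h b hb
    · exact ih a ha

theorem HSide.sideOK {conj : Equiv.Perm E} {t : ℕ} {x : E} {c : BWColour} {D : List ℕ}
    {S : List (BWColour × List E)} {sl : List (E × BWColour)} (h : HSide conj t x c D S sl) :
    BWCode.SideOK t D := by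
  induction h with
  | last t x c as h => exact ⟨_, rfl⟩
  | cons t x y c as D S sl h hy hS ih =>
    cases D with
    | nil => exact ih.elim
    | cons s D => exact ⟨⟨_, rfl⟩, ih⟩

theorem HSide.slotCols {conj : Equiv.Perm E} {t : ℕ} {x : E} {c : BWColour} {D : List ℕ}
    {S : List (BWColour × List E)} {sl : List (E × BWColour)} (h : HSide conj t x c D S sl) :
    BWCode.slotCols t c D = sl.map Prod.snd := by
  induction h with
  | last t x c as h =>
    simp [BWCode.slotCols, Function.comp_def]
  | cons t x y c as D S sl h hy hS ih =>
    cases D with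
    | nil => exact hS.sideOK.elim
    | cons s D =>
      have : (2 * as.length + 2 + t - 2 - t) / 2 = as.length := by omega
      simp [BWCode.slotCols, this, Function.comp_def, ih]

theorem HSide.length_eq {conj : Equiv.Perm E} {t : ℕ} {x : E} {c : BWColour} {D : List ℕ}
    {S : List (BWColour × List E)} {sl : List (E × BWColour)} (h : HSide conj t x c D S sl) :
    S.length = D.length := by
  induction h with
  | last => rfl
  | cons t x y c as D S sl h hy hS ih => simp [ih]

theorem HRun.luk {conj : Equiv.Perm E} {st : List (E × BWColour)} {w : List ℕ}
    {T : List (BWColour × List E)} (h : HRun conj st w T) : BWCode.Luk (st.map Prod.snd) w := by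
  induction h with
  | nil => trivial
  | cons e c ch st w T h hT ih =>
    refine ⟨by omega, ?_⟩
    simpa [Function.comp_def] using ih

/-- The coloured degrees of the vertices of the forest. -/
theorem HRun.forestVerts {conj : Equiv.Perm E} {st : List (E × BWColour)} {w : List ℕ}
    {T : List (BWColour × List E)} (h : HRun conj st w T) :
    T.map (fun v => (v.1, v.2.length)) = BWCode.forestVerts (st.map Prod.snd) w := by
  induction h with
  | nil => rfl
  | cons e c ch st w T h hT ih => simpa [BWCode.forestVerts, Function.comp_def] using ih

theorem HSide.length_tails {conj : Equiv.Perm E} {t : ℕ} {x : E} {c : BWColour} {D : List ℕ}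
    {S : List (BWColour × List E)} {sl : List (E × BWColour)} (h : HSide conj t x c D S sl) :
    (tails S).length + 1 = sl.length + D.length := by
  induction h with
  | last => simp [tails]
  | cons t x y c as D S sl h hy hS ih =>
    simp only [tails_cons, List.length_append, List.length_cons, List.tail_cons, List.length_map,
      List.length_nil]
    omega

theorem HRun.length_tails {conj : Equiv.Perm E} {st : List (E × BWColour)} {w : List ℕ}
    {T : List (BWColour × List E)} (h : HRun conj st w T) :
    (tails T).length + st.length = w.length := by
  induction h with
  | nil => rfl
  | cons e c ch st w T h hT ih =>
    simp only [tails_cons, List.length_append, List.length_cons, List.tail_cons,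
      List.length_map] at ih ⊢
    omega

end Tables

section Doubling

variable {E : Type*} [DecidableEq E]

theorem dbl_last {conj : Equiv.Perm E} {x : E} {as : List E} (h : ∀ a ∈ as, conj a ≠ a) :
    dbl conj (x :: as) =
      x :: (as ++ ((as.map conj).reverse ++ if conj x = x then [] else [conj x])) := by
  have h1 : as.filter (fun a => conj a ≠ a) = as := List.filter_eq_self.2 (by simpa using h)
  by_cases hx : conj x = x
  · simp only [dbl, List.filter_cons, h1, hx]; simp
  · simp only [dbl, List.filter_cons, h1, hx]; simp [hx]

theorem dbl_cons {conj : Equiv.Perm E} {x y : E} {as : List E} (h : ∀ a ∈ as, conj a ≠ a)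
    (hy : conj y = y) :
    dbl conj (x :: (as ++ [y])) =
      x :: (as ++ y :: ((as.map conj).reverse ++ if conj x = x then [] else [conj x])) := by
  have h1 : as.filter (fun a => conj a ≠ a) = as := List.filter_eq_self.2 (by simpa using h)
  by_cases hx : conj x = x
  · simp only [dbl, List.filter_cons, List.filter_append, h1, hx]; simp [hy]
  · simp only [dbl, List.filter_cons, List.filter_append, h1, hx]; simp [hx, hy]

theorem tableAt_dbl (conj : Equiv.Perm E) (c : BWColour)
    (S : List (BWColour × List E)) :
    (tableAt c (S.map fun v => (v.1, dbl conj v.2)) : Multiset E) =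
      (tableAt c S : Multiset E) +
        (((tableAt c S).filter fun e => conj e ≠ e).map conj : List E) := by
  induction S with
  | nil => rfl
  | cons v S ih =>
    rw [List.map_cons, tableAt_cons, tableAt_cons, ← Multiset.coe_add, ih]
    by_cases hv : v.1 = c
    · simp only [hv, if_true, dbl, List.filter_append, List.map_append, ← Multiset.coe_add,
        Multiset.coe_reverse]
      simp only [add_assoc, add_left_comm]
    · simp [hv]

/-- The non-real edges on one side that lead away from the bounded face are the slots. -/
theorem HSide.length_filter_tails {conj : Equiv.Perm E} {t : ℕ} {x : E} {c : BWColour}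
    {D : List ℕ} {S : List (BWColour × List E)} {sl : List (E × BWColour)}
    (h : HSide conj t x c D S sl) :
    ((tails S).filter fun e => conj e ≠ e).length = sl.length := by
  induction h with
  | last t x c as h =>
    have h1 : as.filter (fun a => conj a ≠ a) = as := List.filter_eq_self.2 (by simpa using h)
    rw [tails_cons, List.tail_cons, List.filter_append, h1]
    simp [tails]
  | cons t x y c as D S sl h hy hS ih =>
    have h1 : as.filter (fun a => conj a ≠ a) = as := List.filter_eq_self.2 (by simpa using h)
    rw [tails_cons, List.tail_cons, List.filter_append, List.filter_append, h1,
      List.length_append, List.length_append, List.length_append, ih]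
    simp [hy]

/-- The coloured degrees of the real vertices on one side. -/
theorem HSide.altern {conj : Equiv.Perm E} {t : ℕ} {x : E} {c : BWColour} {D : List ℕ}
    {S : List (BWColour × List E)} {sl : List (E × BWColour)} (h : HSide conj t x c D S sl)
    (ht : t = if conj x = x then 0 else 1) :
    S.map (fun v => (v.1, (dbl conj v.2).length)) = BWCode.altern c D := by
  induction h with
  | last t x c as h =>
    rw [List.map_singleton, dbl_last h, ht]
    by_cases hx : conj x = x <;> simp [BWCode.altern, hx] <;> omega
  | cons t x y c as D S sl h hy hS ih =>
    rw [List.map_cons, dbl_cons h hy, ih (by simp [hy]), ht]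
    by_cases hx : conj x = x <;> simp [BWCode.altern, hx] <;> omega

end Doubling


section CycLemmas

variable {E : Type*} [DecidableEq E]

theorem Cyc.mem_apply {σ : Equiv.Perm E} {l : List E} (h : Cyc σ l) {x : E} (hx : x ∈ l) :
    σ x ∈ l := by
  rw [h.2 x hx]
  exact List.formPerm_apply_mem_of_mem hx

theorem Cyc.apply_getElem {σ : Equiv.Perm E} {l : List E} (h : Cyc σ l) (i : ℕ)
    (hi : i < l.length) :
    σ l[i] = l[(i + 1) % l.length]'(Nat.mod_lt _ (by omega)) := by
  rw [h.2 _ (List.getElem_mem _), List.formPerm_apply_getElem _ h.1]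

theorem Cyc.reverse {σ : Equiv.Perm E} {l : List E} (h : Cyc σ l) : Cyc σ⁻¹ l.reverse := by
  refine ⟨List.nodup_reverse.2 h.1, fun x hx => ?_⟩
  rw [List.mem_reverse] at hx
  rw [List.formPerm_reverse, Equiv.Perm.inv_eq_iff_eq]
  have h1 : l.formPerm⁻¹ x ∈ l := by
    have := List.formPerm_apply_mem_of_mem (List.mem_reverse.2 hx)
    rwa [List.formPerm_reverse, List.mem_reverse] at this
  rw [h.2 _ h1]
  simp

theorem cyc_reverse_iff {σ : Equiv.Perm E} {l : List E} : Cyc σ l.reverse ↔ Cyc σ⁻¹ l :=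
  ⟨fun h => by simpa using h.reverse, fun h => by simpa using h.reverse⟩

theorem Cyc.map {E' : Type*} [DecidableEq E'] {σ : Equiv.Perm E} {τ : E ≃ E'}
    {ρ : Equiv.Perm E'} {l : List E} (h : Cyc σ l)
    (hc : ∀ e, ρ (τ e) = τ (σ e)) : Cyc ρ (l.map τ) := by
  refine ⟨h.1.map τ.injective, fun x hx => ?_⟩
  obtain ⟨y, hy, rfl⟩ := List.mem_map.1 hx
  obtain ⟨i, hi, rfl⟩ := List.getElem_of_mem hy
  have h1 : τ l[i] = (l.map τ)[i]'(by simpa using hi) := by simp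
  rw [hc, h.apply_getElem i hi, h1, List.formPerm_apply_getElem _ (h.1.map τ.injective)]
  simp

theorem Cyc.rotated {σ : Equiv.Perm E} {l l' : List E} (h : Cyc σ l) (hl : l ~r l') :
    Cyc σ l' :=
  ⟨hl.nodup_iff.1 h.1, fun x hx => by
    rw [h.2 x (hl.mem_iff.2 hx), List.formPerm_eq_of_isRotated h.1 hl]⟩

theorem Cyc.sameCycle_iff [Finite E] {σ : Equiv.Perm E} {l : List E} (h : Cyc σ l) {x y : E}
    (hx : x ∈ l) : σ.SameCycle x y ↔ y ∈ l := by
  constructor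
  · intro hxy
    obtain ⟨n, rfl⟩ := hxy.exists_nat_pow_eq
    clear hxy
    induction n with
    | zero => exact hx
    | succ n ih => rw [pow_succ', Equiv.Perm.mul_apply]; exact h.mem_apply ih
  · intro hy
    obtain ⟨n, hn⟩ := (h.1.isCycleOn_formPerm).2 hx hy
    obtain ⟨m, hm⟩ := Equiv.Perm.SameCycle.exists_nat_pow_eq ⟨n, hn⟩
    have key : ∀ k : ℕ, (σ ^ k) x = (l.formPerm ^ k) x ∧ (σ ^ k) x ∈ l := by
      intro k
      induction k with
      | zero => exact ⟨rfl, hx⟩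
      | succ k ih =>
        rw [pow_succ', pow_succ', Equiv.Perm.mul_apply, Equiv.Perm.mul_apply, ← ih.1]
        exact ⟨h.2 _ ih.2, h.mem_apply ih.2⟩
    exact ⟨m, by rw [zpow_natCast, (key m).1, hm]⟩

theorem mem_dbl {conj : Equiv.Perm E} {U : List E} (hc : ∀ e, conj (conj e) = e) {x : E} :
    x ∈ dbl conj U ↔ x ∈ U ∨ conj x ∈ U := by
  simp only [dbl, List.mem_append, List.mem_reverse, List.mem_map, List.mem_filter,
    decide_eq_true_eq]
  constructor
  · rintro (h | ⟨a, ⟨ha, -⟩, rfl⟩)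
    · exact .inl h
    · exact .inr (by rwa [hc])
  · rintro (h | h)
    · exact .inl h
    · by_cases hx : conj x = x
      · exact .inl (by rwa [hx] at h)
      · exact .inr ⟨conj x, ⟨h, by rw [hc]; exact fun h => hx h.symm⟩, hc x⟩

end CycLemmas

/-! ### Tables of real graphs -/

section FullTables

variable {E : Type*}

/-- The table of all vertices, obtained by reflection from those in the closed upper half plane.
Every list is in counterclockwise order: the lists of the real vertices on the left begin with the
edge on the right, from which one gets counterclockwise into the upper half plane, while those of
the real vertices on the right are read clockwise and have to be reversed. -/
def fullTable [DecidableEq E] (conj : Equiv.Perm E) (SL SR T : List (BWColour × List E)) :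
    List (BWColour × List E) :=
  SL.map (fun v => (v.1, dbl conj v.2)) ++ (SR.map (fun v => (v.1, (dbl conj v.2).reverse)) ++
    (T ++ T.map fun v => (v.1, (v.2.map conj).reverse)))

/-- The part of a real graph in the closed upper half plane, as a table of the edges around the
vertices. -/
structure HalfTable (conj : Equiv.Perm E) (C : BWCode) where
  /-- The upper edge of the cycle. -/
  h : E
  /-- The real vertices to the left of the bounded face. -/
  SL : List (BWColour × List E)
  /-- The real vertices to the right of the bounded face. -/
  SR : List (BWColour × List E)
  /-- The vertices in the open upper half plane. -/
  T : List (BWColour × List E)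
  /-- The edges that lead from the real vertices on the left into the upper half plane. -/
  slL : List (E × BWColour)
  /-- The edges that lead from the real vertices on the right into the upper half plane. -/
  slR : List (E × BWColour)
  /-- The two edges of the cycle are conjugate, and not real. -/
  conj_h : conj h ≠ h
  /-- The shape of the left side. -/
  sideL : HSide conj 1 h C.cR.other C.DL SL slL
  /-- The shape of the right side. -/
  sideR : HSide conj 1 h C.cR C.DR SR slR
  /-- The shape of the forest in the open upper half plane. -/
  run : HRun conj (slL ++ slR) C.w T
  /-- The upper edge of the cycle and the edges which do not come first in their lists are
  distinct ... -/
  nodup : (h :: tails (SL ++ SR ++ T)).Nodup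
  /-- ... and they are all edges, up to conjugation ... -/
  cover : ∀ e, e ∈ h :: tails (SL ++ SR ++ T) ∨ conj e ∈ h :: tails (SL ++ SR ++ T)
  /-- ... such that only real edges are conjugate to one another. -/
  disj : ∀ e ∈ h :: tails (SL ++ SR ++ T), conj e ∈ h :: tails (SL ++ SR ++ T) → conj e = e

namespace HalfTable

variable {conj : Equiv.Perm E} {C : BWCode} (H : HalfTable conj C)

/-- The edges in the closed upper half plane. -/
def edges : List E := H.h :: tails (H.SL ++ H.SR ++ H.T)

/-- At the vertices of either colour, every edge in the closed upper half plane occurs once. -/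
theorem tableAt_eq (c : BWColour) :
    (tableAt c (H.SL ++ H.SR ++ H.T) : Multiset E) = (H.edges : Multiset E) := by
  have h1 := H.sideL.tableAt_perm c
  have h2 := H.sideR.tableAt_perm c
  have h3 := H.run.tableAt_perm c
  rw [stackAt_append, ← Multiset.coe_add] at h3
  rw [tableAt_append, tableAt_append, edges, tails_append, tails_append, ← Multiset.cons_coe,
    ← Multiset.coe_add, ← Multiset.coe_add, ← Multiset.coe_add, ← Multiset.coe_add, h3,
    ← Multiset.singleton_add]
  have h4 : (if C.cR.other = c then ({H.h} : Multiset E) else 0) +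
      (if C.cR = c then {H.h} else 0) = {H.h} := by
    rcases BWColour.eq_or_eq_other C.cR c with rfl | rfl <;> simp
  rw [← h4]
  calc _ = ((tableAt c H.SL : Multiset E) + (stackAt c H.slL : Multiset E)) +
        ((tableAt c H.SR : Multiset E) + (stackAt c H.slR : Multiset E)) +
        (tails H.T : Multiset E) := by simp only [add_assoc, add_left_comm]
    _ = _ := by rw [h1, h2]; simp only [add_assoc, add_left_comm]

theorem T_nonreal : ∀ v ∈ H.T, ∀ e ∈ v.2, conj e ≠ e := by
  have key : ∀ st w T, HRun conj st w T → (∀ a ∈ st, conj a.1 ≠ a.1) →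
      ∀ v ∈ T, ∀ e ∈ v.2, conj e ≠ e := by
    intro st w T hT
    induction hT with
    | nil => simp
    | cons e c ch st w T h hT ih =>
      intro hst v hv
      rcases List.mem_cons.1 hv with rfl | hv
      · simp only [List.mem_cons, forall_eq_or_imp]
        exact ⟨hst _ (List.mem_cons_self), h⟩
      · refine ih ?_ v hv
        simp only [List.mem_append, List.mem_map]
        rintro a (⟨b, hb, rfl⟩ | ha)
        · exact h b hb
        · exact hst a (List.mem_cons_of_mem _ ha)
  refine key _ _ _ H.run fun a ha => ?_
  rcases List.mem_append.1 ha with ha | ha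
  · exact H.sideL.slot_nonreal a ha
  · exact H.sideR.slot_nonreal a ha

variable [DecidableEq E]

/-- All vertices, with the edges around them. -/
def full : List (BWColour × List E) := fullTable conj H.SL H.SR H.T

/-- Every edge occurs exactly once in the table at a vertex of a given colour. -/
theorem tableAt_full (c : BWColour) :
    (tableAt c H.full : Multiset E) =
      (H.edges : Multiset E) + ((H.edges.filter fun e => conj e ≠ e).map conj : List E) := by
  have hr : ∀ S : List (BWColour × List E),
      (tableAt c (S.map fun v => (v.1, (dbl conj v.2).reverse)) : Multiset E) =
        (tableAt c (S.map fun v => (v.1, dbl conj v.2)) : Multiset E) := by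
    intro S
    induction S with
    | nil => rfl
    | cons v S ih =>
      rw [List.map_cons, List.map_cons, tableAt_cons, tableAt_cons, ← Multiset.coe_add, ih,
        ← Multiset.coe_add]
      by_cases hv : v.1 = c <;> simp [hv]
  have ht : ∀ S : List (BWColour × List E), (∀ v ∈ S, ∀ e ∈ v.2, conj e ≠ e) →
      (tableAt c (S.map fun v => (v.1, (v.2.map conj).reverse)) : Multiset E) =
          (((tableAt c S).filter fun e => conj e ≠ e).map conj : List E) := by
    intro S hS
    induction S with
    | nil => rfl
    | cons v S ih =>
      rw [List.map_cons, tableAt_cons, tableAt_cons, ← Multiset.coe_add,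
        ih fun u hu => hS u (List.mem_cons_of_mem _ hu)]
      by_cases hv : v.1 = c
      · have h1 : v.2.filter (fun a => conj a ≠ a) = v.2 :=
          List.filter_eq_self.2 (by simpa using hS v List.mem_cons_self)
        simp only [hv, if_true, List.filter_append, List.map_append, ← Multiset.coe_add,
          Multiset.coe_reverse, h1]
      · simp [hv]
  have h0 := H.tableAt_eq c
  have h1 : ((H.edges.filter fun e => conj e ≠ e).map conj : List E) =
      (((tableAt c (H.SL ++ H.SR ++ H.T)).filter fun e => conj e ≠ e).map conj : Multiset E) := by
    have := congrArg (fun m => (Multiset.filter (fun e => conj e ≠ e) m).map conj) h0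
    simpa using this.symm
  rw [h1, ← h0, full, fullTable, tableAt_append, tableAt_append, tableAt_append, tableAt_append,
    tableAt_append, ← Multiset.coe_add, ← Multiset.coe_add, ← Multiset.coe_add, tableAt_dbl, hr,
    tableAt_dbl,
    ht _ H.T_nonreal]
  simp only [List.filter_append, List.map_append, ← Multiset.coe_add]
  simp only [add_assoc, add_left_comm]

theorem nodup_full (c : BWColour) : (tableAt c H.full).Nodup := by
  rw [← Multiset.coe_nodup, H.tableAt_full c, Multiset.coe_add, Multiset.coe_nodup,
    List.nodup_append']
  refine ⟨H.nodup, (H.nodup.filter _).map conj.injective, ?_⟩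
  intro a ha hb
  obtain ⟨b, hb', rfl⟩ := List.mem_map.1 hb
  obtain ⟨hb', hne⟩ := List.mem_filter.1 hb'
  exact (by simpa using hne : conj b ≠ b) (H.disj b hb' ha)

theorem mem_full (hc : ∀ e, conj (conj e) = e) (c : BWColour) (e : E) :
    ∃ v ∈ H.full, v.1 = c ∧ e ∈ v.2 := by
  have h1 : e ∈ (tableAt c H.full : Multiset E) := by
    rw [H.tableAt_full c]
    simp only [Multiset.mem_add, Multiset.mem_coe, List.mem_map, List.mem_filter,
      decide_eq_true_eq]
    rcases H.cover e with he | he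
    · exact .inl he
    · by_cases h : conj e = e
      · exact .inl (by rwa [h] at he)
      · exact .inr ⟨conj e, ⟨he, by rw [hc]; exact fun h' => h h'.symm⟩, hc e⟩
  simpa [tableAt, and_assoc] using h1

theorem ne_nil_of_mem_full {v : BWColour × List E} (hv : v ∈ H.full) : v.2 ≠ [] := by
  have hs : ∀ t x c D S sl, HSide conj t x c D S sl → ∀ v ∈ S, v.2 ≠ [] := by
    intro t x c D S sl hS
    induction hS with
    | last t x c as h => simp
    | cons t x y c as D S sl h hy hS ih => simpa using ih
  have ht : ∀ st w T, HRun conj st w T → ∀ v ∈ T, v.2 ≠ [] := by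
    intro st w T hT
    induction hT with
    | nil => simp
    | cons e c ch st w T h hT ih => simpa using ih
  simp only [full, fullTable, List.mem_append, List.mem_map] at hv
  rcases hv with ⟨u, hu, rfl⟩ | ⟨u, hu, rfl⟩ | hv | ⟨u, hu, rfl⟩
  · have := hs _ _ _ _ _ _ H.sideL u hu
    simp [dbl, this]
  · have := hs _ _ _ _ _ _ H.sideR u hu
    simp [dbl, this]
  · exact ht _ _ _ H.run v hv
  · simpa using ht _ _ _ H.run u hu

/-- Different entries of the table are disjoint if they have the same colour. -/
theorem pairwise_full :
    H.full.Pairwise fun u v => u.1 = v.1 → u.2.Disjoint v.2 := by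
  rw [List.pairwise_iff_getElem]
  intro i j hi hj hij huv
  have h1 := H.nodup_full H.full[i].1
  rw [tableAt, List.nodup_flatMap] at h1
  have h2 : [H.full[i], H.full[j]].Sublist (H.full.filter fun v => v.1 = H.full[i].1) := by
    have h3 : [H.full[i], H.full[j]].Sublist H.full := by
      have h4 : [H.full[j]].Sublist (H.full.drop (i + 1)) := by
        rw [List.singleton_sublist]
        exact List.mem_drop_iff_getElem.2 ⟨j - (i + 1), by omega, by congr 1; omega⟩
      have h5 : H.full.drop i = H.full[i] :: H.full.drop (i + 1) := List.drop_eq_getElem_cons hi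
      exact (h5 ▸ h4.cons_cons _).trans (List.drop_sublist _ _)
    have := h3.filter (fun v => decide (v.1 = H.full[i].1))
    simpa [huv.symm] using this
  have := h1.2.sublist h2
  simpa [Function.onFun] using this

/-- The coloured degrees of all vertices. -/
theorem map_full :
    H.full.map (fun v => (v.1, v.2.length)) =
      BWCode.altern C.cR.other C.DL ++ (BWCode.altern C.cR C.DR ++
        (BWCode.forestVerts C.stack C.w ++ BWCode.forestVerts C.stack C.w)) := by
  have h1 := H.run.forestVerts
  rw [List.map_append, ← H.sideL.slotCols, ← H.sideR.slotCols] at h1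
  have e : ∀ h : conj H.h ≠ H.h, 1 = if conj H.h = H.h then 0 else 1 := fun h => by simp [h]
  have h2 := H.sideL.altern (e H.conj_h)
  have h3 := H.sideR.altern (e H.conj_h)
  rw [BWCode.stack, ← h1, ← h2, ← h3, full, fullTable]
  simp [Function.comp_def]

end HalfTable

end FullTables


/-! ### Presentations of real graphs by codes -/

/-- The edges and vertices of the real graph `G` are listed in a table of the shape that is
described by the code `C`. -/
structure Presentation {d : ℕ} (G : RealBWGraph d) (C : BWCode) extends
    HalfTable G.conj C where
  /-- The hole lies counterclockwise of the edge `G.hole` at the black vertex of the cycle, so this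
  is the upper edge if the black vertex is on the right, and the lower one otherwise. -/
  hole : G.hole = if C.cR = black then h else G.conj h
  /-- The lists are the cyclic orders of the edges around the vertices. -/
  cyc : ∀ v ∈ fullTable G.conj SL SR T, Cyc (G.rot v.1) v.2
  /-- The real vertices, from left to right, are those of the two sides. -/
  spine : G.spine = (SL.reverse ++ SR).map fun v => (v.1, (dbl G.conj v.2).toFinset)

/-- The sum of the numbers of disorders in both colours. -/
def levelDisorders (l : List (BWColour × ℕ)) : ℕ :=
  disorders ((l.filter fun v => v.1 = white).map Prod.snd) +
    disorders ((l.filter fun v => v.1 = black).map Prod.snd)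

namespace BWCode

/-- The coloured degrees of all vertices. -/
def verts (C : BWCode) : List (BWColour × ℕ) :=
  altern C.cR.other C.DL ++ (altern C.cR C.DR ++
    (forestVerts C.stack C.w ++ forestVerts C.stack C.w))

/-- The number of disorders of the degrees of the real vertices, in both colours. -/
def lev (C : BWCode) : ℕ := levelDisorders C.spine

/-- The number of real vertices of degree larger than one to the left of the bounded face. -/
def pol (C : BWCode) : ℕ := C.DL.countP fun s => 1 < s

/-- The sign of a code. -/
def sign (C : BWCode) : ℤ := (-1) ^ (C.lev + C.pol)

/-- The rightmost real vertex has colour `k`. -/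
def Sided (k : BWColour) (C : BWCode) : Prop := ((altern C.cR C.DR).getLast?).map Prod.fst = some k

theorem length_altern (c : BWColour) (D : List ℕ) : (altern c D).length = D.length := by
  induction D generalizing c with
  | nil => rfl
  | cons s D ih => simp [altern, ih]

theorem map_snd_altern (c : BWColour) (D : List ℕ) : (altern c D).map Prod.snd = D := by
  induction D generalizing c with
  | nil => rfl
  | cons s D ih => simp [altern, ih]

end BWCode

namespace HalfTable

variable {d : ℕ} {conj : Equiv.Perm (Fin d)} {C : BWCode}

theorem isVertex_iff (P : HalfTable conj C) (hc : ∀ e, conj (conj e) = e) {rot : BWRotation d}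
    (hr : ∀ v ∈ P.full, Cyc (rot v.1) v.2) (v : BWVertex d) :
    rot.IsVertex v ↔ ∃ u ∈ P.full, (u.1, u.2.toFinset) = v := by
  constructor
  · rintro ⟨e, he⟩
    obtain ⟨u, hu, huc, hue⟩ := P.mem_full hc v.1 e
    refine ⟨u, hu, Prod.ext huc ?_⟩
    ext f
    rw [List.mem_toFinset, he f, ← huc, (hr u hu).sameCycle_iff hue]
  · rintro ⟨u, hu, rfl⟩
    obtain ⟨e, he⟩ := List.exists_mem_of_ne_nil _ (P.ne_nil_of_mem_full hu)
    exact ⟨e, fun f => by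
      change f ∈ u.2.toFinset ↔ (rot u.1).SameCycle e f
      rw [List.mem_toFinset, (hr u hu).sameCycle_iff he]⟩

/-- Different entries of the table are different vertices. -/
theorem nodup_verts (P : HalfTable conj C) :
    (P.full.map fun u => ((u.1, u.2.toFinset) : BWVertex d)).Nodup := by
  rw [List.Nodup, List.pairwise_map]
  have h1 := P.pairwise_full
  refine List.Pairwise.imp_of_mem ?_ h1
  intro u v hu hv huv h
  obtain ⟨e, he⟩ := List.exists_mem_of_ne_nil _ (P.ne_nil_of_mem_full hu)
  have h2 := (Prod.ext_iff.1 h).2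
  have h3 : e ∈ v.2 := by
    rw [← List.mem_toFinset]
    exact (Finset.ext_iff.1 h2 e).1 (List.mem_toFinset.2 he)
  exact huv (Prod.ext_iff.1 h).1 he h3

end HalfTable

namespace Presentation

variable {d : ℕ} {G : RealBWGraph d} {C : BWCode}

theorem isVertex_iff (P : Presentation G C) (v : BWVertex d) :
    G.rot.IsVertex v ↔ ∃ u ∈ P.full, (u.1, u.2.toFinset) = v :=
  P.toHalfTable.isVertex_iff G.conj_conj P.cyc v

theorem nodup_verts (P : Presentation G C) :
    (P.full.map fun u => ((u.1, u.2.toFinset) : BWVertex d)).Nodup :=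
  P.toHalfTable.nodup_verts

theorem degrees_eq (P : Presentation G C) (k : BWColour) :
    G.rot.degrees k = ((C.verts.filter fun v => v.1 = k).map Prod.snd : Multiset ℕ) := by
  classical
  have h0 : (Finset.univ.filter fun v : BWVertex d => G.rot.IsVertex v ∧ v.1 = k).val =
      (((P.full.map fun u => ((u.1, u.2.toFinset) : BWVertex d)).filter fun v => v.1 = k :
        List (BWVertex d)) : Multiset (BWVertex d)) := by
    rw [Multiset.Nodup.ext (Finset.nodup _) (Multiset.coe_nodup.2 (P.nodup_verts.filter _))]
    intro v
    simp only [Finset.mem_val, Finset.mem_filter, Finset.mem_univ, true_and, Multiset.mem_coe,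
      List.mem_filter, List.mem_map, decide_eq_true_eq, P.isVertex_iff]
  have e1 : G.rot.degrees k =
      (Finset.univ.filter fun v : BWVertex d => G.rot.IsVertex v ∧ v.1 = k).val.map
        BWVertex.degree := by
    unfold BWRotation.degrees
    congr!
  have h2 : ∀ v ∈ P.full, v.2.toFinset.card = v.2.length := fun v hv =>
    List.toFinset_card_of_nodup (P.cyc v hv).1
  rw [e1, h0, Multiset.map_coe, BWCode.verts, ← P.map_full, List.filter_map, List.filter_map,
    List.map_map, List.map_map]
  refine congrArg _ (List.map_congr_left fun v hv => ?_)
  exact h2 v (List.mem_of_mem_filter hv)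

theorem map_spine (P : Presentation G C) : G.spine.map (fun v => (v.1, v.degree)) = C.spine := by
  have e : ∀ h : G.conj P.h ≠ P.h, 1 = if G.conj P.h = P.h then 0 else 1 := fun h => by simp [h]
  have h2 := P.sideL.altern (e P.conj_h)
  have h3 := P.sideR.altern (e P.conj_h)
  rw [BWCode.spine, ← h2, ← h3, P.spine, ← List.map_reverse, ← List.map_append, List.map_map]
  refine List.map_congr_left fun v hv => Prod.ext rfl ?_
  change (dbl G.conj v.2).toFinset.card = _
  refine List.toFinset_card_of_nodup ?_
  rw [List.mem_append, List.mem_reverse] at hv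
  rcases hv with hv | hv
  · exact (P.cyc (v.1, dbl G.conj v.2) (by
      simp only [fullTable, List.mem_append, List.mem_map]; exact .inl ⟨v, hv, rfl⟩)).1
  · exact List.nodup_reverse.1 (P.cyc (v.1, (dbl G.conj v.2).reverse) (by
      simp only [fullTable, List.mem_append, List.mem_map]; exact .inr (.inl ⟨v, hv, rfl⟩))).1

theorem realDegrees_eq (P : Presentation G C) (k : BWColour) :
    G.realDegrees k = (C.spine.filter fun v => v.1 = k).map Prod.snd := by
  rw [← P.map_spine, RealBWGraph.realDegrees, List.filter_map, List.map_map]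
  rfl

theorem lev_eq (P : Presentation G C) : G.lev = C.lev := by
  rw [RealBWGraph.lev, BWCode.lev, levelDisorders, P.realDegrees_eq, P.realDegrees_eq]

theorem hole_mem_dbl (P : Presentation G C) {U : List (Fin d)} :
    G.hole ∈ dbl G.conj U ↔ P.h ∈ dbl G.conj U := by
  rw [P.hole]
  split_ifs
  · rfl
  · rw [mem_dbl G.conj_conj, mem_dbl G.conj_conj, G.conj_conj, or_comm]

/-- The left vertex of the cycle is the first real vertex that is incident to the cycle. -/
theorem findIdx_eq (P : Presentation G C) :
    G.spine.findIdx (fun v => G.hole ∈ v.2) + 1 = C.DL.length := by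
  obtain ⟨l, S, ⟨U, rfl⟩, hS⟩ := P.sideL.ne_nil
  obtain ⟨l', S', ⟨U', rfl⟩, hS'⟩ := P.sideR.ne_nil
  have hmem : ∀ (V : List (Fin d)), P.h ∈ dbl G.conj (P.h :: V) := fun V =>
    (mem_dbl G.conj_conj).2 (.inl List.mem_cons_self)
  have hno : ∀ v ∈ S, P.h ∉ dbl G.conj v.2 := by
    intro v hv hh
    have hp := P.pairwise_full
    rw [HalfTable.full, fullTable, hS, hS', List.map_cons, List.cons_append,
      List.pairwise_cons] at hp
    rcases BWColour.eq_or_eq_other C.cR v.1 with hc | hc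
    · have := (List.pairwise_append.1 hp.2).2.2 (v.1, dbl G.conj v.2)
        (List.mem_map.2 ⟨v, hv, rfl⟩) (C.cR, (dbl G.conj (P.h :: U')).reverse)
        (List.mem_append_left _ (by rw [List.map_cons]; exact List.mem_cons_self)) hc hh
      exact this (List.mem_reverse.2 (hmem _))
    · exact hp.1 (v.1, dbl G.conj v.2) (List.mem_append_left _ (List.mem_map.2 ⟨v, hv, rfl⟩))
        hc.symm (hmem _) hh
  have hl := P.sideL.length_eq
  rw [P.spine, hS, List.reverse_cons, List.append_assoc, List.map_append, List.findIdx_append,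
    if_neg]
  · rw [List.singleton_append, List.map_cons, List.findIdx_cons]
    have h1 : decide (G.hole ∈ (dbl G.conj (P.h :: U)).toFinset) = true := by
      rw [decide_eq_true_eq, List.mem_toFinset, P.hole_mem_dbl]
      exact hmem _
    simp only [h1, cond_true]
    rw [hS] at hl
    simpa using hl
  · rw [List.findIdx_lt_length]
    push Not
    intro v hv
    obtain ⟨u, hu, rfl⟩ := List.mem_map.1 hv
    simp only [ne_eq, decide_eq_true_eq, List.mem_toFinset]
    rw [P.hole_mem_dbl]
    exact hno u (List.mem_reverse.1 hu)

theorem pol_eq (P : Presentation G C) : G.pol = C.pol := by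
  have h1 := P.map_spine
  -- the left vertex of the cycle is the last one of the left side
  have h2 : G.pol = ((C.spine.take C.DL.length).map Prod.snd).countP fun s => 1 < s := by
    rw [RealBWGraph.pol, P.findIdx_eq, ← h1, ← List.map_take, List.map_map, List.countP_map]
    rfl
  rw [h2, BWCode.pol, BWCode.spine, List.take_append_of_le_length (by simp [BWCode.length_altern]),
    List.take_of_length_le (by simp [BWCode.length_altern]), List.map_reverse,
    BWCode.map_snd_altern, List.countP_reverse]

theorem sign_eq (P : Presentation G C) : G.sign = C.sign := by
  rw [RealBWGraph.sign, BWCode.sign, P.lev_eq, P.pol_eq]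

theorem sided_iff (P : Presentation G C) (k : BWColour) : G.Sided k ↔ C.Sided k := by
  have h1 := P.map_spine
  have h2 : BWCode.altern C.cR C.DR ≠ [] := by
    obtain ⟨l', S', ⟨U', rfl⟩, hS'⟩ := P.sideR.ne_nil
    have := P.sideR.length_eq
    rw [hS'] at this
    rw [← List.length_pos_iff, BWCode.length_altern, ← this]
    simp
  have h3 : (G.spine.getLast?).map Prod.fst = (BWCode.altern C.cR C.DR).getLast?.map Prod.fst := by
    have := congrArg (fun l => l.getLast?.map Prod.fst) h1
    simp only [BWCode.spine, List.getLast?_map, List.getLast?_append, Option.map_map] at this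
    rw [List.getLast?_eq_some_getLast h2] at this ⊢
    simpa [Function.comp_def] using this
  rw [BWCode.Sided, ← h3, RealBWGraph.Sided, Option.map_eq_some_iff]

/-- The number of edges is counted at the white vertices. -/
theorem valid (P : Presentation G C) : C.Valid d := by
  refine ⟨P.sideL.sideOK, P.sideR.sideOK, ?_, ?_⟩
  · rw [BWCode.stack, P.sideL.slotCols, P.sideR.slotCols, ← List.map_append]
    exact P.run.luk
  · have h1 := Multiset.coe_nodup.2 (P.nodup_full white)
    have h2 : ∀ e, e ∈ (tableAt white P.full : Multiset (Fin d)) := fun e => by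
      obtain ⟨v, hv, hc, he⟩ := P.mem_full G.conj_conj white e
      rw [Multiset.mem_coe, tableAt, List.mem_flatMap]
      exact ⟨v, by simpa [hc] using hv, he⟩
    have h3 : Multiset.card (tableAt white P.full : Multiset (Fin d)) = d := by
      have h4 : (⟨_, h1⟩ : Finset (Fin d)) = Finset.univ := by
        ext e
        simpa using h2 e
      have := congrArg Finset.card h4
      simpa using this
    rw [P.tableAt_full white, Multiset.card_add, Multiset.coe_card, Multiset.coe_card,
      List.length_map, HalfTable.edges, tails_append, tails_append] at h3
    have hL := P.sideL.length_tails
    have hR := P.sideR.length_tails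
    have hT := P.run.length_tails
    have hL' := P.sideL.length_filter_tails
    have hR' := P.sideR.length_filter_tails
    have hT' : (tails P.T).filter (fun e => G.conj e ≠ e) = tails P.T := by
      rw [List.filter_eq_self]
      intro e he
      obtain ⟨v, hv, he⟩ := List.mem_flatMap.1 he
      simpa using P.T_nonreal v hv e (List.mem_of_mem_tail he)
    rw [List.filter_cons_of_pos (by simpa using P.conj_h), List.filter_append, List.filter_append,
      hT'] at h3
    simp only [List.length_append, List.length_cons] at h3 hT
    omega

end Presentation


/-! ### Graphs with the same code are isomorphic -/

/-- A bijection between the edges in the closed upper half planes that respects the real edges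
extends to a bijection of all edges that commutes with conjugation. -/
theorem exists_equiv_of_halves {E E' : Type*} {conj : Equiv.Perm E} {conj' : Equiv.Perm E'}
    (hc : ∀ e, conj (conj e) = e) (hc' : ∀ e, conj' (conj' e) = e) {L : List E} {L' : List E'}
    (hL : L.Nodup) (hL' : L'.Nodup) (hcov : ∀ e, e ∈ L ∨ conj e ∈ L)
    (hcov' : ∀ e, e ∈ L' ∨ conj' e ∈ L') (hd : ∀ e ∈ L, conj e ∈ L → conj e = e)
    (hd' : ∀ e ∈ L', conj' e ∈ L' → conj' e = e)
    (hr : List.Forall₂ (fun x y => conj x = x ↔ conj' y = y) L L') :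
    ∃ τ : E ≃ E', L.map τ = L' ∧ ∀ e, τ (conj e) = conj' (τ e) := by
  -- the graph of `τ`: entries at the same place in both lists, and their conjugates
  let R : E → E' → Prop := fun e e' => ∃ i, ∃ h : i < L.length, ∃ h' : i < L'.length,
    (e = L[i] ∧ e' = L'[i]) ∨ (e = conj L[i] ∧ e' = conj' L'[i])
  have hlen := hr.length_eq
  have hr' : ∀ i (h : i < L.length) (h' : i < L'.length),
      conj L[i] = L[i] ↔ conj' L'[i] = L'[i] := fun i h h' => (List.forall₂_iff_get.1 hr).2 i h h'
  have hf : ∀ e e₁ e₂, R e e₁ → R e e₂ → e₁ = e₂ := by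
    rintro e e₁ e₂ ⟨i, hi, hi', h1⟩ ⟨j, hj, hj', h2⟩
    rcases h1 with ⟨h1, rfl⟩ | ⟨h1, rfl⟩ <;> rcases h2 with ⟨h2, rfl⟩ | ⟨h2, rfl⟩
    · obtain rfl := (hL.getElem_inj_iff).1 (h1.symm.trans h2)
      rfl
    · have h3 := h1.symm.trans h2
      have h4 := hd _ (List.getElem_mem hj) (h3 ▸ List.getElem_mem hi)
      obtain rfl := (hL.getElem_inj_iff).1 (h3.trans h4)
      exact ((hr' i hi hi').1 h4).symm
    · have h3 := h2.symm.trans h1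
      have h4 := hd _ (List.getElem_mem hi) (h3 ▸ List.getElem_mem hj)
      obtain rfl := (hL.getElem_inj_iff).1 (h3.trans h4)
      exact (hr' j hj hj').1 h4
    · obtain rfl := (hL.getElem_inj_iff).1 (conj.injective (h1.symm.trans h2))
      rfl
  have hg : ∀ e₁ e₂ e, R e₁ e → R e₂ e → e₁ = e₂ := by
    rintro e₁ e₂ e ⟨i, hi, hi', h1⟩ ⟨j, hj, hj', h2⟩
    rcases h1 with ⟨rfl, h1⟩ | ⟨rfl, h1⟩ <;> rcases h2 with ⟨rfl, h2⟩ | ⟨rfl, h2⟩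
    · obtain rfl := (hL'.getElem_inj_iff).1 (h1.symm.trans h2)
      rfl
    · have h3 := h1.symm.trans h2
      have h4 := hd' _ (List.getElem_mem hj') (h3 ▸ List.getElem_mem hi')
      obtain rfl := (hL'.getElem_inj_iff).1 (h3.trans h4)
      exact ((hr' i hi hi').2 h4).symm
    · have h3 := h2.symm.trans h1
      have h4 := hd' _ (List.getElem_mem hi') (h3 ▸ List.getElem_mem hj')
      obtain rfl := (hL'.getElem_inj_iff).1 (h3.trans h4)
      exact (hr' j hj hj').2 h4
    · obtain rfl := (hL'.getElem_inj_iff).1 (conj'.injective (h1.symm.trans h2))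
      rfl
  have ex : ∀ e, ∃ e', R e e' := by
    intro e
    rcases hcov e with h | h
    · obtain ⟨i, hi, rfl⟩ := List.getElem_of_mem h
      exact ⟨L'[i], i, hi, hlen ▸ hi, .inl ⟨rfl, rfl⟩⟩
    · obtain ⟨i, hi, h⟩ := List.getElem_of_mem h
      exact ⟨conj' (L'[i]'(hlen ▸ hi)), i, hi, hlen ▸ hi, .inr ⟨by rw [h, hc], rfl⟩⟩
  have ex' : ∀ e', ∃ e, R e e' := by
    intro e
    rcases hcov' e with h | h
    · obtain ⟨i, hi, rfl⟩ := List.getElem_of_mem h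
      exact ⟨L[i], i, hlen ▸ hi, hi, .inl ⟨rfl, rfl⟩⟩
    · obtain ⟨i, hi, h⟩ := List.getElem_of_mem h
      exact ⟨conj (L[i]'(hlen ▸ hi)), i, hlen ▸ hi, hi, .inr ⟨rfl, by rw [h, hc']⟩⟩
  choose f hfR using ex
  choose g hgR using ex'
  refine ⟨⟨f, g, fun e => hg _ _ _ (hgR _) (hfR e), fun e => hf _ _ _ (hfR _) (hgR e)⟩, ?_, ?_⟩
  · refine List.ext_getElem (by simpa using hlen) fun i h1 h2 => ?_
    rw [List.getElem_map]
    exact hf _ _ _ (hfR _) ⟨i, by simpa using h1, h2, .inl ⟨rfl, rfl⟩⟩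
  · intro e
    refine hf _ _ _ (hfR _) ?_
    obtain ⟨i, hi, hi', h | h⟩ := hfR e
    · exact ⟨i, hi, hi', .inr ⟨by rw [h.1], congrArg conj' h.2⟩⟩
    · exact ⟨i, hi, hi', .inl ⟨by rw [h.1, hc], (congrArg conj' h.2).trans (hc' _)⟩⟩

section Parallel

variable {E E' : Type*} {conj : Equiv.Perm E} {conj' : Equiv.Perm E'}

theorem HSide.not_nil {t : ℕ} {x : E} {c : BWColour} {S : List (BWColour × List E)}
    {sl : List (E × BWColour)} : ¬ HSide conj t x c [] S sl := fun h => h.sideOK.elim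

theorem forall₂_nonreal {as : List E} {as' : List E'} (h : ∀ a ∈ as, conj a ≠ a)
    (h' : ∀ a ∈ as', conj' a ≠ a) (hl : as.length = as'.length) :
    List.Forall₂ (fun x y => conj x = x ↔ conj' y = y) as as' := by
  rw [List.forall₂_iff_get]
  exact ⟨hl, fun i h1 h2 => iff_of_false (h _ (List.getElem_mem h1)) (h' _ (List.getElem_mem h2))⟩

/-- In two tables with the same degrees, real edges are at the same places. -/
theorem HSide.forall₂ {t : ℕ} {x : E} {x' : E'} {c : BWColour} {D : List ℕ}
    {S : List (BWColour × List E)} {sl : List (E × BWColour)}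
    {S' : List (BWColour × List E')} {sl' : List (E' × BWColour)}
    (h : HSide conj t x c D S sl) (h' : HSide conj' t x' c D S' sl') :
    List.Forall₂ (fun x y => conj x = x ↔ conj' y = y) (tails S) (tails S') := by
  induction h generalizing x' S' sl' with
  | last t x c as h =>
    generalize hD : [2 * as.length + 1 + t] = D at h'
    cases h' with
    | last _ _ _ as' h' =>
      simp only [List.cons.injEq, and_true] at hD
      simpa [tails] using forall₂_nonreal h h' (by omega)
    | cons _ _ _ _ _ D' _ _ _ _ hS' =>
      simp only [List.cons.injEq] at hD
      exact absurd (hD.2 ▸ hS') HSide.not_nil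
  | cons t x y c as D S sl h hy hS ih =>
    generalize hD : (2 * as.length + 2 + t) :: D = D' at h'
    cases h' with
    | last _ _ _ as' h' =>
      simp only [List.cons.injEq] at hD
      exact absurd (hD.2 ▸ hS) HSide.not_nil
    | cons _ _ y' _ as' D' S' sl' h' hy' hS' =>
      simp only [List.cons.injEq] at hD
      obtain ⟨hD, rfl⟩ := hD
      rw [tails_cons, tails_cons]
      exact List.rel_append (List.rel_append (forall₂_nonreal h h' (by omega))
        (.cons (iff_of_true hy hy') .nil)) (ih hS')

theorem HRun.forall₂ {st : List (E × BWColour)} {st' : List (E' × BWColour)} {w : List ℕ}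
    {T : List (BWColour × List E)} {T' : List (BWColour × List E')} (h : HRun conj st w T)
    (h' : HRun conj' st' w T') :
    List.Forall₂ (fun x y => conj x = x ↔ conj' y = y) (tails T) (tails T') := by
  induction h generalizing st' T' with
  | nil => cases h'; exact .nil
  | cons e c ch st w T h hT ih =>
    generalize hD : (ch.length + 1) :: w = w' at h'
    cases h' with
    | nil => cases hD
    | cons e' c' ch' st' w' T' h' hT' =>
      simp only [List.cons.injEq] at hD
      obtain ⟨hD, rfl⟩ := hD
      rw [tails_cons, tails_cons]
      exact List.rel_append (forall₂_nonreal h h' (by omega)) (ih hT')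

/-- The image of a table under a map of the edges. -/
def mapTable (τ : E → E') (S : List (BWColour × List E)) : List (BWColour × List E') :=
  S.map fun v => (v.1, v.2.map τ)

/-- The image of a stack under a map of the edges. -/
def mapStack (τ : E → E') (st : List (E × BWColour)) : List (E' × BWColour) :=
  st.map fun a => (τ a.1, a.2)

/-- The table of one side is determined by its degrees and by the edges that lead away. -/
theorem HSide.eq_map {τ : E → E'} {t : ℕ} {x : E} {c : BWColour} {D : List ℕ}
    {S : List (BWColour × List E)} {sl : List (E × BWColour)}
    {S' : List (BWColour × List E')} {sl' : List (E' × BWColour)}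
    (h : HSide conj t x c D S sl) (h' : HSide conj' t (τ x) c D S' sl')
    (ht : (tails S).map τ = tails S') : S' = mapTable τ S ∧ sl' = mapStack τ sl := by
  generalize hx : τ x = x' at h'
  induction h generalizing x' S' sl' with
  | last t x c as h =>
    generalize hD : [2 * as.length + 1 + t] = D at h'
    cases h' with
    | last _ _ _ as' h' =>
      simp only [tails, List.flatMap_cons, List.flatMap_nil, List.tail_cons, List.append_nil] at ht
      subst ht hx
      simp [mapTable, mapStack]
    | cons _ _ _ _ _ D' _ _ _ _ hS' =>
      simp only [List.cons.injEq] at hD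
      exact absurd (hD.2 ▸ hS') HSide.not_nil
  | cons t x y c as D S sl h hy hS ih =>
    generalize hD : (2 * as.length + 2 + t) :: D = D' at h'
    cases h' with
    | last _ _ _ as' h' =>
      simp only [List.cons.injEq] at hD
      exact absurd (hD.2 ▸ hS) HSide.not_nil
    | cons _ _ y' _ as' D' S' sl' h' hy' hS' =>
      simp only [List.cons.injEq] at hD
      obtain ⟨hD, rfl⟩ := hD
      rw [tails_cons, tails_cons, List.tail_cons, List.tail_cons, List.map_append,
        List.map_append, List.append_assoc, List.append_assoc] at ht
      obtain ⟨rfl, ht2⟩ := List.append_inj ht (by rw [List.length_map]; omega)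
      obtain ⟨hy1, ht3⟩ := List.append_inj ht2 (by simp)
      simp only [List.map_cons, List.map_nil, List.cons.injEq, and_true] at hy1
      obtain ⟨rfl, rfl⟩ := ih ht3 y' hy1 hS'
      subst hx hy1
      simp [mapTable, mapStack]

/-- The table of a forest is determined by its degrees and by the edges that lead away. -/
theorem HRun.eq_map {τ : E → E'} {st : List (E × BWColour)} {w : List ℕ}
    {T : List (BWColour × List E)} {T' : List (BWColour × List E')} (h : HRun conj st w T)
    (h' : HRun conj' (mapStack τ st) w T') (ht : (tails T).map τ = tails T') :
    T' = mapTable τ T := by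
  generalize hst : mapStack τ st = st' at h'
  induction h generalizing st' T' with
  | nil => cases hst; cases h'; rfl
  | cons e c ch st w T h hT ih =>
    generalize hD : (ch.length + 1) :: w = w' at h'
    cases h' with
    | nil => cases hD
    | cons e' c' ch' st' w' T' h' hT' =>
      simp only [List.cons.injEq] at hD
      obtain ⟨hD, rfl⟩ := hD
      simp only [mapStack, List.map_cons, List.cons.injEq, Prod.mk.injEq] at hst
      obtain ⟨⟨rfl, rfl⟩, rfl⟩ := hst
      rw [tails_cons, tails_cons, List.tail_cons, List.tail_cons, List.map_append] at ht
      obtain ⟨rfl, ht2⟩ := List.append_inj ht (by rw [List.length_map]; omega)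
      rw [ih ht2 _ (by simp [mapStack]) hT']
      simp [mapTable]

theorem dbl_map [DecidableEq E] [DecidableEq E'] {τ : E ≃ E'}
    (hτ : ∀ e, τ (conj e) = conj' (τ e)) (U : List E) :
    dbl conj' (U.map τ) = (dbl conj U).map τ := by
  have h1 : (U.map τ).filter (fun x => conj' x ≠ x) = (U.filter fun x => conj x ≠ x).map τ := by
    rw [List.filter_map]
    congr 1
    refine List.filter_congr fun x _ => ?_
    simp [← hτ]
  rw [dbl, dbl, h1]
  simp [hτ]

theorem fullTable_map [DecidableEq E] [DecidableEq E'] {τ : E ≃ E'}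
    (hτ : ∀ e, τ (conj e) = conj' (τ e)) (SL SR T : List (BWColour × List E)) :
    fullTable conj' (mapTable τ SL) (mapTable τ SR) (mapTable τ T) =
      mapTable τ (fullTable conj SL SR T) := by
  simp only [fullTable, mapTable, List.map_append, List.map_map, Function.comp_def, dbl_map hτ,
    List.map_reverse, hτ]

end Parallel

/-- Graphs with the same code are isomorphic: an isomorphism identifies the edges at the same places
in the two tables. -/
theorem Presentation.exists_isIso {d : ℕ} {G H : RealBWGraph d} {C : BWCode}
    (P : Presentation G C) (Q : Presentation H C) : ∃ τ, RealBWGraph.IsIso G H τ := by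
  have hr : List.Forall₂ (fun x y => G.conj x = x ↔ H.conj y = y) P.edges Q.edges := by
    refine .cons (iff_of_false P.conj_h Q.conj_h) ?_
    rw [tails_append, tails_append, tails_append, tails_append]
    exact List.rel_append (List.rel_append (P.sideL.forall₂ Q.sideL) (P.sideR.forall₂ Q.sideR))
      (P.run.forall₂ Q.run)
  obtain ⟨τ, hτL, hτ⟩ := exists_equiv_of_halves G.conj_conj H.conj_conj P.nodup Q.nodup P.cover
    Q.cover P.disj Q.disj hr
  simp only [List.map_cons, List.cons.injEq] at hτL
  obtain ⟨hh, ht⟩ := hτL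
  rw [tails_append, tails_append, tails_append, tails_append, List.map_append,
    List.map_append] at ht
  have hlen : ∀ {x : Fin d} {x' : Fin d} {c D S sl S' sl'}, HSide G.conj 1 x c D S sl →
      HSide H.conj 1 x' c D S' sl' → ((tails S).map τ).length = (tails S').length := by
    intro x x' c D S sl S' sl' h h'
    rw [List.length_map, (h.forall₂ h').length_eq]
  have hRl := hlen P.sideR Q.sideR
  have hLl := hlen P.sideL Q.sideL
  obtain ⟨ht, htT⟩ := List.append_inj ht (by simp only [List.length_append]; omega)
  obtain ⟨htL, htR⟩ := List.append_inj ht hLl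
  obtain ⟨hSL, hslL⟩ := P.sideL.eq_map (by rw [hh]; exact Q.sideL) htL
  obtain ⟨hSR, hslR⟩ := P.sideR.eq_map (by rw [hh]; exact Q.sideR) htR
  have hT := P.run.eq_map (τ := τ) (T' := Q.T) (by
    have := Q.run
    rwa [hslL, hslR, mapStack, mapStack, ← List.map_append] at this) htT
  have hfull : Q.full = mapTable τ P.full := by
    rw [HalfTable.full, HalfTable.full, hSL, hSR, hT, fullTable_map hτ]
  refine ⟨τ, ?_, ?_, fun e => (hτ e).symm, ?_⟩
  · intro k e
    obtain ⟨v, hv, rfl, he⟩ := P.mem_full G.conj_conj k e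
    have h1 := Q.cyc (v.1, v.2.map τ) (by
      change _ ∈ Q.full
      rw [hfull]
      exact List.mem_map.2 ⟨v, hv, rfl⟩)
    have h2 := P.cyc v hv
    obtain ⟨i, hi, rfl⟩ := List.getElem_of_mem he
    have h3 := h1.apply_getElem i (by simpa using hi)
    rw [h2.apply_getElem i hi]
    simpa using h3
  · rw [Q.hole, P.hole, ← hh, ← hτ]
    split_ifs <;> rfl
  · rw [Q.spine, P.spine, hSL, hSR, mapTable, mapTable, ← List.map_reverse, ← List.map_append,
      List.map_map, List.map_map]
    refine List.map_congr_left fun v _ => Prod.ext rfl ?_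
    ext e
    change e ∈ (dbl H.conj (v.2.map τ)).toFinset ↔ e ∈ (dbl G.conj v.2).toFinset.map τ.toEmbedding
    rw [dbl_map hτ, List.mem_toFinset, Finset.mem_map_equiv, List.mem_toFinset, List.mem_map]
    exact ⟨by rintro ⟨a, ha, rfl⟩; simpa using ha, fun h => ⟨_, h, by simp⟩⟩

/-! ### The code is determined by the isomorphism class -/

section Unique

variable {E E' : Type*} [DecidableEq E] [DecidableEq E'] {conj : Equiv.Perm E}
  {conj' : Equiv.Perm E'}

/-- A cyclic order is determined by its first entry and the permutation. -/
theorem Cyc.eq_of_cons [Finite E] {σ : Equiv.Perm E} {x : E} {l l' : List E}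
    (h : Cyc σ (x :: l)) (h' : Cyc σ (x :: l')) : l = l' := by
  have hlen : (x :: l).length = (x :: l').length := by
    refine List.Perm.length_eq ((List.perm_ext_iff_of_nodup h.1 h'.1).2 fun y => ?_)
    rw [← h.sameCycle_iff List.mem_cons_self, ← h'.sameCycle_iff List.mem_cons_self]
  have key : ∀ i (h1 : i < (x :: l).length) (h2 : i < (x :: l').length),
      (x :: l)[i] = (x :: l')[i] := by
    intro i
    induction i with
    | zero => intros; rfl
    | succ i ih =>
      intro h1 h2
      have e1 := h.apply_getElem i (by omega)
      have e2 := h'.apply_getElem i (by omega)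
      simp only [Nat.mod_eq_of_lt h1] at e1
      simp only [Nat.mod_eq_of_lt h2] at e2
      rw [← e1, ← e2, ih]
  exact (List.cons.inj (List.ext_getElem hlen key)).2

/-- An isomorphism respects the slots of the sides: around each vertex they follow the first edge in
the cyclic order. -/
theorem HSide.eq_map_of_cyc [Finite E'] {τ : E ≃ E'} (hτ : ∀ e, τ (conj e) = conj' (τ e))
    {σ : BWColour → Equiv.Perm E} {σ' : BWColour → Equiv.Perm E'}
    (hσ : ∀ k e, σ' k (τ e) = τ (σ k e)) {t : ℕ} {x : E} {c : BWColour} {D : List ℕ}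
    {S : List (BWColour × List E)} {sl : List (E × BWColour)}
    {S' : List (BWColour × List E')} {sl' : List (E' × BWColour)}
    (h : HSide conj t x c D S sl) (h' : HSide conj' t (τ x) c D S' sl')
    (hS : ∀ v ∈ S, Cyc (σ v.1) (dbl conj v.2)) (hS' : ∀ v ∈ S', Cyc (σ' v.1) (dbl conj' v.2)) :
    sl' = mapStack τ sl := by
  have key : ∀ (c : BWColour) (x : E) (U : List E) (U' : List E'), U.length = U'.length →
      Cyc (σ c) (dbl conj (x :: U)) → Cyc (σ' c) (dbl conj' (τ x :: U')) → U' = U.map τ := by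
    intro c x U U' hl h1 h2
    have h3 := h1.map (hσ c)
    rw [← dbl_map hτ] at h3
    have h4 := h2.eq_of_cons h3
    exact (List.append_inj h4 (by simpa using hl.symm)).1
  generalize hx : τ x = x' at h'
  induction h generalizing x' S' sl' with
  | last t x c as h =>
    generalize hD : [2 * as.length + 1 + t] = D at h'
    cases h' with
    | last _ _ _ as' h' =>
      subst hx
      simp only [List.cons.injEq, and_true] at hD
      obtain rfl := key c x as as' (by omega) (hS _ List.mem_cons_self) (hS' _ List.mem_cons_self)
      simp [mapStack]
    | cons _ _ _ _ _ D' _ _ _ _ hSS' =>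
      simp only [List.cons.injEq] at hD
      exact absurd (hD.2 ▸ hSS') HSide.not_nil
  | cons t x y c as D S sl h hy hSS ih =>
    generalize hD : (2 * as.length + 2 + t) :: D = D' at h'
    cases h' with
    | last _ _ _ as' h' =>
      simp only [List.cons.injEq] at hD
      exact absurd (hD.2 ▸ hSS) HSide.not_nil
    | cons _ _ y' _ as' D' S' sl' h' hy' hSS' =>
      subst hx
      simp only [List.cons.injEq] at hD
      obtain ⟨hD, rfl⟩ := hD
      have h5 := key c x (as ++ [y]) (as' ++ [y']) (by
        simp only [List.length_append, List.length_cons, List.length_nil]; omega)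
        (hS _ List.mem_cons_self) (hS' _ List.mem_cons_self)
      rw [List.map_append] at h5
      obtain ⟨rfl, h6⟩ := List.append_inj h5 (by rw [List.length_map]; omega)
      simp only [List.map_cons, List.map_nil, List.cons.injEq, and_true] at h6
      rw [ih (fun v hv => hS v (List.mem_cons_of_mem _ hv))
        (fun v hv => hS' v (List.mem_cons_of_mem _ hv)) y' h6.symm hSS']
      simp [mapStack]

/-- An isomorphism respects the forests that hang on given edges. -/
theorem HRun.eq_of_cyc [Finite E'] {τ : E ≃ E'}
    {σ : BWColour → Equiv.Perm E} {σ' : BWColour → Equiv.Perm E'}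
    (hσ : ∀ k e, σ' k (τ e) = τ (σ k e)) {st : List (E × BWColour)} {w w' : List ℕ}
    {T : List (BWColour × List E)} {T' : List (BWColour × List E')} (h : HRun conj st w T)
    (h' : HRun conj' (mapStack τ st) w' T') (hT : ∀ v ∈ T, Cyc (σ v.1) v.2)
    (hT' : ∀ v ∈ T', Cyc (σ' v.1) v.2) : w' = w := by
  generalize hst : mapStack τ st = st' at h'
  induction h generalizing st' T' w' with
  | nil => cases hst; cases h'; rfl
  | cons e c ch st w T h hTT ih =>
    cases h' with
    | nil => cases hst
    | cons e' c' ch' st' w' T' h' hTT' =>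
      simp only [mapStack, List.map_cons, List.cons.injEq, Prod.mk.injEq] at hst
      obtain ⟨⟨rfl, rfl⟩, rfl⟩ := hst
      have h1 := (hT _ List.mem_cons_self).map (hσ c)
      obtain rfl := (hT' _ List.mem_cons_self).eq_of_cons h1
      rw [ih (fun v hv => hT v (List.mem_cons_of_mem _ hv))
        (fun v hv => hT' v (List.mem_cons_of_mem _ hv)) _ (by simp [mapStack]) hTT']
      simp

end Unique

/-- Isomorphic graphs have the same code.  The degrees of the real vertices can be read off from the
list of the real vertices, and the forest from the rotation. -/
theorem Presentation.code_unique {d : ℕ} {G H : RealBWGraph d} {C C' : BWCode}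
    (P : Presentation G C) (Q : Presentation H C') {τ : Equiv.Perm (Fin d)}
    (hτ : RealBWGraph.IsIso G H τ) : C' = C := by
  have h1 : C'.spine = C.spine := by
    rw [← P.map_spine, ← Q.map_spine, hτ.spine, List.map_map]
    refine List.map_congr_left fun v _ => Prod.ext rfl ?_
    exact RealBWGraph.degree_relabel τ v
  have h2 : C'.DL.length = C.DL.length := by
    rw [← P.findIdx_eq, ← Q.findIdx_eq, hτ.spine, List.findIdx_map]
    congr 2
    funext v
    simp [BWVertex.relabel, hτ.hole]
  obtain ⟨h3, h4⟩ := List.append_inj h1 (by simpa [BWCode.length_altern] using h2)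
  have hL : C'.DL = C.DL := by
    have := congrArg (List.map Prod.snd) (List.reverse_injective h3)
    simpa [BWCode.map_snd_altern] using this
  have hR : C'.DR = C.DR := by
    have := congrArg (List.map Prod.snd) h4
    simpa [BWCode.map_snd_altern] using this
  have hne : C.DR ≠ [] := fun h => by
    have := P.sideR.sideOK
    rw [h] at this
    exact this
  have hc : C'.cR = C.cR := by
    rw [hR] at h4
    obtain ⟨s, D, hD⟩ := List.exists_cons_of_ne_nil hne
    rw [hD] at h4
    exact (Prod.ext_iff.1 (List.cons.inj h4).1).1
  have hconj : ∀ e, τ (G.conj e) = H.conj (τ e) := fun e => (hτ.conj e).symm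
  have hh : τ P.h = Q.h := by
    have e1 := P.hole
    have e2 := Q.hole
    rw [hτ.hole, e1, hc] at e2
    by_cases h : C.cR = black
    · simpa [h] using e2
    · simp only [h, if_false, hconj] at e2
      exact H.conj.injective e2
  have hrot : ∀ k e, H.rot k (τ e) = τ (G.rot k e) := hτ.rot
  have hrot' : ∀ k e, (H.rot k)⁻¹ (τ e) = τ ((G.rot k)⁻¹ e) := by
    intro k e
    rw [Equiv.Perm.inv_eq_iff_eq, hrot]
    simp
  have hmem : ∀ {conj : Equiv.Perm (Fin d)} {SL SR T : List (BWColour × List (Fin d))},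
      (∀ v ∈ SL, (v.1, dbl conj v.2) ∈ fullTable conj SL SR T) ∧
      (∀ v ∈ SR, (v.1, (dbl conj v.2).reverse) ∈ fullTable conj SL SR T) ∧
      (∀ v ∈ T, v ∈ fullTable conj SL SR T) := by
    intro conj SL SR T
    simp only [fullTable, List.mem_append, List.mem_map]
    exact ⟨fun v hv => .inl ⟨v, hv, rfl⟩, fun v hv => .inr (.inl ⟨v, hv, rfl⟩),
      fun v hv => .inr (.inr (.inl hv))⟩
  have hsL : Q.slL = mapStack τ P.slL := by
    refine P.sideL.eq_map_of_cyc hconj hrot (S' := Q.SL) ?_ (fun v hv => P.cyc _ (hmem.1 v hv))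
      (fun v hv => Q.cyc _ (hmem.1 v hv))
    have := Q.sideL
    rwa [hc, hL, ← hh] at this
  have hsR : Q.slR = mapStack τ P.slR := by
    refine P.sideR.eq_map_of_cyc (σ := fun k => (G.rot k)⁻¹) (σ' := fun k => (H.rot k)⁻¹)
      hconj hrot' (S' := Q.SR) ?_ (fun v hv => cyc_reverse_iff.1 (P.cyc _ (hmem.2.1 v hv)))
      (fun v hv => cyc_reverse_iff.1 (Q.cyc _ (hmem.2.1 v hv)))
    have := Q.sideR
    rwa [hc, hR, ← hh] at this
  have hw : C'.w = C.w := by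
    refine P.run.eq_of_cyc (σ := G.rot) (σ' := H.rot) hrot (T' := Q.T) (conj' := H.conj) ?_
      (fun v hv => P.cyc _ (hmem.2.2 v hv)) (fun v hv => Q.cyc _ (hmem.2.2 v hv))
    have := Q.run
    rwa [hsL, hsR, mapStack, mapStack, ← List.map_append] at this
  cases C
  cases C'
  simp_all


/-! ### Counting edges and vertices -/

section Vert

variable {d : ℕ}

open Classical in
/-- The end of colour `c` of the edge `e`. -/
noncomputable def vert (rot : BWRotation d) (c : BWColour) (e : Fin d) : BWVertex d :=
  (c, Finset.univ.filter fun f => (rot c).SameCycle e f)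

theorem mem_vert {rot : BWRotation d} {c : BWColour} {e f : Fin d} :
    f ∈ (vert rot c e).2 ↔ (rot c).SameCycle e f := by simp [vert]

theorem vert_eq_iff {rot : BWRotation d} {c : BWColour} {e f : Fin d} :
    vert rot c e = vert rot c f ↔ (rot c).SameCycle e f := by
  constructor
  · intro h
    rw [← mem_vert, h, mem_vert]
  · intro h
    refine Prod.ext rfl (Finset.ext fun g => ?_)
    rw [mem_vert, mem_vert]
    exact ⟨h.symm.trans, h.trans⟩

theorem isVertex_vert (rot : BWRotation d) (c : BWColour) (e : Fin d) :
    rot.IsVertex (vert rot c e) := ⟨e, fun _ => mem_vert⟩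

theorem BWRotation.IsVertex.eq_vert {rot : BWRotation d} {v : BWVertex d} (h : rot.IsVertex v)
    {e : Fin d} (he : e ∈ v.2) : v = vert rot v.1 e := by
  obtain ⟨f, hf⟩ := h
  refine Prod.ext rfl (Finset.ext fun g => ?_)
  rw [mem_vert, hf]
  exact ⟨((hf e).1 he).symm.trans, ((hf e).1 he).trans⟩

theorem BWRotation.IsVertex.exists_mem {rot : BWRotation d} {v : BWVertex d}
    (h : rot.IsVertex v) : ∃ e, v = vert rot v.1 e := by
  obtain ⟨f, hf⟩ := id h
  exact ⟨f, h.eq_vert ((hf f).2 (Equiv.Perm.SameCycle.refl _ _))⟩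

theorem vert_ne {rot : BWRotation d} {c k : BWColour} (h : c ≠ k) (e f : Fin d) :
    vert rot c e ≠ vert rot k f := fun h' => h (congrArg Prod.fst h')

theorem skeleton_adj_vert (rot : BWRotation d) (e : Fin d) :
    rot.skeleton.Adj ⟨vert rot white e, isVertex_vert _ _ _⟩
      ⟨vert rot black e, isVertex_vert _ _ _⟩ :=
  ⟨by simp [vert], e, mem_vert.2 (Equiv.Perm.SameCycle.refl _ _),
    mem_vert.2 (Equiv.Perm.SameCycle.refl _ _)⟩

end Vert

namespace BWGraph

variable {d : ℕ} (G : BWGraph d)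

theorem parallel_hole : G.rot.Parallel G.hole (G.rot black G.hole) := by
  intro k
  cases k
  · have : (G.rot white).SameCycle (G.rot black G.hole) (G.rot white (G.rot black G.hole)) :=
      Equiv.Perm.sameCycle_apply_right.2 (Equiv.Perm.SameCycle.refl _ _)
    rw [G.hole_face] at this
    exact this.symm
  · exact Equiv.Perm.sameCycle_apply_right.2 (Equiv.Perm.SameCycle.refl _ _)

open Classical in
/-- A connected graph with exactly one cycle has as many vertices as edges. -/
theorem card_vertices : (Finset.univ.filter fun v => G.rot.IsVertex v).card = d := by
  -- the skeleton is a tree, and its edges are the edges of the graph other than `hole`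
  have hT : G.rot.skeleton.IsTree := ⟨G.connected, G.acyclic⟩
  have h1 := hT.card_edgeFinset
  have h2 : Fintype.card {v // G.rot.IsVertex v} =
      (Finset.univ.filter fun v => G.rot.IsVertex v).card := Fintype.card_subtype _
  have h3 : G.rot.skeleton.edgeFinset.card = (Finset.univ.erase G.hole).card := by
    symm
    refine Finset.card_bij (fun e _ => s(⟨vert G.rot white e, isVertex_vert _ _ _⟩,
      ⟨vert G.rot black e, isVertex_vert _ _ _⟩)) ?_ ?_ ?_
    · intro e _
      rw [SimpleGraph.mem_edgeFinset, SimpleGraph.mem_edgeSet]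
      exact skeleton_adj_vert G.rot e
    · intro e he f hf hef
      by_contra hne
      have hp : G.rot.Parallel e f := by
        rw [Sym2.eq_iff] at hef
        rcases hef with ⟨h, h'⟩ | ⟨h, -⟩
        · intro k
          cases k
          · exact vert_eq_iff.1 (congrArg Subtype.val h)
          · exact vert_eq_iff.1 (congrArg Subtype.val h')
        · exact absurd (congrArg Subtype.val h) (vert_ne (by decide) _ _)
      rcases G.parallel e f hne hp with h | h
      · exact (Finset.mem_erase.1 he).1 h.1
      · exact (Finset.mem_erase.1 hf).1 h.2
    · intro q hq
      rw [SimpleGraph.mem_edgeFinset] at hq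
      obtain ⟨u, v⟩ := q
      rw [SimpleGraph.mem_edgeSet] at hq
      obtain ⟨hne, e, heu, hev⟩ := hq
      obtain ⟨f, hf, hff⟩ : ∃ f, f ≠ G.hole ∧ G.rot.Parallel e f := by
        by_cases h : e = G.hole
        · exact ⟨_, G.hole_ne, h ▸ G.parallel_hole⟩
        · exact ⟨e, h, fun k => Equiv.Perm.SameCycle.refl _ _⟩
      refine ⟨f, by simpa using hf, ?_⟩
      have hu := u.2.eq_vert heu
      have hv := v.2.eq_vert hev
      rw [vert_eq_iff.2 (hff _)] at hu hv
      rw [Sym2.eq_iff]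
      rcases hc : u.1.1 with _ | _
      · rw [hc] at hu hne
        rw [show v.1.1 = black from BWColour.ne_iff_eq_other.1 hne.symm] at hv
        exact .inl ⟨Subtype.ext hu.symm, Subtype.ext hv.symm⟩
      · rw [hc] at hu hne
        rw [show v.1.1 = white from BWColour.ne_iff_eq_other.1 hne.symm] at hv
        exact .inr ⟨Subtype.ext hv.symm, Subtype.ext hu.symm⟩
  rw [Finset.card_erase_of_mem (Finset.mem_univ _), Finset.card_univ, Fintype.card_fin] at h3
  have h4 : 0 < d := Fin.pos G.hole
  rw [← h2, ← h1, h3]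
  omega

/-- If a set of vertices is neither empty nor everything, some edge leaves it. -/
theorem exists_boundary (X : Finset (BWVertex d)) (hX : ∀ v ∈ X, G.rot.IsVertex v)
    {u v : BWVertex d} (hu : u ∈ X) (hv : G.rot.IsVertex v) (hvX : v ∉ X) :
    ∃ e c, vert G.rot c e ∈ X ∧ vert G.rot c.other e ∉ X := by
  obtain ⟨p⟩ := G.connected.preconnected ⟨u, hX u hu⟩ ⟨v, hv⟩
  obtain ⟨a, -, h1, h2⟩ := p.exists_boundary_dart {a | a.1 ∈ X} hu hvX
  obtain ⟨hne, e, he1, he2⟩ := a.adj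
  have e1 := a.fst.2.eq_vert he1
  have e2 := a.snd.2.eq_vert he2
  refine ⟨e, a.fst.1.1, e1 ▸ h1, ?_⟩
  rw [← BWColour.ne_iff_eq_other.1 hne.symm, ← e2]
  exact h2

open Classical in
/-- The edges with both ends in `X`. -/
noncomputable def inner (X : Finset (BWVertex d)) : Finset (Fin d) :=
  Finset.univ.filter fun e => ∀ c, vert G.rot c e ∈ X

theorem mem_inner {X : Finset (BWVertex d)} {e : Fin d} :
    e ∈ G.inner X ↔ ∀ c, vert G.rot c e ∈ X := by simp [inner]

/-- A set of vertices spans at most as many edges as it has elements. -/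
theorem card_inner_le (X : Finset (BWVertex d)) (hX : ∀ v ∈ X, G.rot.IsVertex v)
    (hne : X.Nonempty) : (G.inner X).card ≤ X.card := by
  classical
  induction hk : ((Finset.univ.filter fun v => G.rot.IsVertex v) \ X).card generalizing X with
  | zero =>
    have h1 : (Finset.univ.filter fun v => G.rot.IsVertex v) ⊆ X := by
      rwa [Finset.card_eq_zero, Finset.sdiff_eq_empty_iff_subset] at hk
    have h2 := Finset.card_le_card h1
    rw [G.card_vertices] at h2
    exact (Finset.card_le_univ _).trans (by simpa using h2)
  | succ k ih =>
    obtain ⟨v, hv⟩ := Finset.card_pos.1 (by rw [hk]; exact Nat.succ_pos k)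
    obtain ⟨hv, hvX⟩ := Finset.mem_sdiff.1 hv
    obtain ⟨u, hu⟩ := hne
    obtain ⟨e, c, he, he'⟩ := G.exists_boundary X hX hu (by simpa using hv) hvX
    have h1 := ih (insert (vert G.rot c.other e) X) (by
      intro v hv
      rcases Finset.mem_insert.1 hv with rfl | hv
      · exact isVertex_vert _ _ _
      · exact hX v hv) ⟨u, Finset.mem_insert_of_mem hu⟩ (by
      rw [Finset.sdiff_insert, Finset.card_erase_of_mem, hk, Nat.add_sub_cancel]
      simpa [he'] using isVertex_vert _ _ _)
    rw [Finset.card_insert_of_notMem he'] at h1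
    have h2 : insert e (G.inner X) ⊆ G.inner (insert (vert G.rot c.other e) X) := by
      intro f hf
      rw [mem_inner]
      rcases Finset.mem_insert.1 hf with rfl | hf
      · intro k
        rcases BWColour.eq_or_eq_other c k with rfl | rfl
        · exact Finset.mem_insert_of_mem he
        · exact Finset.mem_insert_self _ _
      · exact fun k => Finset.mem_insert_of_mem (G.mem_inner.1 hf k)
    have h3 := Finset.card_le_card h2
    rw [Finset.card_insert_of_notMem fun h => he' (G.mem_inner.1 h _)] at h3
    omega

end BWGraph


/-! ### Exploring the upper half plane -/

section Orbits

variable {E : Type*} [DecidableEq E]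

theorem Cyc.of_getElem {σ : Equiv.Perm E} {l : List E} (h : l.Nodup)
    (hl : ∀ i (hi : i < l.length), σ l[i] = l[(i + 1) % l.length]'(Nat.mod_lt _ (by omega))) :
    Cyc σ l := by
  refine ⟨h, fun x hx => ?_⟩
  obtain ⟨i, hi, rfl⟩ := List.getElem_of_mem hx
  rw [hl i hi, List.formPerm_apply_getElem _ h]

/-- The orbit of a point, with its length. -/
theorem exists_pow_period [Finite E] (σ : Equiv.Perm E) (x : E) :
    ∃ s, 0 < s ∧ (σ ^ s) x = x ∧ (∀ i j, i < s → j < s → (σ ^ i) x = (σ ^ j) x → i = j) ∧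
      Cyc σ ((List.range s).map fun i => (σ ^ i) x) := by
  have hp : x ∈ Function.periodicPts σ := σ.injective.mem_periodicPts x
  have hs := Function.minimalPeriod_pos_of_mem_periodicPts hp
  have hx : (σ ^ Function.minimalPeriod σ x) x = x := by
    rw [← Equiv.Perm.iterate_eq_pow]
    exact Function.iterate_minimalPeriod
  have hinj : ∀ i j, i < Function.minimalPeriod σ x → j < Function.minimalPeriod σ x →
      (σ ^ i) x = (σ ^ j) x → i = j := by
    intro i j hi hj hij
    rw [← Equiv.Perm.iterate_eq_pow, ← Equiv.Perm.iterate_eq_pow] at hij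
    exact Function.iterate_injOn_Iio_minimalPeriod hi hj hij
  refine ⟨_, hs, hx, hinj, Cyc.of_getElem ?_ ?_⟩
  · refine List.Nodup.map_on ?_ List.nodup_range
    intro i hi j hj hij
    exact hinj i j (List.mem_range.1 hi) (List.mem_range.1 hj) hij
  · intro i hi
    rw [List.length_map, List.length_range] at hi
    simp only [List.getElem_map, List.getElem_range, List.length_map, List.length_range]
    rw [← Equiv.Perm.mul_apply, ← pow_succ']
    rcases Nat.lt_or_ge (i + 1) (Function.minimalPeriod σ x) with h | h
    · rw [Nat.mod_eq_of_lt h]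
    · have : i + 1 = Function.minimalPeriod σ x := by omega
      rw [this, Nat.mod_self, hx]
      rfl

end Orbits

namespace RealBWGraph

variable {d : ℕ} (G : RealBWGraph d)

/-- Conjugation of vertices is given by conjugation of edges. -/
theorem relabel_vert (c : BWColour) (e : Fin d) :
    (vert G.rot c e).relabel G.conj = vert G.rot c (G.conj e) := by
  have hs : ∀ {e f}, (G.rot c).SameCycle e f → (G.rot c).SameCycle (G.conj e) (G.conj f) := by
    rintro e f h
    obtain ⟨n, rfl⟩ := h.exists_nat_pow_eq
    refine ⟨-n, ?_⟩
    rw [zpow_neg, zpow_natCast, Equiv.Perm.inv_eq_iff_eq]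
    clear h
    induction n with
    | zero => rfl
    | succ n ih =>
      have h2 := G.conj_rot c ((G.rot c ^ n) e)
      have h3 : (G.rot c ^ (n + 1)) e = G.rot c ((G.rot c ^ n) e) := by
        rw [pow_succ', Equiv.Perm.mul_apply]
      rw [h3, pow_succ, Equiv.Perm.mul_apply, h2, Equiv.apply_symm_apply, ← ih]
  refine Prod.ext rfl (Finset.ext fun f => ?_)
  change f ∈ (vert G.rot c e).2.map G.conj.toEmbedding ↔ _
  rw [Finset.mem_map_equiv, mem_vert, mem_vert]
  have h1 : G.conj.symm f = G.conj f := by rw [Equiv.symm_apply_eq, G.conj_conj]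
  rw [h1]
  exact ⟨fun h => by simpa [G.conj_conj] using hs h, fun h => by simpa [G.conj_conj] using hs h⟩

theorem vert_mem_spine {c : BWColour} {e : Fin d} :
    vert G.rot c e ∈ G.spine ↔ vert G.rot c (G.conj e) = vert G.rot c e := by
  rw [G.mem_spine, relabel_vert]
  simp [isVertex_vert]

/-- Depth-first exploration of the upper half plane: if the vertices in `X` have been visited, if
they span as many edges as there are of them, and if the edges in `st` are those which lead from
`X` into the remaining part of the upper half plane, then this part is a forest.  The list `L`
consists of the edges met so far, one of every conjugate pair.  The reason is that the graph has a
single cycle, so that a set of vertices that already spans as many edges as it has elements can be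
left only along edges that lead to different new vertices (`card_inner_le`). -/
theorem exists_run (n : ℕ) : ∀ (X : Finset (BWVertex d)) (L : List (Fin d))
    (st : List (Fin d × BWColour)),
    (Finset.univ \ X).card < n →
    X.Nonempty → (∀ v ∈ X, G.rot.IsVertex v) → (∀ v ∈ G.spine, v ∈ X) →
    (∀ c e, vert G.rot c e ∈ X → vert G.rot c (G.conj e) ∈ X) →
    X.card ≤ (G.inner X).card → L.Nodup → (∀ e ∈ L, G.conj e ∈ L → G.conj e = e) →
    (∀ e, (∃ c, vert G.rot c e ∈ X) ↔ e ∈ L ∨ G.conj e ∈ L) →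
    (∀ a ∈ st, a.1 ∈ L ∧ vert G.rot a.2.other a.1 ∈ X ∧ vert G.rot a.2 a.1 ∉ X) →
    (∀ e ∈ L, e ∉ G.inner X → ∃ a ∈ st, a.1 = e) → (st.map Prod.fst).Nodup →
    ∃ w T, HRun G.conj st w T ∧ (∀ v ∈ T, Cyc (G.rot v.1) v.2) ∧ (L ++ tails T).Nodup ∧
      (∀ e ∈ L ++ tails T, G.conj e ∈ L ++ tails T → G.conj e = e) ∧
      (∀ e, e ∈ L ++ tails T ∨ G.conj e ∈ L ++ tails T) := by
  induction n with
  | zero => intros; omega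
  | succ n ih =>
    intro X L st hn hne hX hsp hconj hcard hL hd hcov hst hst2 hst3
    match st, hst, hst2, hst3 with
    | [], hst, hst2, hst3 =>
      refine ⟨[], [], .nil, by simp, by simpa [tails] using hL, by simpa [tails] using hd, ?_⟩
      simp only [tails, List.flatMap_nil, List.append_nil]
      intro e
      rw [← hcov]
      by_contra hcon
      push Not at hcon
      obtain ⟨u, hu⟩ := hne
      obtain ⟨f, c, hf, hf'⟩ := G.exists_boundary X hX hu (isVertex_vert _ white e) (hcon white)
      rcases (hcov f).1 ⟨c, hf⟩ with h | h
      · obtain ⟨a, ha, -⟩ := hst2 f h fun h => hf' (G.mem_inner.1 h _)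
        simp at ha
      · obtain ⟨a, ha, -⟩ := hst2 _ h fun h => hf' (by
          have := hconj _ _ (G.mem_inner.1 h c.other)
          rwa [G.conj_conj] at this)
        simp at ha
    | (e, c) :: st, hst, hst2, hst3 =>
      obtain ⟨heL, he1, he2⟩ := hst _ List.mem_cons_self
      dsimp only at heL he1 he2
      -- the far end of `e` is neither visited nor real
      have hv' : vert G.rot c (G.conj e) ∉ X := fun h => he2 (by
        have := hconj _ _ h
        rwa [G.conj_conj] at this)
      have hvv : vert G.rot c (G.conj e) ≠ vert G.rot c e := fun h =>
        he2 (hsp _ (G.vert_mem_spine.2 h))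
      have hee : G.conj e ≠ e := fun h => hvv (by rw [h])
      obtain ⟨s, hs, -, -, hcyc⟩ := exists_pow_period (G.rot c) e
      obtain ⟨k, rfl⟩ : ∃ k, s = k + 1 := ⟨s - 1, by omega⟩
      rw [List.range_succ_eq_map, List.map_cons, pow_zero, Equiv.Perm.one_apply,
        List.map_map] at hcyc
      generalize hch : List.map ((fun i => (G.rot c ^ i) e) ∘ Nat.succ) (List.range k) = ch
        at hcyc
      have hmem : ∀ f, vert G.rot c f = vert G.rot c e ↔ f = e ∨ f ∈ ch := by
        intro f
        rw [eq_comm, vert_eq_iff, hcyc.sameCycle_iff List.mem_cons_self, List.mem_cons]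
      -- the next vertex is visited together with its mirror image
      set X' := insert (vert G.rot c e) (insert (vert G.rot c (G.conj e)) X) with hX'
      have hXX' : ∀ v ∈ X, v ∈ X' := fun v hv =>
        Finset.mem_insert_of_mem (Finset.mem_insert_of_mem hv)
      have hvX' : vert G.rot c e ∈ X' := Finset.mem_insert_self _ _
      have hvX'' : vert G.rot c (G.conj e) ∈ X' :=
        Finset.mem_insert_of_mem (Finset.mem_insert_self _ _)
      have hcardX' : X'.card = X.card + 2 := by
        rw [hX', Finset.card_insert_of_notMem, Finset.card_insert_of_notMem hv']
        rw [Finset.mem_insert]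
        push Not
        exact ⟨hvv.symm, he2⟩
      have hX'v : ∀ v ∈ X', G.rot.IsVertex v := by
        intro v hv
        rcases Finset.mem_insert.1 hv with rfl | hv
        · exact isVertex_vert _ _ _
        rcases Finset.mem_insert.1 hv with rfl | hv
        · exact isVertex_vert _ _ _
        · exact hX v hv
      -- the new vertices contribute no edges but `e` and its conjugate, as there is only one cycle
      have hin : insert e (insert (G.conj e) (G.inner X)) = G.inner X' := by
        have h1 : insert e (insert (G.conj e) (G.inner X)) ⊆ G.inner X' := by
          intro f hf
          rw [G.mem_inner]
          intro k
          rcases Finset.mem_insert.1 hf with rfl | hf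
          · rcases BWColour.eq_or_eq_other c k with rfl | rfl
            · exact hvX'
            · exact hXX' _ he1
          rcases Finset.mem_insert.1 hf with rfl | hf
          · rcases BWColour.eq_or_eq_other c k with rfl | rfl
            · exact hvX''
            · exact hXX' _ (hconj _ _ he1)
          · exact hXX' _ (G.mem_inner.1 hf k)
        refine Finset.eq_of_subset_of_card_le h1 ?_
        have h2 := G.card_inner_le X' hX'v ⟨_, hvX'⟩
        rw [Finset.card_insert_of_notMem, Finset.card_insert_of_notMem]
        · omega
        · exact fun h => hv' (G.mem_inner.1 h c)
        · rw [Finset.mem_insert]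
          push Not
          exact ⟨hee.symm, fun h => he2 (G.mem_inner.1 h c)⟩
      have hche : ∀ f ∈ ch, f ≠ e := fun f hf h => (List.nodup_cons.1 hcyc.1).1 (h ▸ hf)
      have hch1 : ∀ f ∈ ch, vert G.rot c f = vert G.rot c e := fun f hf => (hmem f).2 (.inr hf)
      have hconjv : ∀ {f g : Fin d}, vert G.rot c f = vert G.rot c g →
          vert G.rot c (G.conj f) = vert G.rot c (G.conj g) := by
        intro f g h
        rw [← G.relabel_vert, h, G.relabel_vert]
      have hch2 : ∀ f ∈ ch, vert G.rot c.other f ∉ X' := by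
        intro f hf h
        have h1 : f ∈ G.inner X' := by
          rw [G.mem_inner]
          intro k
          rcases BWColour.eq_or_eq_other c k with rfl | rfl
          · rw [hch1 f hf]; exact hvX'
          · exact h
        rw [← hin, Finset.mem_insert, Finset.mem_insert] at h1
        rcases h1 with h1 | h1 | h1
        · exact hche f hf h1
        · exact hvv (by rw [← h1, hch1 f hf])
        · exact he2 (by rw [← hch1 f hf]; exact G.mem_inner.1 h1 c)
      have hchX : ∀ f ∈ ch, ∀ k, vert G.rot k f ∉ X := by
        intro f hf k
        rcases BWColour.eq_or_eq_other c k with rfl | rfl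
        · rw [hch1 f hf]; exact he2
        · exact fun h => hch2 f hf (hXX' _ h)
      have hchL : ∀ f ∈ ch, f ∉ L ∧ G.conj f ∉ L := by
        intro f hf
        have h1 : ¬ (f ∈ L ∨ G.conj f ∈ L) := by
          rw [← hcov]
          rintro ⟨k, hk⟩
          exact hchX f hf k hk
        exact not_or.1 h1
      have hchc : ∀ f ∈ ch, G.conj f ∉ ch := by
        intro f hf h
        exact hvv (by rw [← hch1 _ h, hconjv (hch1 f hf)])
      have hchr : ∀ f ∈ ch, G.conj f ≠ f := fun f hf h => hchc f hf (by rwa [h])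
      have hsub : (Finset.univ \ X').card < n := by
        have h1 : X'.card ≤ Fintype.card (BWVertex d) := Finset.card_le_univ _
        rw [Finset.card_sdiff_of_subset (Finset.subset_univ _), Finset.card_univ] at hn ⊢
        omega
      have hclosed : ∀ k f, vert G.rot k f ∈ X' → vert G.rot k (G.conj f) ∈ X' := by
        intro k f hf
        rcases Finset.mem_insert.1 hf with h | hf
        · obtain rfl : k = c := congrArg Prod.fst h
          rw [hconjv h]
          exact hvX''
        rcases Finset.mem_insert.1 hf with h | hf
        · obtain rfl : k = c := congrArg Prod.fst h
          rw [hconjv h, G.conj_conj]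
          exact hvX'
        · exact hXX' _ (hconj _ _ hf)
      obtain ⟨w, T, hrun, hT, h1, h2, h3⟩ := ih X' (L ++ ch)
        ((ch.map fun a => (a, c.other)) ++ st) hsub ⟨_, hvX'⟩ hX'v (fun v hv => hXX' _ (hsp v hv))
        hclosed (by
          rw [← hin, hcardX', Finset.card_insert_of_notMem, Finset.card_insert_of_notMem]
          · omega
          · exact fun h => hv' (G.mem_inner.1 h c)
          · rw [Finset.mem_insert]
            push Not
            exact ⟨hee.symm, fun h => he2 (G.mem_inner.1 h c)⟩)
        (List.nodup_append'.2 ⟨hL, (List.nodup_cons.1 hcyc.1).2, fun f hf hf' =>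
          (hchL f hf').1 hf⟩)
        (by
          intro f hf hf'
          rcases List.mem_append.1 hf with hf | hf <;> rcases List.mem_append.1 hf' with hf' | hf'
          · exact hd f hf hf'
          · exact absurd (by rwa [G.conj_conj]) (hchL _ hf').2
          · exact absurd hf' (hchL _ hf).2
          · exact absurd hf' (hchc f hf))
        (by
          intro f
          simp only [List.mem_append]
          constructor
          · rintro ⟨k, hk⟩
            rcases Finset.mem_insert.1 hk with h | hk
            · obtain rfl : k = c := congrArg Prod.fst h
              rcases (hmem f).1 h with rfl | h
              · exact .inl (.inl heL)
              · exact .inl (.inr h)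
            rcases Finset.mem_insert.1 hk with h | hk
            · obtain rfl : k = c := congrArg Prod.fst h
              have h' := hconjv h
              rw [G.conj_conj] at h'
              rcases (hmem _).1 h' with h | h
              · exact .inr (.inl (h ▸ heL))
              · exact .inr (.inr h)
            · rcases (hcov f).1 ⟨k, hk⟩ with h | h
              · exact .inl (.inl h)
              · exact .inr (.inl h)
          · rintro ((h | h) | (h | h))
            · obtain ⟨k, hk⟩ := (hcov f).2 (.inl h)
              exact ⟨k, hXX' _ hk⟩
            · exact ⟨c, by rw [hch1 f h]; exact hvX'⟩
            · obtain ⟨k, hk⟩ := (hcov f).2 (.inr h)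
              exact ⟨k, hXX' _ hk⟩
            · refine ⟨c, ?_⟩
              have := hclosed c _ (by rw [hch1 _ h]; exact hvX')
              rwa [G.conj_conj] at this)
        (by
          intro a ha
          rcases List.mem_append.1 ha with ha | ha
          · obtain ⟨f, hf, rfl⟩ := List.mem_map.1 ha
            refine ⟨List.mem_append_right _ hf, ?_, hch2 f hf⟩
            simp only [BWColour.other_other]
            rw [hch1 f hf]
            exact hvX'
          · obtain ⟨g1, g2, g3⟩ := hst a (List.mem_cons_of_mem _ ha)
            refine ⟨List.mem_append_left _ g1, hXX' _ g2, fun h => ?_⟩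
            have h1 : a.1 ∈ G.inner X' := by
              rw [G.mem_inner]
              intro k
              rcases BWColour.eq_or_eq_other a.2 k with h' | h'
              · rw [h']; exact h
              · rw [h']; exact hXX' _ g2
            rw [← hin, Finset.mem_insert, Finset.mem_insert] at h1
            rcases h1 with h1 | h1 | h1
            · rw [List.map_cons, List.nodup_cons] at hst3
              exact hst3.1 (List.mem_map.2 ⟨a, ha, h1⟩)
            · exact hee (hd e heL (h1 ▸ g1))
            · exact g3 (G.mem_inner.1 h1 _))
        (by
          intro f hf hf'
          rcases List.mem_append.1 hf with hf | hf
          · rw [← hin, Finset.mem_insert, Finset.mem_insert] at hf'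
            push Not at hf'
            obtain ⟨a, ha, rfl⟩ := hst2 f hf hf'.2.2
            rcases List.mem_cons.1 ha with rfl | ha
            · exact absurd rfl hf'.1
            · exact ⟨a, List.mem_append_right _ ha, rfl⟩
          · exact ⟨(f, c.other), List.mem_append_left _ (List.mem_map.2 ⟨f, hf, rfl⟩), rfl⟩)
        (by
          rw [List.map_cons, List.nodup_cons] at hst3
          rw [List.map_append, List.map_map, List.nodup_append']
          refine ⟨?_, hst3.2, ?_⟩
          · simpa [Function.comp_def] using (List.nodup_cons.1 hcyc.1).2
          · intro f hf hf'
            obtain ⟨g, hg, rfl⟩ := List.mem_map.1 hf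
            obtain ⟨a, ha, ha'⟩ := List.mem_map.1 hf'
            exact (hchL g hg).1 (by
              have := (hst a (List.mem_cons_of_mem _ ha)).1
              rw [ha'] at this
              exact this))
      refine ⟨_, (c, e :: ch) :: T, .cons e c ch st w T hchr hrun, ?_, ?_⟩
      · intro v hv
        rcases List.mem_cons.1 hv with rfl | hv
        · exact hcyc
        · exact hT v hv
      · rw [tails_cons, List.tail_cons, ← List.append_assoc]
        exact ⟨h1, h2, h3⟩

end RealBWGraph


/-! ### The real vertices -/

section Dihedral

variable {E : Type*} {σ κ : Equiv.Perm E} {x : E} {t s : ℕ}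

/-- A reflection of a cycle of length `s`, in terms of the powers of the rotation. -/
theorem reflect_pow (hκ : ∀ e, κ (σ e) = σ⁻¹ (κ e)) (ht : (σ ^ t) (κ x) = x)
    (hs : (σ ^ s) x = x) (m : ℕ) (hm : m + t ≤ s) : κ ((σ ^ m) x) = (σ ^ (s - t - m)) x := by
  have h1 : (σ ^ m) (κ ((σ ^ m) x)) = κ x := by
    clear hm
    induction m with
    | zero => rfl
    | succ n ih =>
      have h3 : (σ ^ (n + 1)) x = σ ((σ ^ n) x) := by rw [pow_succ', Equiv.Perm.mul_apply]
      rw [h3, pow_succ, Equiv.Perm.mul_apply, hκ, ← Equiv.Perm.mul_apply σ, mul_inv_cancel,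
        Equiv.Perm.one_apply, ih]
  apply (σ ^ (t + m)).injective
  rw [pow_add, Equiv.Perm.mul_apply, h1, ht, ← pow_add, ← Equiv.Perm.mul_apply, ← pow_add,
    show t + m + (s - t - m) = s by omega, hs]

/-- The mirror images of `k` consecutive edges. -/
theorem map_reflect_reverse (hκ : ∀ e, κ (σ e) = σ⁻¹ (κ e)) (ht : (σ ^ t) (κ x) = x)
    (hs : (σ ^ s) x = x) (k : ℕ) (hk : k + t ≤ s) :
    (((List.range k).map fun i => (σ ^ (1 + i)) x).map κ).reverse =
      (List.range k).map fun i => (σ ^ (s - t - k + i)) x := by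
  refine List.ext_getElem (by simp) fun i h1 h2 => ?_
  simp only [List.length_map, List.length_range] at h2
  simp only [List.getElem_reverse, List.getElem_map, List.length_map, List.length_range,
    List.getElem_range]
  rw [reflect_pow hκ ht hs _ (by omega)]
  congr 2
  omega

variable [DecidableEq E] [Finite E]

/-- If a vertex has no real edge except possibly `x`, the edges around it are obtained by
reflection from `x` and some non-real edges. -/
theorem exists_dbl_last (hκ : ∀ e, κ (σ e) = σ⁻¹ (κ e))
    (ht : (σ ^ t) (κ x) = x) (ht' : t = if κ x = x then 0 else 1)
    (hr : ∀ f, σ.SameCycle x f → κ f = f → f = x) :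
    ∃ as : List E, (∀ a ∈ as, κ a ≠ a) ∧ Cyc σ (dbl κ (x :: as)) := by
  obtain ⟨s, hs0, hs, hinj, hcyc⟩ := exists_pow_period σ x
  have ht1 : t ≤ 1 := by rw [ht']; split_ifs <;> simp
  -- otherwise the edge opposite to the starting point of the reflection would be real
  obtain ⟨k, hk⟩ : ∃ k, s = 2 * k + 1 + t := by
    by_contra hcon
    have h2 : ∃ j, s = 2 * j + t := by
      rcases Nat.even_or_odd' (s - t) with ⟨j, h | h⟩
      · exact ⟨j, by omega⟩
      · exact absurd ⟨j, by omega⟩ hcon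
    obtain ⟨j, hj⟩ := h2
    have h3 : κ ((σ ^ j) x) = (σ ^ j) x := by
      rw [reflect_pow hκ ht hs j (by omega)]
      congr 2
      omega
    have h4 := hr _ ⟨j, rfl⟩ h3
    by_cases hx : κ x = x
    · have := hinj j 0 (by simp [hx] at ht'; omega) hs0 h4
      simp [hx] at ht'
      omega
    · exact hx (h4 ▸ h3)
  have hne : ∀ a ∈ (List.range k).map (fun i => (σ ^ (1 + i)) x), κ a ≠ a := by
    intro a ha h
    obtain ⟨i, hi, rfl⟩ := List.mem_map.1 ha
    rw [List.mem_range] at hi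
    rw [reflect_pow hκ ht hs _ (by omega)] at h
    have := hinj _ _ (by omega) (by omega) h
    omega
  refine ⟨_, hne, ?_⟩
  convert hcyc using 1
  rw [dbl_last hne, map_reflect_reverse hκ ht hs k (by omega), hk,
    show 2 * k + 1 + t = 1 + (k + (k + t)) by omega, List.range_add, List.range_add,
    List.range_add]
  simp only [List.map_append, List.map_map, List.range_one, List.map_cons,
    List.singleton_append, pow_zero, Equiv.Perm.one_apply, Function.comp_def]
  congr 3
  · refine List.map_congr_left fun i _ => ?_
    congr 2
    omega
  · by_cases hx : κ x = x
    · simp [hx] at ht'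
      simp [hx, ht']
    · simp only [hx, if_false] at ht'
      subst ht'
      have h5 := reflect_pow hκ ht hs 0 (by omega)
      simp only [hx, if_false, List.range_one, List.map_cons, List.map_nil]
      rw [pow_zero, Equiv.Perm.one_apply] at h5
      rw [h5]
      congr 3
      omega

/-- If a vertex has a real edge `y` other than `x`, the edges around it are obtained by
reflection from `x`, some non-real edges, and `y`. -/
theorem exists_dbl_cons (hκ : ∀ e, κ (σ e) = σ⁻¹ (κ e))
    (ht : (σ ^ t) (κ x) = x) (ht' : t = if κ x = x then 0 else 1) {y : E}
    (hy : σ.SameCycle x y) (hyr : κ y = y) (hyx : y ≠ x) :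
    ∃ as : List E, (∀ a ∈ as, κ a ≠ a) ∧ Cyc σ (dbl κ (x :: (as ++ [y]))) := by
  obtain ⟨s, hs0, hs, hinj, hcyc⟩ := exists_pow_period σ x
  have ht1 : t ≤ 1 := by rw [ht']; split_ifs <;> simp
  obtain ⟨j, hj, hjy⟩ : ∃ j < s, (σ ^ j) x = y := by
    have h1 : x ∈ (List.range s).map fun i => (σ ^ i) x :=
      List.mem_map.2 ⟨0, List.mem_range.2 hs0, rfl⟩
    rw [hcyc.sameCycle_iff h1, List.mem_map] at hy
    obtain ⟨j, hj, h⟩ := hy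
    exact ⟨j, List.mem_range.1 hj, h⟩
  have hj0 : j ≠ 0 := by
    rintro rfl
    exact hyx hjy.symm
  -- the two real directions are opposite to one another
  have hjs : s = 2 * j + t := by
    rw [← hjy, reflect_pow hκ ht hs _ (by omega)] at hyr
    have := hinj _ _ (by omega) hj hyr
    omega
  obtain ⟨k, rfl⟩ : ∃ k, j = k + 1 := ⟨j - 1, by omega⟩
  have hne : ∀ a ∈ (List.range k).map (fun i => (σ ^ (1 + i)) x), κ a ≠ a := by
    intro a ha h
    obtain ⟨i, hi, rfl⟩ := List.mem_map.1 ha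
    rw [List.mem_range] at hi
    rw [reflect_pow hκ ht hs _ (by omega)] at h
    have := hinj _ _ (by omega) (by omega) h
    omega
  refine ⟨_, hne, ?_⟩
  convert hcyc using 1
  rw [dbl_cons hne hyr, map_reflect_reverse hκ ht hs k (by omega),
    show s = 1 + (k + (1 + (k + t))) by omega, List.range_add, List.range_add,
    List.range_add, List.range_add]
  simp only [List.map_append, List.map_map, List.range_one, List.map_cons,
    List.singleton_append, pow_zero, Equiv.Perm.one_apply, Function.comp_def]
  congr 4
  · rw [← hjy]
    congr 2
    omega
  · refine List.map_congr_left fun i _ => ?_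
    congr 2
    omega
  · by_cases hx : κ x = x
    · simp [hx] at ht'
      simp [hx, ht']
    · simp only [hx, if_false] at ht'
      subst ht'
      have h5 := reflect_pow hκ ht hs 0 (by omega)
      simp only [hx, if_false, List.range_one, List.map_cons, List.map_nil]
      rw [pow_zero, Equiv.Perm.one_apply] at h5
      rw [h5]
      congr 3
      omega

end Dihedral

/-- Consecutive real vertices in the list are joined by real edges, the first one contains the edge
`x`, and the last one has no other real edge. -/
inductive SpineChain {d : ℕ} (conj : Equiv.Perm (Fin d)) : Fin d → List (BWVertex d) → Prop
  | last (x : Fin d) (v : BWVertex d) (h : ∀ f ∈ v.2, conj f = f → f = x) : SpineChain conj x [v]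
  | cons (x y : Fin d) (u v : BWVertex d) (vs : List (BWVertex d)) (hy : conj y = y)
      (hyu : y ∈ u.2) (hyv : y ∈ v.2) (hyx : y ≠ x) (huv : u ≠ v)
      (h : SpineChain conj y (v :: vs)) : SpineChain conj x (u :: v :: vs)

namespace RealBWGraph

variable {d : ℕ} (G : RealBWGraph d)

/-- The real vertices on one side of the bounded face form a table of the right shape.  The
permutations `δ` are the rotations on the left and their inverses on the right. -/
theorem exists_side {δ : BWColour → Equiv.Perm (Fin d)}
    (hδ : ∀ k e, G.conj (δ k e) = (δ k)⁻¹ (G.conj e))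
    (hδs : ∀ k e f, (δ k).SameCycle e f ↔ (G.rot k).SameCycle e f) {x : Fin d}
    {vs : List (BWVertex d)} (h : SpineChain G.conj x vs) (hvs : ∀ v ∈ vs, G.rot.IsVertex v)
    (c : BWColour) (hx : ∀ v ∈ vs.head?, x ∈ v.2 ∧ v.1 = c) (t : ℕ)
    (ht : t = if G.conj x = x then 0 else 1) (ht' : ((δ c) ^ t) (G.conj x) = x) :
    ∃ D S sl, HSide G.conj t x c D S sl ∧ (∀ u ∈ S, Cyc (δ u.1) (dbl G.conj u.2)) ∧
      S.map (fun v => (v.1, (dbl G.conj v.2).toFinset)) = vs := by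
  have key : ∀ {v : BWVertex d} {x : Fin d} {U : List (Fin d)}, G.rot.IsVertex v → x ∈ v.2 →
      Cyc (δ v.1) (dbl G.conj (x :: U)) → (v.1, (dbl G.conj (x :: U)).toFinset) = v := by
    intro v x U hv hxv hU
    refine Prod.ext rfl (Finset.ext fun f => ?_)
    have h1 : x ∈ dbl G.conj (x :: U) := (mem_dbl G.conj_conj).2 (.inl List.mem_cons_self)
    rw [List.mem_toFinset, ← hU.sameCycle_iff h1, hδs, ← mem_vert, ← hv.eq_vert hxv]
  induction h generalizing c t with
  | last x v h =>
    obtain ⟨hxv, rfl⟩ := hx v rfl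
    have hv := hvs v List.mem_cons_self
    obtain ⟨as, has, hcyc⟩ := exists_dbl_last (hδ v.1) ht' ht (fun f hf hfr => h f (by
      rw [hδs, ← mem_vert, ← hv.eq_vert hxv] at hf
      exact hf) hfr)
    exact ⟨_, _, _, .last t x v.1 as has, by simpa using hcyc, by simp [key hv hxv hcyc]⟩
  | cons x y u v vs hy hyu hyv hyx huv h ih =>
    obtain ⟨hxu, rfl⟩ := hx u rfl
    have hu := hvs u List.mem_cons_self
    have hv := hvs v (List.mem_cons_of_mem _ List.mem_cons_self)
    obtain ⟨as, has, hcyc⟩ := exists_dbl_cons (hδ u.1) ht' ht (y := y) (by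
      rw [hδs, ← mem_vert, ← hu.eq_vert hxu]
      exact hyu) hy hyx
    have hc : v.1 = u.1.other := by
      rw [← BWColour.ne_iff_eq_other]
      intro hc
      exact huv ((hu.eq_vert hyu).trans (by rw [← hc, ← hv.eq_vert hyv]))
    obtain ⟨D, S, sl, hS, hS1, hS2⟩ := ih (fun w hw => hvs w (List.mem_cons_of_mem _ hw))
      u.1.other (by
        rintro w hw
        obtain rfl : v = w := by simpa using hw
        exact ⟨hyv, hc⟩) 0 (by simp [hy]) (by simpa using hy)
    refine ⟨_, _, _, .cons t x y u.1 as D S sl has hy hS, ?_, ?_⟩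
    · intro w hw
      rcases List.mem_cons.1 hw with rfl | hw
      · exact hcyc
      · exact hS1 w hw
    · rw [List.map_cons, hS2, key hu hxu hcyc]

theorem conj_hole_ne : G.conj G.hole ≠ G.hole := by
  rw [G.conj_hole]
  exact G.hole_ne

theorem vert_mem_spine_of_real {e : Fin d} (he : G.conj e = e) (c : BWColour) :
    vert G.rot c e ∈ G.spine := by
  rw [G.vert_mem_spine, he]

theorem vert_hole_mem_spine (c : BWColour) : vert G.rot c G.hole ∈ G.spine := by
  rw [G.vert_mem_spine, G.conj_hole, eq_comm, vert_eq_iff]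
  exact G.parallel_hole c

theorem vert_conj_hole (c : BWColour) : vert G.rot c (G.conj G.hole) = vert G.rot c G.hole := by
  rw [G.conj_hole, eq_comm, vert_eq_iff]
  exact G.parallel_hole c

/-- The edges between consecutive real vertices.  One of them is an edge of the cycle, and apart
from the conjugate of that edge there are no other edges between real vertices: a set of vertices does not
span more edges than it has elements. -/
theorem exists_spine_edges : ∃ (J : ℕ → Fin d) (p : ℕ), p + 1 < G.spine.length ∧
    (∀ i (hi : i + 1 < G.spine.length), J i ∈ G.spine[i].2 ∧ J i ∈ G.spine[i + 1].2) ∧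
    J p = G.hole ∧ (∀ i, i + 1 < G.spine.length → i ≠ p → G.conj (J i) = J i) ∧
    (∀ i j, i + 1 < G.spine.length → j + 1 < G.spine.length → J i = J j → i = j) ∧
    (∀ e ∈ G.inner G.spine.toFinset, e = G.conj G.hole ∨ ∃ i, i + 1 < G.spine.length ∧ e = J i) ∧
    (G.inner G.spine.toFinset).card = G.spine.length := by
  have h0 : ∀ i, ∃ e : Fin d, ∀ hi : i + 1 < G.spine.length,
      e ∈ G.spine[i].2 ∧ e ∈ G.spine[i + 1].2 ∧ (G.conj e = e ∨ e = G.hole) := by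
    intro i
    by_cases hi : i + 1 < G.spine.length
    · obtain ⟨e, he⟩ := List.isChain_iff_getElem.1 G.spine_chain i hi
      exact ⟨e, fun _ => he⟩
    · exact ⟨G.hole, fun h => absurd h hi⟩
  choose J hJ using h0
  have hvert : ∀ i (hi : i < G.spine.length) e, e ∈ G.spine[i].2 →
      G.spine[i] = vert G.rot G.spine[i].1 e := fun i hi e he =>
    ((G.mem_spine _).1 (List.getElem_mem hi)).1.eq_vert he
  have hcol : ∀ i (hi : i + 1 < G.spine.length), G.spine[i + 1].1 = G.spine[i].1.other := by
    intro i hi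
    rw [← BWColour.ne_iff_eq_other]
    intro hc
    have h1 := hvert i (by omega) _ (hJ i hi).1
    have h2 := hvert (i + 1) hi _ (hJ i hi).2.1
    rw [hc, ← h1] at h2
    have := (G.spine_nodup.getElem_inj_iff).1 h2
    omega
  have hends : ∀ i (hi : i + 1 < G.spine.length) j (hj : j < G.spine.length),
      J i ∈ G.spine[j].2 → j = i ∨ j = i + 1 := by
    intro i hi j hj h
    have h1 := hvert i (by omega) _ (hJ i hi).1
    have h2 := hvert (i + 1) hi _ (hJ i hi).2.1
    have h3 := hvert j hj _ h
    rcases BWColour.eq_or_eq_other G.spine[i].1 G.spine[j].1 with hc | hc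
    · rw [hc, ← h1] at h3
      exact .inl ((G.spine_nodup.getElem_inj_iff).1 h3)
    · rw [hc, ← hcol i hi, ← h2] at h3
      exact .inr ((G.spine_nodup.getElem_inj_iff).1 h3)
  have hinj : ∀ i j, i + 1 < G.spine.length → j + 1 < G.spine.length → J i = J j → i = j := by
    intro i j hi hj hij
    have h1 := hends i hi j (by omega) (hij ▸ (hJ j hj).1)
    have h2 := hends i hi (j + 1) hj (hij ▸ (hJ j hj).2.1)
    omega
  have hX : ∀ v ∈ G.spine.toFinset, G.rot.IsVertex v := fun v hv =>
    ((G.mem_spine v).1 (List.mem_toFinset.1 hv)).1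
  have hpos : 0 < G.spine.length := List.length_pos_of_mem (G.vert_hole_mem_spine white)
  have hcard : G.spine.toFinset.card = G.spine.length := List.toFinset_card_of_nodup G.spine_nodup
  have hle := G.card_inner_le G.spine.toFinset hX
    ⟨_, List.mem_toFinset.2 (G.vert_hole_mem_spine white)⟩
  rw [hcard] at hle
  have hin : ∀ i, i + 1 < G.spine.length → J i ∈ G.inner G.spine.toFinset := by
    intro i hi
    rw [G.mem_inner]
    intro c
    rw [List.mem_toFinset]
    rcases (hJ i hi).2.2 with h | h
    · exact G.vert_mem_spine_of_real h c
    · rw [h]; exact G.vert_hole_mem_spine c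
  have hin1 : G.hole ∈ G.inner G.spine.toFinset := G.mem_inner.2 fun c =>
    List.mem_toFinset.2 (G.vert_hole_mem_spine c)
  have hin2 : G.conj G.hole ∈ G.inner G.spine.toFinset := G.mem_inner.2 fun c =>
    List.mem_toFinset.2 (by rw [G.vert_conj_hole]; exact G.vert_hole_mem_spine c)
  set I := (Finset.range (G.spine.length - 1)).image J with hI
  have hIsub : I ⊆ G.inner G.spine.toFinset := by
    intro e he
    obtain ⟨i, hi, rfl⟩ := Finset.mem_image.1 he
    rw [Finset.mem_range] at hi
    exact hin i (by omega)
  have hIcard : I.card = G.spine.length - 1 := by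
    rw [hI, Finset.card_image_of_injOn, Finset.card_range]
    intro i hi j hj hij
    rw [Finset.mem_coe, Finset.mem_range] at hi hj
    exact hinj i j (by omega) (by omega) hij
  have hnot : G.conj G.hole ∉ I := by
    intro h
    obtain ⟨i, hi, h⟩ := Finset.mem_image.1 h
    rw [Finset.mem_range] at hi
    rcases (hJ i (by omega)).2.2 with h' | h'
    · rw [h, G.conj_conj] at h'
      exact G.conj_hole_ne h'.symm
    · exact G.conj_hole_ne (h.symm.trans h')
  -- otherwise both edges of the cycle would be outside the chain, which is too many
  have hp : G.hole ∈ I := by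
    by_contra h
    have h1 : insert G.hole (insert (G.conj G.hole) I) ⊆ G.inner G.spine.toFinset := by
      intro e he
      rcases Finset.mem_insert.1 he with rfl | he
      · exact hin1
      rcases Finset.mem_insert.1 he with rfl | he
      · exact hin2
      · exact hIsub he
    have h2 := Finset.card_le_card h1
    rw [Finset.card_insert_of_notMem, Finset.card_insert_of_notMem hnot] at h2
    · omega
    · rw [Finset.mem_insert]
      push Not
      exact ⟨G.conj_hole_ne.symm, h⟩
  -- there are `length - 1` edges in the chain, and one more, so that the bound is attained
  have hall : insert (G.conj G.hole) I = G.inner G.spine.toFinset := by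
    refine Finset.eq_of_subset_of_card_le (Finset.insert_subset hin2 hIsub) ?_
    rw [Finset.card_insert_of_notMem hnot]
    omega
  obtain ⟨p, hpr, hp⟩ := Finset.mem_image.1 hp
  rw [Finset.mem_range] at hpr
  refine ⟨J, p, by omega, fun i hi => ⟨(hJ i hi).1, (hJ i hi).2.1⟩, hp, ?_, hinj, ?_, ?_⟩
  · intro i hi hip
    exact (hJ i hi).2.2.resolve_right fun h => hip (hinj i p hi (by omega) (h.trans hp.symm))
  · intro e he
    rw [← hall, Finset.mem_insert] at he
    refine he.imp_right fun h => ?_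
    obtain ⟨i, hi, rfl⟩ := Finset.mem_image.1 h
    rw [Finset.mem_range] at hi
    exact ⟨i, by omega, rfl⟩
  · rw [← hall, Finset.card_insert_of_notMem hnot, hIcard]
    omega

end RealBWGraph


/-! ### Every real graph has a code -/

section Near

variable {E : Type*}

/-- The slots occur in the lists of their near ends. -/
theorem HSide.stackAt_le {conj : Equiv.Perm E} {t : ℕ} {x : E} {c : BWColour} {D : List ℕ}
    {S : List (BWColour × List E)} {sl : List (E × BWColour)} (h : HSide conj t x c D S sl)
    (k : BWColour) :
    (if c = k then {x} else 0) + (stackAt k.other sl : Multiset E) ≤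
      (tableAt k S : Multiset E) := by
  induction h with
  | last t x c as h =>
    rw [tableAt_cons, stackAt_map]
    rcases BWColour.eq_or_eq_other c k with rfl | rfl
    · simp [tableAt]
    · simp
  | cons t x y c as D S sl h hy hS ih =>
    rw [tableAt_cons, stackAt_append, stackAt_map, ← Multiset.coe_add, ← Multiset.coe_add]
    rcases BWColour.eq_or_eq_other c k with rfl | rfl
    · simp only [if_true, BWColour.other_ne, if_false, zero_add] at ih ⊢
      rw [← add_assoc]
      refine add_le_add ?_ ih
      rw [← Multiset.cons_coe, ← Multiset.coe_add, ← Multiset.singleton_add]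
      exact add_le_add_right (Multiset.le_add_right _ _) _
    · simp only [BWColour.other_other, BWColour.ne_other, BWColour.other_ne, if_true, if_false,
        zero_add, Multiset.coe_nil] at ih ⊢
      exact (Multiset.le_add_left _ _).trans ih

end Near

namespace RealBWGraph

variable {d : ℕ} (G : RealBWGraph d)

/-- The real vertices to the right and to the left of the cycle edge in the chain, read away from
it. -/
theorem exists_chains {J : ℕ → Fin d} {p : ℕ} (hp : p + 1 < G.spine.length)
    (hJ : ∀ i (hi : i + 1 < G.spine.length), J i ∈ G.spine[i].2 ∧ J i ∈ G.spine[i + 1].2)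
    (hJp : J p = G.hole)
    (hreal : ∀ i, i + 1 < G.spine.length → i ≠ p → G.conj (J i) = J i)
    (hinj : ∀ i j, i + 1 < G.spine.length → j + 1 < G.spine.length → J i = J j → i = j)
    (hall : ∀ e ∈ G.inner G.spine.toFinset, e = G.conj G.hole ∨
      ∃ i, i + 1 < G.spine.length ∧ e = J i) (h : Fin d) (hh : G.conj h ≠ h) :
    SpineChain G.conj h (G.spine.drop (p + 1)) ∧
      SpineChain G.conj h (G.spine.take (p + 1)).reverse := by
  have hvert : ∀ i (hi : i < G.spine.length) e, e ∈ G.spine[i].2 →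
      G.spine[i] = vert G.rot G.spine[i].1 e := fun i hi e he =>
    ((G.mem_spine _).1 (List.getElem_mem hi)).1.eq_vert he
  have hne : ∀ i j (hi : i < G.spine.length) (hj : j < G.spine.length), i ≠ j →
      G.spine[i] ≠ G.spine[j] := fun i j hi hj hij h =>
    hij ((G.spine_nodup.getElem_inj_iff).1 h)
  have hcol : ∀ i (hi : i + 1 < G.spine.length), G.spine[i + 1].1 = G.spine[i].1.other := by
    intro i hi
    rw [← BWColour.ne_iff_eq_other]
    intro hc
    have h1 := hvert i (by omega) _ (hJ i hi).1
    have h2 := hvert (i + 1) hi _ (hJ i hi).2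
    rw [hc, ← h1] at h2
    exact hne (i + 1) i hi (by omega) (by omega) h2
  have hends : ∀ i (hi : i + 1 < G.spine.length) j (hj : j < G.spine.length),
      J i ∈ G.spine[j].2 → j = i ∨ j = i + 1 := by
    intro i hi j hj h
    have h1 := hvert i (by omega) _ (hJ i hi).1
    have h2 := hvert (i + 1) hi _ (hJ i hi).2
    have h3 := hvert j hj _ h
    rcases BWColour.eq_or_eq_other G.spine[i].1 G.spine[j].1 with hc | hc
    · rw [hc, ← h1] at h3
      exact .inl ((G.spine_nodup.getElem_inj_iff).1 h3)
    · rw [hc, ← hcol i hi, ← h2] at h3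
      exact .inr ((G.spine_nodup.getElem_inj_iff).1 h3)
  -- a real edge is one of the edges `J i`, and its ends are the `i`-th and the next vertex
  have hf : ∀ f, G.conj f = f → ∀ j (hj : j < G.spine.length), f ∈ G.spine[j].2 →
      ∃ i, i + 1 < G.spine.length ∧ i ≠ p ∧ f = J i ∧ (j = i ∨ j = i + 1) := by
    intro f hf j hj hfj
    rcases hall f (G.mem_inner.2 fun c => List.mem_toFinset.2 (G.vert_mem_spine_of_real hf c)) with
      rfl | ⟨i, hi, rfl⟩
    · rw [G.conj_conj] at hf
      exact absurd hf.symm G.conj_hole_ne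
    · refine ⟨i, hi, ?_, rfl, hends i hi j hj hfj⟩
      rintro rfl
      rw [hJp] at hf
      exact G.conj_hole_ne hf
  constructor
  · have key : ∀ m i x, i + 1 + m = G.spine.length → 0 < m → p ≤ i →
        ((x = J i ∧ i ≠ p) ∨ (i = p ∧ G.conj x ≠ x)) →
        SpineChain G.conj x (G.spine.drop (i + 1)) := by
      intro m
      induction m with
      | zero => intros; omega
      | succ m ih =>
        intro i x him _ hpi hx
        rw [List.drop_eq_getElem_cons (by omega : i + 1 < G.spine.length)]
        rcases Nat.eq_zero_or_pos m with rfl | hm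
        · rw [List.drop_eq_nil_of_le (by omega)]
          refine .last _ _ fun f hfv hfr => ?_
          obtain ⟨j, hj, hjp, rfl, hji⟩ := hf f hfr _ _ hfv
          obtain rfl : j = i := by omega
          exact (hx.resolve_right fun h => hjp h.1).1.symm
        · rw [List.drop_eq_getElem_cons (by omega : i + 1 + 1 < G.spine.length)]
          have hr := hreal (i + 1) (by omega) (by omega)
          refine .cons x (J (i + 1)) _ _ _ hr (hJ (i + 1) (by omega)).1 (hJ (i + 1) (by omega)).2
            ?_ (hne _ _ _ _ (by omega)) ?_
          · rcases hx with ⟨rfl, -⟩ | ⟨-, hx⟩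
            · exact fun h => by
                have := hinj _ _ (by omega) (by omega) h
                omega
            · rintro rfl
              exact hx hr
          · rw [← List.drop_eq_getElem_cons]
            exact ih (i + 1) _ (by omega) hm (by omega) (.inl ⟨rfl, by omega⟩)
    exact key (G.spine.length - (p + 1)) p h (by omega) (by omega) le_rfl (.inr ⟨rfl, hh⟩)
  · have key : ∀ i x, i ≤ p → ((x = J i ∧ i ≠ p) ∨ (i = p ∧ G.conj x ≠ x)) →
        SpineChain G.conj x (G.spine.take (i + 1)).reverse := by
      intro i
      induction i with
      | zero =>
        intro x _ hx
        have h0 : 0 < G.spine.length := by omega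
        have h1 : (G.spine.take (0 + 1)).reverse = [G.spine[0]] := by
          rw [List.take_succ_eq_append_getElem h0]
          simp
        rw [h1]
        refine .last _ _ fun f hfv hfr => ?_
        obtain ⟨j, hj, hjp, rfl, hji⟩ := hf f hfr _ _ hfv
        obtain rfl : j = 0 := by omega
        exact (hx.resolve_right fun h => hjp h.1).1.symm
      | succ i ih =>
        intro x hip hx
        have hr := hreal i (by omega) (by omega)
        have h2 := ih (J i) (by omega) (.inl ⟨rfl, by omega⟩)
        rw [List.take_succ_eq_append_getElem (by omega : i + 1 < G.spine.length),
          List.reverse_append, List.reverse_singleton, List.singleton_append]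
        rw [List.take_succ_eq_append_getElem (by omega : i < G.spine.length),
          List.reverse_append, List.reverse_singleton, List.singleton_append] at h2 ⊢
        refine .cons x (J i) _ _ _ hr (hJ i (by omega)).2 (hJ i (by omega)).1 ?_
          (hne _ _ _ _ (by omega)) h2
        rcases hx with ⟨rfl, -⟩ | ⟨-, hx⟩
        · exact fun h => by
            have := hinj _ _ (by omega) (by omega) h
            omega
        · rintro rfl
          exact hx hr
    exact key p h le_rfl (.inr ⟨rfl, hh⟩)

/-- Every real graph is presented by a code. -/
theorem exists_presentation : ∃ C, Nonempty (Presentation G C) := by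
  obtain ⟨J, p, hp, hJ, hJp, hreal, hinj, hall, hcard⟩ := G.exists_spine_edges
  set c := G.spine[p + 1].1 with hc
  -- `h` is the upper edge of the cycle
  obtain ⟨h, hhole⟩ : ∃ h, G.hole = if c = black then h else G.conj h := by
    by_cases hb : c = black
    · exact ⟨G.hole, by simp [hb]⟩
    · exact ⟨G.conj G.hole, by simp [hb, G.conj_conj]⟩
  have hh' : h = G.hole ∨ h = G.conj G.hole := by
    split_ifs at hhole
    · exact .inl hhole.symm
    · exact .inr (by rw [hhole, G.conj_conj])
  have hh : G.conj h ≠ h := by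
    rcases hh' with rfl | rfl
    · exact G.conj_hole_ne
    · rw [G.conj_conj]; exact G.conj_hole_ne.symm
  have hvh : ∀ k, vert G.rot k h = vert G.rot k G.hole := by
    rcases hh' with rfl | rfl
    · exact fun _ => rfl
    · exact G.vert_conj_hole
  obtain ⟨hchR, hchL⟩ := G.exists_chains hp hJ hJp hreal hinj hall h hh
  have hvtx : ∀ v ∈ G.spine, G.rot.IsVertex v := fun v hv => ((G.mem_spine v).1 hv).1
  have hhmem : ∀ v, G.rot.IsVertex v → G.hole ∈ v.2 → h ∈ v.2 := by
    intro v hv hm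
    have h1 := hv.eq_vert hm
    rw [h1, ← hvh, mem_vert]
  have hcR : ∀ k e, G.conj ((G.rot k)⁻¹ e) = ((G.rot k)⁻¹)⁻¹ (G.conj e) := by
    intro k e
    rw [inv_inv, ← Equiv.Perm.inv_eq_iff_eq]
    have := G.conj_rot k ((G.rot k)⁻¹ e)
    rw [show G.rot k ((G.rot k)⁻¹ e) = e from (G.rot k).apply_symm_apply e] at this
    exact this.symm
  have hcc : G.spine[p].1 = c.other := by
    rw [← BWColour.ne_iff_eq_other]
    intro hcp
    have h1 := (hvtx _ (List.getElem_mem (by omega : p < G.spine.length))).eq_vert (hJ p hp).1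
    have h2 := (hvtx _ (List.getElem_mem hp)).eq_vert (hJ p hp).2
    rw [hcp, hc, ← h2] at h1
    have := (G.spine_nodup.getElem_inj_iff).1 h1
    omega
  -- the face inside the cycle determines the rotation at its two vertices
  have hrot : G.rot c h = G.conj h ∧ G.rot c.other (G.conj h) = h := by
    have h1 := G.conj_hole
    have h2 := G.hole_face
    rw [← h1] at h2
    cases hb : c with
    | black =>
      rw [hb, if_pos rfl] at hhole
      subst hhole
      exact ⟨h1.symm, h2⟩
    | white =>
      rw [hb, if_neg (by simp)] at hhole
      rw [hhole, G.conj_conj] at h1 h2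
      exact ⟨h2, h1.symm⟩
  obtain ⟨hrotR, hrotL⟩ := hrot
  obtain ⟨DR, SR, slR, hSR, hcycR, hmapR⟩ := G.exists_side (δ := fun k => (G.rot k)⁻¹) hcR
    (fun k e f => Equiv.Perm.sameCycle_inv) hchR
    (fun v hv => hvtx v (List.mem_of_mem_drop hv)) c (by
      intro v hv
      rw [List.drop_eq_getElem_cons hp, List.head?_cons] at hv
      obtain rfl : G.spine[p + 1] = v := by simpa using hv
      exact ⟨hhmem _ (hvtx _ (List.getElem_mem _)) (hJp ▸ (hJ p hp).2), rfl⟩) 1 (by simp [hh])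
    (by rw [pow_one, ← hrotR]; simp)
  obtain ⟨DL, SL, slL, hSL, hcycL, hmapL⟩ := G.exists_side (δ := G.rot) G.conj_rot
    (fun k e f => Iff.rfl) hchL
    (fun v hv => hvtx v (List.mem_of_mem_take (List.mem_reverse.1 hv))) c.other (by
      intro v hv
      rw [List.take_succ_eq_append_getElem (by omega : p < G.spine.length),
          List.reverse_append, List.reverse_singleton, List.singleton_append] at hv
      obtain rfl : G.spine[p] = v := by simpa using hv
      exact ⟨hhmem _ (hvtx _ (List.getElem_mem _)) (hJp ▸ (hJ p hp).1), hcc⟩) 1 (by simp [hh])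
    (by rw [pow_one, hrotL])
  have hspine : G.spine = (SL.reverse ++ SR).map fun v => (v.1, (dbl G.conj v.2).toFinset) := by
    rw [List.map_append, List.map_reverse, hmapL, hmapR, List.reverse_reverse,
      List.take_append_drop]
  set X := G.spine.toFinset with hX
  have hmemX : ∀ {v}, v ∈ X ↔ v ∈ G.spine := List.mem_toFinset
  have hclosed : ∀ k e, vert G.rot k e ∈ X → vert G.rot k (G.conj e) ∈ X := by
    intro k e
    rw [hmemX, hmemX, G.vert_mem_spine]
    intro hk
    rw [hk, G.vert_mem_spine]
    exact hk
  -- the edges at the real vertices of colour `k`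
  have hTmem : ∀ k e, e ∈ tableAt k ((SL ++ SR).map fun v => (v.1, dbl G.conj v.2)) ↔
      vert G.rot k e ∈ X := by
    intro k e
    have h1 : e ∈ tableAt k ((SL ++ SR).map fun v => (v.1, dbl G.conj v.2)) ↔
        ∃ u ∈ SL ++ SR, u.1 = k ∧ e ∈ dbl G.conj u.2 := by
      simp only [tableAt, List.mem_flatMap, List.mem_filter, List.mem_map, decide_eq_true_eq]
      constructor
      · rintro ⟨_, ⟨⟨u, hu, rfl⟩, hk⟩, he⟩
        exact ⟨u, hu, hk, he⟩
      · rintro ⟨u, hu, hk, he⟩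
        exact ⟨_, ⟨⟨u, hu, rfl⟩, hk⟩, he⟩
    rw [h1, hmemX]
    constructor
    · rintro ⟨u, hu, rfl, he⟩
      have h2 : (u.1, (dbl G.conj u.2).toFinset) ∈ G.spine := by
        rw [hspine]
        refine List.mem_map.2 ⟨u, ?_, rfl⟩
        simpa using hu
      have h3 := (hvtx _ h2).eq_vert (List.mem_toFinset.2 he)
      rwa [h3] at h2
    · intro h2
      rw [hspine] at h2
      obtain ⟨u, hu, hu2⟩ := List.mem_map.1 h2
      refine ⟨u, by simpa using hu, congrArg Prod.fst hu2, ?_⟩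
      rw [← List.mem_toFinset]
      have : e ∈ (vert G.rot k e).2 := mem_vert.2 (Equiv.Perm.SameCycle.refl _ _)
      rwa [← hu2] at this
  have hnd : ∀ k, (tableAt k ((SL ++ SR).map fun v => (v.1, dbl G.conj v.2))).Nodup := by
    intro k
    have h1 : ((SL ++ SR).map fun v => ((v.1, (dbl G.conj v.2).toFinset) : BWVertex d)).Nodup := by
      have h2 := G.spine_nodup
      rw [hspine] at h2
      refine (List.Perm.nodup_iff (List.Perm.map _ ?_)).1 h2
      exact (List.reverse_perm _).append_right _
    rw [tableAt, List.nodup_flatMap]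
    constructor
    · intro v hv
      obtain ⟨u, hu, rfl⟩ := List.mem_map.1 (List.mem_of_mem_filter hv)
      rcases List.mem_append.1 hu with hu | hu
      · exact (hcycL u hu).1
      · exact (hcycR u hu).1
    · refine (List.Pairwise.filter (R := fun u v => u.1 = v.1 → List.Disjoint u.2 v.2) _
        ?_).imp_of_mem ?_
      · rw [List.pairwise_map]
        rw [List.Nodup, List.pairwise_map] at h1
        refine h1.imp_of_mem fun {u v} hu hv huv hc e he he' => huv ?_
        have h2 : ∀ u ∈ SL ++ SR, e ∈ dbl G.conj u.2 →
            ((u.1, (dbl G.conj u.2).toFinset) : BWVertex d) = vert G.rot u.1 e := by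
          intro u hu he
          refine BWRotation.IsVertex.eq_vert (v := (u.1, (dbl G.conj u.2).toFinset))
            (hvtx _ ?_) (List.mem_toFinset.2 he)
          rw [hspine]
          exact List.mem_map.2 ⟨u, by simpa using hu, rfl⟩
        have hc' : u.1 = v.1 := hc
        rw [h2 u hu he, h2 v hv he', hc']
      · intro u v hu hv huv
        have hu := (List.mem_filter.1 hu).2
        have hv := (List.mem_filter.1 hv).2
        simp only [decide_eq_true_eq] at hu hv
        exact huv (hu.trans hv.symm)
  -- the part of the tables in the closed upper half plane
  have hhalf : ∀ k, (tableAt k (SL ++ SR)).Nodup := fun k => by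
    have h1 := Multiset.coe_nodup.2 (hnd k)
    rw [tableAt_dbl] at h1
    exact Multiset.coe_nodup.1 (Multiset.nodup_add.1 h1).1
  have hdis : ∀ k e, G.conj e ≠ e → e ∈ tableAt k (SL ++ SR) →
      G.conj e ∉ tableAt k (SL ++ SR) := by
    intro k e hne he he'
    have h1 := Multiset.coe_nodup.2 (hnd k)
    rw [tableAt_dbl] at h1
    refine (Multiset.disjoint_left.1 (Multiset.nodup_add.1 h1).2.2) (Multiset.mem_coe.2 he') ?_
    exact Multiset.mem_coe.2 (List.mem_map_of_mem (List.mem_filter.2 ⟨he, by simpa using hne⟩))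
  have hTX : ∀ k e, vert G.rot k e ∈ X ↔
      e ∈ tableAt k (SL ++ SR) ∨ G.conj e ∈ tableAt k (SL ++ SR) := by
    intro k e
    rw [← hTmem, ← Multiset.mem_coe, tableAt_dbl, Multiset.mem_add, Multiset.mem_coe,
      Multiset.mem_coe, List.mem_map]
    refine or_congr_right' fun hn => ⟨?_, fun h => ⟨_, List.mem_filter.2 ⟨h, ?_⟩, G.conj_conj e⟩⟩
    · rintro ⟨f, hf, rfl⟩
      rw [G.conj_conj]
      exact List.mem_of_mem_filter hf
    · simp only [ne_eq, G.conj_conj, decide_not, Bool.not_eq_true', decide_eq_false_iff_not]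
      intro h'
      rw [h'] at hn
      exact hn h
  have key1 : ∀ k, (tableAt k (SL ++ SR) : Multiset (Fin d)) +
      (stackAt k (slL ++ slR) : Multiset (Fin d)) =
      ((h :: tails (SL ++ SR) : List (Fin d)) : Multiset (Fin d)) := by
    intro k
    have hL := hSL.tableAt_perm k
    have hR := hSR.tableAt_perm k
    rw [tableAt_append, stackAt_append, tails_append, ← Multiset.coe_add, ← Multiset.coe_add,
      ← Multiset.cons_coe, ← Multiset.coe_add, ← Multiset.singleton_add, add_add_add_comm, hL, hR]
    rcases BWColour.eq_or_eq_other c k with rfl | rfl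
    · simp only [if_true, BWColour.other_ne, if_false, zero_add]
      exact add_left_comm _ _ _
    · simp only [if_true, BWColour.ne_other, if_false, zero_add]
      exact (add_assoc _ _ _)
  have key2 : ∀ k, {h} + (stackAt k.other (slL ++ slR) : Multiset (Fin d)) ≤
      (tableAt k (SL ++ SR) : Multiset (Fin d)) := by
    intro k
    have hL := hSL.stackAt_le k
    have hR := hSR.stackAt_le k
    have := add_le_add hL hR
    rw [tableAt_append, stackAt_append, ← Multiset.coe_add, ← Multiset.coe_add]
    refine le_trans (le_of_eq ?_) this
    rcases BWColour.eq_or_eq_other c k with rfl | rfl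
    · simp only [if_true, BWColour.other_ne, if_false, zero_add]
      exact add_left_comm _ _ _
    · simp only [if_true, BWColour.ne_other, if_false, zero_add]
      exact (add_assoc _ _ _).symm
  have hnd2 : ∀ k : BWColour, h ∉ stackAt k.other (slL ++ slR) ∧
      (stackAt k.other (slL ++ slR)).Nodup := by
    intro k
    have := Multiset.nodup_of_le (key2 k) (Multiset.coe_nodup.2 (hhalf k))
    rw [Multiset.singleton_add, Multiset.nodup_cons] at this
    exact ⟨fun h => this.1 (Multiset.mem_coe.2 h), Multiset.coe_nodup.1 this.2⟩
  have hsub : ∀ k, ∀ e ∈ stackAt k (slL ++ slR), e ∈ tableAt k.other (SL ++ SR) := by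
    intro k e he
    have := Multiset.subset_of_le (key2 k.other)
    refine Multiset.mem_coe.1 (this (Multiset.mem_add.2 (.inr ?_)))
    rwa [BWColour.other_other]
  have hhin : ∀ k, h ∈ tableAt k (SL ++ SR) := fun k =>
    Multiset.mem_coe.1 (Multiset.subset_of_le (key2 k) (by simp))
  have hmemst : ∀ k e, e ∈ stackAt k (slL ++ slR) ↔ (e, k) ∈ slL ++ slR := by
    intro k e
    simp only [stackAt, List.mem_map, List.mem_filter, decide_eq_true_eq]
    constructor
    · rintro ⟨⟨e', k'⟩, ⟨h1, rfl⟩, rfl⟩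
      exact h1
    · exact fun h1 => ⟨_, ⟨h1, rfl⟩, rfl⟩
  -- a slot leads away from the real line
  have hout : ∀ k e, e ∈ stackAt k (slL ++ slR) → vert G.rot k e ∉ X := by
    intro k e he hk
    have hne : G.conj e ≠ e := by
      rcases List.mem_append.1 ((hmemst k e).1 he) with h1 | h1
      · exact hSL.slot_nonreal _ h1
      · exact hSR.slot_nonreal _ h1
    have h1 := hsub k e he
    have h2 : e ∈ G.inner X := by
      refine G.mem_inner.2 fun k' => ?_
      rcases BWColour.eq_or_eq_other k k' with rfl | rfl
      · exact hk
      · exact (hTX _ _).2 (.inl h1)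
    have h3 : e = h ∨ e = G.conj h := by
      have h4 : e = G.hole ∨ e = G.conj G.hole := by
        rcases hall e h2 with h4 | ⟨i, hi, rfl⟩
        · exact .inr h4
        · by_cases hip : i = p
          · subst hip
            exact .inl hJp
          · exact absurd (hreal i hi hip) hne
      rcases hh' with rfl | rfl
      · exact h4
      · rw [G.conj_conj]
        exact h4.symm
    rcases h3 with rfl | rfl
    · refine (hnd2 k.other).1 ?_
      rwa [BWColour.other_other]
    · exact hdis _ _ hh (hhin _) h1
  have hLmem : ∀ k e, e ∈ h :: tails (SL ++ SR) ↔
      e ∈ tableAt k (SL ++ SR) ∨ e ∈ stackAt k (slL ++ slR) := by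
    intro k e
    rw [← Multiset.mem_coe, ← key1 k, Multiset.mem_add, Multiset.mem_coe, Multiset.mem_coe]
  have hstnd : ∀ k, (stackAt k (slL ++ slR)).Nodup := fun k => by
    have := (hnd2 k.other).2
    rwa [BWColour.other_other] at this
  obtain ⟨w, T, hT, hTc, hTn, hTd, hTcov⟩ := G.exists_run (d + 1 + (Finset.univ \ X).card) X
    (h :: tails (SL ++ SR)) (slL ++ slR) (by omega)
    ⟨_, hmemX.2 (List.getElem_mem hp)⟩ (fun v hv => hvtx v (hmemX.1 hv))
    (fun v hv => hmemX.2 hv) hclosed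
    (by rw [hcard, hX, List.toFinset_card_of_nodup G.spine_nodup])
    (by
      rw [← Multiset.coe_nodup, ← key1 c, Multiset.nodup_add]
      refine ⟨Multiset.coe_nodup.2 (hhalf c), Multiset.coe_nodup.2 (hstnd c), ?_⟩
      rw [Multiset.disjoint_left]
      intro e he he'
      exact hout c e he' ((hTX _ _).2 (.inl he)))
    (by
      intro e he he'
      by_contra hne
      rw [hLmem c] at he he'
      by_cases hk : vert G.rot c e ∈ X
      · have h1 := he.resolve_right fun h' => hout _ _ h' hk
        have h2 := he'.resolve_right fun h' => hout _ _ h' (hclosed _ _ hk)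
        exact hdis _ _ hne h1 h2
      · rw [hTX, not_or] at hk
        exact hdis _ _ hne (hsub _ _ (he.resolve_left hk.1)) (hsub _ _ (he'.resolve_left hk.2)))
    (by
      intro e
      constructor
      · rintro ⟨k, hk⟩
        rw [hLmem k, hLmem k]
        rcases (hTX _ _).1 hk with hk | hk
        · exact .inl (.inl hk)
        · exact .inr (.inl hk)
      · rintro (he | he)
        · rcases (hLmem c e).1 he with h1 | h1
          · exact ⟨_, (hTX _ _).2 (.inl h1)⟩
          · exact ⟨_, (hTX _ _).2 (.inl (hsub _ _ h1))⟩
        · rcases (hLmem c _).1 he with h1 | h1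
          · exact ⟨_, (hTX _ _).2 (.inr h1)⟩
          · exact ⟨_, (hTX _ _).2 (.inr (hsub _ _ h1))⟩)
    (by
      rintro ⟨e, k⟩ he
      rw [← hmemst] at he
      exact ⟨(hLmem k e).2 (.inr he), (hTX _ _).2 (.inl (hsub _ _ he)), hout _ _ he⟩)
    (by
      intro e he he'
      rw [G.mem_inner] at he'
      push Not at he'
      obtain ⟨k, hk⟩ := he'
      refine ⟨(e, k), (hmemst _ _).1 (((hLmem k e).1 he).resolve_left fun h' => hk ?_), rfl⟩
      exact (hTX _ _).2 (.inl h'))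
    (by
      refine List.Nodup.map_on ?_ ?_
      · rintro ⟨e, k⟩ he ⟨_, k'⟩ he' rfl
        rw [← hmemst] at he he'
        rcases BWColour.eq_or_eq_other k k' with rfl | rfl
        · rfl
        · have := hsub _ _ he'
          rw [BWColour.other_other] at this
          exact absurd ((hTX _ _).2 (.inl this)) (hout _ _ he)
      · rw [List.nodup_iff_count_le_one]
        rintro ⟨e, k⟩
        have h1 := List.nodup_iff_count_le_one.1 (hstnd k) e
        refine le_trans ?_ h1
        have h2 := List.count_le_count_map (f := Prod.fst) (x := (e, k))
          (l := (slL ++ slR).filter fun a => a.2 = k)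
        rwa [List.count_filter (by simp)] at h2)
  have happ : ∀ l : List (BWColour × List (Fin d)),
      h :: tails (SL ++ SR ++ l) = (h :: tails (SL ++ SR)) ++ tails l := fun l => by
    rw [tails_append (SL ++ SR), List.cons_append]
  refine ⟨⟨c, DL, DR, w⟩, ⟨{
    h := h
    SL := SL
    SR := SR
    T := T
    slL := slL
    slR := slR
    conj_h := hh
    sideL := hSL
    sideR := hSR
    run := hT
    nodup := by rw [happ]; exact hTn
    cover := by rw [happ]; exact hTcov
    disj := by rw [happ]; exact hTd
    hole := hhole
    cyc := ?_
    spine := hspine }⟩⟩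
  intro v hv
  simp only [fullTable, List.mem_append, List.mem_map] at hv
  rcases hv with ⟨u, hu, rfl⟩ | ⟨u, hu, rfl⟩ | hv | ⟨u, hu, rfl⟩
  · exact hcycL u hu
  · exact cyc_reverse_iff.2 (hcycR u hu)
  · exact hTc v hv
  · refine cyc_reverse_iff.2 ((hTc u hu).map (τ := G.conj) fun e => ?_)
    exact (G.conj_rot _ _).symm

end RealBWGraph


/-! ### Every valid code is the code of a real graph -/

section Supply

/-- A forest has at least as many vertices as roots. -/
theorem BWCode.Luk.length_le : ∀ {st : List BWColour} {w : List ℕ}, BWCode.Luk st w →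
    st.length ≤ w.length := by
  intro st w
  induction w generalizing st with
  | nil => cases st with
    | nil => simp
    | cons => exact fun h => h.elim
  | cons s w ih => cases st with
    | nil => simp
    | cons c st =>
      intro h
      have := ih h.2
      simp at this ⊢
      omega

variable {E : Type*} {conj : Equiv.Perm E}

/-- The real vertices on one side can be built from any supply of edges of the right size. -/
theorem exists_hSide (D : List ℕ) : ∀ (t : ℕ) (c : BWColour) (x : E) (rs us : List E),
    BWCode.SideOK t D → rs.length + 1 = D.length → us.length = (BWCode.slotCols t c D).length →
    (∀ e ∈ rs, conj e = e) → (∀ e ∈ us, conj e ≠ e) →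
    ∃ S sl, HSide conj t x c D S sl ∧ (tails S).Perm (rs ++ us) := by
  induction D with
  | nil => exact fun _ _ _ _ _ h => h.elim
  | cons s D ih =>
    intro t c x rs us hD hrs hus hr hu
    cases D with
    | nil =>
      obtain ⟨k, rfl⟩ := hD
      obtain rfl : rs = [] := List.length_eq_zero_iff.1 (by simpa using hrs)
      have hk : us.length = k := by
        simp [BWCode.slotCols] at hus
        omega
      rw [← hk]
      exact ⟨_, _, .last t x c us hu, by simp [tails]⟩
    | cons s' D =>
      obtain ⟨⟨k, rfl⟩, hD⟩ := hD
      obtain ⟨y, rs, rfl⟩ := List.exists_cons_of_ne_nil (l := rs) (by rintro rfl; simp at hrs)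
      have hk : (2 * k + 2 + t - 2 - t) / 2 = k := by omega
      simp only [BWCode.slotCols, hk, List.length_append, List.length_replicate] at hus
      obtain ⟨S, sl, hS, hp⟩ := ih 0 c.other y rs (us.drop k) hD (by simpa using hrs)
        (by simp; omega) (fun e he => hr e (by simp [he]))
        (fun e he => hu e (List.mem_of_mem_drop he))
      have h1 := HSide.cons t x y c (us.take k) _ _ _
        (fun e he => hu e (List.mem_of_mem_take he)) (hr y (by simp)) hS
      rw [List.length_take, min_eq_left (by omega)] at h1
      refine ⟨_, _, h1, ?_⟩
      rw [tails_cons, List.tail_cons]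
      rw [← Multiset.coe_eq_coe] at hp ⊢
      have h2 : ((us.take k : List E) : Multiset E) + (us.drop k : List E) = us := by
        rw [Multiset.coe_add, List.take_append_drop]
      rw [← Multiset.coe_add, hp, ← Multiset.coe_add, ← Multiset.coe_add, ← Multiset.coe_add, ← h2,
        ← Multiset.cons_coe, ← Multiset.cons_coe, ← Multiset.singleton_add,
        ← Multiset.singleton_add, Multiset.coe_nil, add_zero]
      simp only [add_assoc, add_left_comm]

/-- A plane forest can be built from any supply of edges of the right size. -/
theorem exists_hRun (w : List ℕ) : ∀ (st : List (E × BWColour)) (us : List E),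
    BWCode.Luk (st.map Prod.snd) w → us.length + st.length = w.length →
    (∀ e ∈ us, conj e ≠ e) → ∃ T, HRun conj st w T ∧ tails T = us := by
  induction w with
  | nil =>
    intro st us _ hl _
    obtain ⟨rfl, rfl⟩ : st = [] ∧ us = [] := by simpa [and_comm] using hl
    exact ⟨[], .nil, rfl⟩
  | cons s w ih =>
    intro st us hw hl hu
    match st with
    | [] => exact hw.elim
    | (e, c) :: st =>
      obtain ⟨hs, hw⟩ := hw
      have h1 := hw.length_le
      simp only [List.length_append, List.length_replicate, List.length_map,
        List.length_cons] at h1 hl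
      obtain ⟨T, hT, hT'⟩ := ih ((us.take (s - 1)).map (fun a => (a, c.other)) ++ st)
        (us.drop (s - 1)) (by
          rw [List.map_append, List.map_map]
          have : List.map (Prod.snd ∘ fun a : E => (a, c.other)) (us.take (s - 1)) =
              List.replicate (s - 1) c.other := by
            rw [List.eq_replicate_iff]
            refine ⟨by simp; omega, fun b hb => ?_⟩
            obtain ⟨_, _, rfl⟩ := List.mem_map.1 hb
            rfl
          rwa [this])
        (by simp; omega) (fun e he => hu e (List.mem_of_mem_drop he))
      have h2 := HRun.cons e c (us.take (s - 1)) st w T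
        (fun e he => hu e (List.mem_of_mem_take he)) hT
      rw [List.length_take, min_eq_left (by omega), Nat.sub_add_cancel hs] at h2
      exact ⟨_, h2, by rw [tails_cons, hT', List.tail_cons, List.take_append_drop]⟩

/-- Disjoint cyclic lists are cycles of a permutation. -/
theorem exists_cyc [DecidableEq E] (ls : List (List E)) (h : ls.flatten.Nodup) :
    ∃ σ : Equiv.Perm E, (∀ l ∈ ls, Cyc σ l) ∧ ∀ x, x ∉ ls.flatten → σ x = x := by
  induction ls with
  | nil => exact ⟨1, by simp, by simp⟩
  | cons l ls ih =>
    rw [List.flatten_cons, List.nodup_append'] at h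
    obtain ⟨hl, hls, hd⟩ := h
    obtain ⟨σ, h1, h2⟩ := ih hls
    refine ⟨l.formPerm * σ, ?_, fun x hx => ?_⟩
    · intro l' hl'
      rcases List.mem_cons.1 hl' with rfl | hl'
      · refine ⟨hl, fun x hx => ?_⟩
        rw [Equiv.Perm.mul_apply, h2 x (hd hx)]
      · refine ⟨(h1 l' hl').1, fun x hx => ?_⟩
        rw [Equiv.Perm.mul_apply, List.formPerm_apply_of_notMem, (h1 l' hl').2 x hx]
        intro h
        exact hd h (List.mem_flatten_of_mem hl' ((h1 l' hl').mem_apply hx))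
    · rw [List.flatten_cons, List.mem_append, not_or] at hx
      rw [Equiv.Perm.mul_apply, h2 x hx.2, List.formPerm_apply_of_notMem hx.1]

end Supply

section Conjugation

/-- An involution with prescribed numbers of fixed points and of two-element orbits. -/
theorem exists_involution {d r u : ℕ} (h : r + 2 * u = d) :
    ∃ (conj : Equiv.Perm (Fin d)) (rs us : List (Fin d)), (∀ e, conj (conj e) = e) ∧
      rs.length = r ∧ us.length = u ∧ (∀ e ∈ rs, conj e = e) ∧ (∀ e ∈ us, conj e ≠ e) ∧
      (rs ++ us).Nodup ∧ (∀ e, e ∈ rs ++ us ∨ conj e ∈ rs ++ us) ∧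
      (∀ e ∈ rs ++ us, conj e ∈ rs ++ us → conj e = e) := by
  -- the first `r` points are fixed, and the next `u` ones are exchanged with the last `u` ones
  let f : Fin d → Fin d := fun e =>
    if h1 : e.1 < r then e else if h2 : e.1 < r + u then ⟨e.1 + u, by omega⟩ else
      ⟨e.1 - u, by omega⟩
  have hf : Function.Involutive f := by
    intro e
    apply Fin.ext
    simp only [f]
    by_cases h1 : e.1 < r
    · simp [h1]
    · by_cases h2 : e.1 < r + u
      · have h3 : ¬ e.1 + u < r := by omega
        simp [h1, h2, h3]
      · have h3 : ¬ e.1 - u < r := by omega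
        have h4 : e.1 - u < r + u := by omega
        simp only [h1, h2, h3, h4, dif_neg, dif_pos, not_false_eq_true]
        omega
  have hval : ∀ e : Fin d, (f e).1 = if e.1 < r then e.1 else
      if e.1 < r + u then e.1 + u else e.1 - u := by
    intro e
    simp only [f]
    split_ifs <;> rfl
  have hrs : ∀ e : Fin d, e ∈ List.ofFn (fun i : Fin r => (⟨i.1, by omega⟩ : Fin d)) ↔ e.1 < r := by
    intro e
    rw [List.mem_ofFn]
    exact ⟨fun ⟨i, hi⟩ => by rw [← hi]; exact i.2, fun he => ⟨⟨e.1, he⟩, rfl⟩⟩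
  have hus : ∀ e : Fin d, e ∈ List.ofFn (fun i : Fin u => (⟨r + i.1, by omega⟩ : Fin d)) ↔
      r ≤ e.1 ∧ e.1 < r + u := by
    intro e
    rw [List.mem_ofFn]
    refine ⟨fun ⟨i, hi⟩ => by rw [← hi]; exact ⟨by simp, by simp⟩, fun he =>
      ⟨⟨e.1 - r, by omega⟩, Fin.ext ?_⟩⟩
    change r + (e.1 - r) = e.1
    omega
  refine ⟨hf.toPerm, List.ofFn fun i : Fin r => ⟨i.1, by omega⟩,
    List.ofFn fun i : Fin u => ⟨r + i.1, by omega⟩, hf, by simp, by simp, ?_, ?_, ?_, ?_, ?_⟩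
  · intro e he
    rw [hrs] at he
    exact Fin.ext (by rw [hf.coe_toPerm, hval, if_pos he])
  · intro e he h'
    rw [hus] at he
    have := congrArg Fin.val h'
    rw [hf.coe_toPerm, hval, if_neg (by omega), if_pos he.2] at this
    omega
  · rw [List.nodup_append']
    refine ⟨List.nodup_ofFn.2 fun i j h => ?_, List.nodup_ofFn.2 fun i j h => ?_, ?_⟩
    · exact Fin.ext (Fin.mk.inj_iff.1 h)
    · have := Fin.mk.inj_iff.1 h
      exact Fin.ext (by omega)
    · intro e he he'
      rw [hrs] at he
      rw [hus] at he'
      omega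
  · intro e
    rw [List.mem_append, List.mem_append, hrs, hus, hrs, hus, hf.coe_toPerm, hval]
    split_ifs <;> omega
  · intro e he he'
    rw [List.mem_append, hrs, hus] at he he'
    rw [hf.coe_toPerm, hval] at he'
    apply Fin.ext
    rw [hf.coe_toPerm, hval]
    split_ifs at he' ⊢ <;> omega

end Conjugation

namespace BWCode

/-- The edges around the vertices of a valid code. -/
theorem Valid.exists_halfTable {d : ℕ} {C : BWCode} (hC : C.Valid d) :
    ∃ conj : Equiv.Perm (Fin d), (∀ e, conj (conj e) = e) ∧ Nonempty (HalfTable conj C) := by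
  obtain ⟨hL, hR, hw, hd⟩ := hC
  have hpos : ∀ {D : List ℕ}, SideOK 1 D → 0 < D.length := by
    intro D h
    cases D with
    | nil => exact h.elim
    | cons => simp
  have h1 := hpos hL
  have h2 := hpos hR
  have h3 := hw.length_le
  obtain ⟨conj, rs, us, hc, hrs, hus, hr, hu, hnd, hcov, hdis⟩ := exists_involution
    (d := d) (r := C.DL.length - 1 + (C.DR.length - 1)) (u := C.w.length + 1) (by omega)
  obtain ⟨h, us, rfl⟩ := List.exists_cons_of_ne_nil (l := us) (by rintro rfl; simp at hus)
  simp only [List.length_cons, Nat.add_right_cancel_iff] at hus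
  rw [stack, List.length_append] at h3
  set a := C.DL.length - 1 with ha
  set nL := (slotCols 1 C.cR.other C.DL).length with hnL
  set nR := (slotCols 1 C.cR C.DR).length with hnR
  have hu' : ∀ e ∈ us, conj e ≠ e := fun e he => hu e (by simp [he])
  obtain ⟨SL, slL, hSL, hpL⟩ := exists_hSide C.DL 1 C.cR.other h (rs.take a) (us.take nL) hL
    (by rw [List.length_take]; omega) (by rw [List.length_take]; omega)
    (fun e he => hr e (List.mem_of_mem_take he)) (fun e he => hu' e (List.mem_of_mem_take he))
  obtain ⟨SR, slR, hSR, hpR⟩ := exists_hSide C.DR 1 C.cR h (rs.drop a)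
    ((us.drop nL).take nR) hR
    (by rw [List.length_drop]; omega) (by rw [List.length_take, List.length_drop]; omega)
    (fun e he => hr e (List.mem_of_mem_drop he))
    (fun e he => hu' e (List.mem_of_mem_drop (List.mem_of_mem_take he)))
  have hlL : slL.length = nL := by rw [hnL, hSL.slotCols, List.length_map]
  have hlR : slR.length = nR := by rw [hnR, hSR.slotCols, List.length_map]
  obtain ⟨T, hT, hpT⟩ := exists_hRun (conj := conj) C.w (slL ++ slR) ((us.drop nL).drop nR)
    (by rw [List.map_append, ← hSL.slotCols, ← hSR.slotCols]; exact hw)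
    (by simp only [List.length_drop, List.length_append]; omega)
    (fun e he => hu' e (List.mem_of_mem_drop (List.mem_of_mem_drop he)))
  have hp : (h :: tails (SL ++ SR ++ T)).Perm (rs ++ h :: us) := by
    rw [← Multiset.coe_eq_coe] at hpL hpR ⊢
    have e1 : ((rs.take a : List (Fin d)) : Multiset (Fin d)) + (rs.drop a : List _) = rs := by
      rw [Multiset.coe_add, List.take_append_drop]
    have e2 : ((us.take nL : List (Fin d)) : Multiset (Fin d)) + (us.drop nL : List _) = us := by
      rw [Multiset.coe_add, List.take_append_drop]
    have e3 : (((us.drop nL).take nR : List (Fin d)) : Multiset (Fin d)) +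
        ((us.drop nL).drop nR : List _) = us.drop nL := by
      rw [Multiset.coe_add, List.take_append_drop]
    rw [← Multiset.cons_coe, tails_append, tails_append, ← Multiset.coe_add, ← Multiset.coe_add,
      hpL, hpR, hpT, ← Multiset.coe_add, ← Multiset.coe_add, ← Multiset.coe_add,
      ← Multiset.cons_coe, ← e1, ← e2, ← e3, ← Multiset.singleton_add, ← Multiset.singleton_add]
    simp only [add_assoc, add_left_comm]
  exact ⟨conj, hc, ⟨{
    h := h
    SL := SL
    SR := SR
    T := T
    slL := slL
    slR := slR
    conj_h := hu h (by simp)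
    sideL := hSL
    sideR := hSR
    run := hT
    nodup := hp.nodup_iff.2 hnd
    cover := fun e => by rw [hp.mem_iff, hp.mem_iff]; exact hcov e
    disj := fun e he he' => hdis e (hp.mem_iff.1 he) (hp.mem_iff.1 he') }⟩⟩

end BWCode


section Reflection

variable {E : Type*} {conj : Equiv.Perm E}

/-- Reflection reverses the cyclic order of the edges around a real vertex. -/
theorem HSide.map_dbl [DecidableEq E] {t : ℕ} {x : E} {c : BWColour} {D : List ℕ}
    {S : List (BWColour × List E)} {sl : List (E × BWColour)} (h : HSide conj t x c D S sl)
    (hc : ∀ e, conj (conj e) = e) :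
    ∀ v ∈ S, ((dbl conj v.2).map conj) ~r (dbl conj v.2).reverse := by
  have hmm : ∀ l : List E, (l.map conj).map conj = l := fun l => by
    rw [List.map_map]
    exact (List.map_congr_left (g := id) fun e _ => hc e).trans (List.map_id _)
  induction h with
  | last t x c as h =>
    intro v hv
    obtain rfl := List.mem_singleton.1 hv
    dsimp only
    rw [dbl_last h]
    by_cases hx : conj x = x
    · simp only [hx, if_true, List.append_nil, List.map_cons, List.map_append, List.map_reverse,
        hmm, List.reverse_cons, List.reverse_append, List.reverse_reverse]
      exact List.isRotated_append (l := [x])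
    · simp only [hx, if_false, List.map_cons, List.map_append, List.map_reverse,
        hmm, List.reverse_cons, List.reverse_append, List.reverse_reverse, hc]
      simpa using List.IsRotated.refl _
  | cons t x y c as D S sl h hy hS ih =>
    intro v hv
    rcases List.mem_cons.1 hv with rfl | hv
    · dsimp only
      rw [dbl_cons h hy]
      by_cases hx : conj x = x
      · simp only [hx, hy, if_true, List.append_nil, List.map_cons, List.map_append,
          List.map_reverse, hmm, List.reverse_cons, List.reverse_append, List.reverse_reverse]
        have := List.isRotated_append (l := [x]) (l' := as.map conj ++ y :: as.reverse)
        simpa using this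
      · simp only [hx, hy, if_false, List.map_cons, List.map_append, List.map_reverse,
          hmm, List.reverse_cons, List.reverse_append, List.reverse_reverse, hc]
        simpa using List.IsRotated.refl _
    · exact ih v hv

/-- Consecutive real vertices on one side are joined by real edges. -/
theorem HSide.isChain {t : ℕ} {x : E} {c : BWColour} {D : List ℕ}
    {S : List (BWColour × List E)} {sl : List (E × BWColour)} (h : HSide conj t x c D S sl) :
    S.IsChain fun u v => ∃ e, e ∈ u.2 ∧ e ∈ v.2 ∧ conj e = e := by
  induction h with
  | last => simp
  | cons t x y c as D S sl h hy hS ih =>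
    obtain ⟨l, S', ⟨U, rfl⟩, rfl⟩ := hS.ne_nil
    rw [List.isChain_cons_cons]
    exact ⟨⟨y, by simp, by simp, hy⟩, ih⟩

/-- A property that spreads along the vertices of one side spreads from the first edge to all. -/
theorem HSide.closed {t : ℕ} {x : E} {c : BWColour} {D : List ℕ}
    {S : List (BWColour × List E)} {sl : List (E × BWColour)} (h : HSide conj t x c D S sl)
    {Q : E → Prop} (hQ : ∀ v ∈ S, ∀ e ∈ v.2, ∀ f ∈ v.2, Q e → Q f) (hx : Q x) :
    (∀ e ∈ tails S, Q e) ∧ ∀ a ∈ sl, Q a.1 := by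
  induction h with
  | last t x c as h =>
    have h1 : ∀ e ∈ as, Q e := fun e he =>
      hQ _ List.mem_cons_self x (by simp) e (by simp [he]) hx
    simpa [tails] using h1
  | cons t x y c as D S sl h hy hS ih =>
    have h1 : ∀ e ∈ x :: (as ++ [y]), Q e := fun e he =>
      hQ _ List.mem_cons_self x (by simp) e he hx
    obtain ⟨h2, h3⟩ := ih (fun v hv => hQ v (List.mem_cons_of_mem _ hv)) (h1 y (by simp))
    refine ⟨fun e he => ?_, fun a ha => ?_⟩
    · rw [tails_cons, List.mem_append] at he
      rcases he with he | he
      · exact h1 e (List.mem_cons_of_mem _ he)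
      · exact h2 e he
    · rcases List.mem_append.1 ha with ha | ha
      · obtain ⟨b, hb, rfl⟩ := List.mem_map.1 ha
        exact h1 b (by simp [hb])
      · exact h3 a ha

/-- A property that spreads along the vertices of a forest spreads from the stack to all edges. -/
theorem HRun.closed {st : List (E × BWColour)} {w : List ℕ} {T : List (BWColour × List E)}
    (h : HRun conj st w T) {Q : E → Prop}
    (hQ : ∀ v ∈ T, ∀ e ∈ v.2, ∀ f ∈ v.2, Q e → Q f) (hst : ∀ a ∈ st, Q a.1) :
    ∀ e ∈ tails T, Q e := by
  induction h with
  | nil => simp [tails]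
  | cons e c ch st w T h hT ih =>
    have h1 : ∀ a ∈ ch, Q a := fun a ha => hQ _ List.mem_cons_self e (by simp) a (by simp [ha])
      (hst (e, c) (by simp))
    have h2 := ih (fun v hv => hQ v (List.mem_cons_of_mem _ hv)) fun a ha => by
      rcases List.mem_append.1 ha with ha | ha
      · obtain ⟨b, hb, rfl⟩ := List.mem_map.1 ha
        exact h1 b hb
      · exact hst a (by simp [ha])
    intro f hf
    rw [tails_cons, List.mem_append] at hf
    rcases hf with hf | hf
    · exact h1 f hf
    · exact h2 f hf

/-- A property that spreads from an edge to its neighbours at all vertices spreads from the upper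
edge of the cycle to all edges. -/
theorem HalfTable.induction_edges [DecidableEq E] {C : BWCode} (H : HalfTable conj C)
    (hc : ∀ e, conj (conj e) = e) {Q : E → Prop}
    (hQ : ∀ v ∈ H.full, ∀ e ∈ v.2, ∀ f ∈ v.2, Q e → Q f) (hh : Q H.h) (e : E) : Q e := by
  have key : ∀ Q : E → Prop, (∀ v ∈ H.SL ++ H.SR ++ H.T, ∀ e ∈ v.2, ∀ f ∈ v.2, Q e → Q f) →
      Q H.h → ∀ e ∈ H.edges, Q e := by
    intro Q hQ hh
    obtain ⟨hL, hL'⟩ := H.sideL.closed (fun v hv => hQ v (by simp [hv])) hh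
    obtain ⟨hR, hR'⟩ := H.sideR.closed (fun v hv => hQ v (by simp [hv])) hh
    have hT := H.run.closed (fun v hv => hQ v (by simp [hv])) (fun a ha => by
      rcases List.mem_append.1 ha with ha | ha
      · exact hL' a ha
      · exact hR' a ha)
    intro e he
    rw [edges, tails_append, tails_append, List.mem_cons, List.mem_append, List.mem_append] at he
    rcases he with rfl | (he | he) | he
    · exact hh
    · exact hL e he
    · exact hR e he
    · exact hT e he
  have hS : ∀ v ∈ H.SL ++ H.SR, ∀ e ∈ dbl conj v.2, ∀ f ∈ dbl conj v.2, Q e → Q f := by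
    intro v hv
    rcases List.mem_append.1 hv with hv | hv
    · exact hQ (v.1, dbl conj v.2) (List.mem_append_left _ (List.mem_map_of_mem hv))
    · have := hQ (v.1, (dbl conj v.2).reverse) (List.mem_append_right _ (List.mem_append_left _
        (List.mem_map.2 ⟨v, hv, rfl⟩)))
      simpa using this
  have h1 := key Q (fun v hv e he f hf => by
    rcases List.mem_append.1 hv with hv | hv
    · exact hS v hv e ((mem_dbl hc).2 (.inl he)) f ((mem_dbl hc).2 (.inl hf))
    · exact hQ v (by simp [full, fullTable, hv]) e he f hf) hh
  have hh' : Q (conj H.h) := by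
    obtain ⟨l, S', ⟨U, rfl⟩, hS'⟩ := H.sideL.ne_nil
    refine hS (C.cR.other, H.h :: U) (by simp [hS']) H.h ?_ _ ?_ hh
    · exact (mem_dbl hc).2 (.inl (by simp))
    · exact (mem_dbl hc).2 (.inr (by simp [hc]))
  have h2 := key (fun e => Q (conj e)) (fun v hv e he f hf => by
    rcases List.mem_append.1 hv with hv | hv
    · exact hS v hv _ ((mem_dbl hc).2 (.inr (by rwa [hc]))) _ ((mem_dbl hc).2 (.inr (by rwa [hc])))
    · refine hQ (v.1, (v.2.map conj).reverse) ?_ _ (by simpa using he) _ (by simpa using hf)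
      simp only [full, fullTable, List.mem_append, List.mem_map]
      exact .inr (.inr (.inr ⟨v, hv, rfl⟩))) hh'
  rcases H.cover e with he | he
  · exact h1 e he
  · have := h2 _ he
    rwa [hc] at this

end Reflection

section Tree

open Classical in
/-- A connected bipartite graph that has as many vertices as edges, and two parallel edges, is a
tree after merging them, and has no other parallel edges. -/
theorem tree_of_card {d : ℕ} {rot : BWRotation d} (hconn : rot.skeleton.Connected)
    (hcard : (Finset.univ.filter fun v => rot.IsVertex v).card = d) {h h' : Fin d} (hne : h ≠ h')
    (hpar : rot.Parallel h h') :
    rot.skeleton.IsAcyclic ∧ ∀ e f, e ≠ f → rot.Parallel e f →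
      (e = h ∧ f = h') ∨ (e = h' ∧ f = h) := by
  have hV : Nat.card {v // rot.IsVertex v} = d := by
    rw [Nat.card_eq_fintype_card, Fintype.card_subtype, hcard]
  let F : Fin d → rot.skeleton.edgeSet := fun e =>
    ⟨s(⟨vert rot white e, isVertex_vert _ _ _⟩, ⟨vert rot black e, isVertex_vert _ _ _⟩),
      skeleton_adj_vert rot e⟩
  have hF : ∀ e f, rot.Parallel e f → F e = F f := by
    intro e f hef
    have h1 := vert_eq_iff.2 (hef white)
    have h2 := vert_eq_iff.2 (hef black)
    refine Subtype.ext (Sym2.eq_iff.2 (.inl ⟨Subtype.ext h1, Subtype.ext h2⟩))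
  have hsurj : Function.Surjective F := by
    rintro ⟨s, hs⟩
    induction s using Sym2.ind with
    | _ u v =>
    obtain ⟨hc, e, heu, hev⟩ := SimpleGraph.mem_edgeSet _ |>.1 hs
    refine ⟨e, Subtype.ext ?_⟩
    have hu := u.2.eq_vert heu
    have hv := v.2.eq_vert hev
    change s(_, _) = s(u, v)
    rw [Sym2.eq_iff]
    cases huc : u.1.1 <;> cases hvc : v.1.1 <;> rw [huc] at hu <;> rw [hvc] at hv
    · exact absurd (huc.trans hvc.symm) hc
    · exact .inl ⟨Subtype.ext hu.symm, Subtype.ext hv.symm⟩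
    · exact .inr ⟨Subtype.ext hv.symm, Subtype.ext hu.symm⟩
    · exact absurd (huc.trans hvc.symm) hc
  -- merging parallel edges must not leave fewer edges than a connected graph needs
  have hle : ∀ s : Finset (Fin d), (∀ e, ∃ f ∈ s, F f = F e) →
      Nat.card rot.skeleton.edgeSet ≤ s.card := by
    intro s hs
    have h1 : Function.Surjective fun e : s => F e := by
      intro y
      obtain ⟨e, rfl⟩ := hsurj y
      obtain ⟨f, hf, hfe⟩ := hs e
      exact ⟨⟨f, hf⟩, hfe⟩
    have := Nat.card_le_card_of_surjective _ h1
    simpa using this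
  have hge := hconn.card_vert_le_card_edgeSet_add_one
  rw [hV] at hge
  have hpos : 0 < d := h.pos
  have hsymm : ∀ e f, rot.Parallel e f → rot.Parallel f e := fun e f h k => (h k).symm
  refine ⟨?_, ?_⟩
  · refine (SimpleGraph.isTree_iff_connected_and_card.2 ⟨hconn, ?_⟩).isAcyclic
    have := hle (Finset.univ.erase h') fun e => by
      by_cases he : e = h'
      · exact ⟨h, by simp [hne], by rw [he, hF _ _ hpar]⟩
      · exact ⟨e, by simp [he], rfl⟩
    rw [Finset.card_erase_of_mem (Finset.mem_univ _), Finset.card_univ, Fintype.card_fin] at this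
    rw [hV]
    omega
  · have key : ∀ e f, e ≠ f → rot.Parallel e f → e = h ∨ e = h' := by
      intro e f hef hp
      by_contra hcon
      push Not at hcon
      have := hle ((Finset.univ.erase h').erase e) fun g => by
        by_cases hg : g = h'
        · exact ⟨h, by simp [hne, hcon.1.symm], by rw [hg, hF _ _ hpar]⟩
        · by_cases hge : g = e
          · by_cases hf : f = h'
            · exact ⟨h, by simp [hne, hcon.1.symm], by rw [hge, hF _ _ hpar, hF _ _ hp, hf]⟩
            · exact ⟨f, by simp [hf, hef.symm], by rw [hge, hF _ _ hp]⟩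
          · exact ⟨g, by simp [hg, hge], rfl⟩
      rw [Finset.card_erase_of_mem (by simp [hcon.2]),
        Finset.card_erase_of_mem (Finset.mem_univ _), Finset.card_univ, Fintype.card_fin] at this
      have h2 : 2 ≤ d := by
        have h3 := h.2
        have h4 := h'.2
        have h5 : h.1 ≠ h'.1 := fun h5 => hne (Fin.ext h5)
        omega
      omega
    intro e f hef hp
    rcases key e f hef hp with rfl | rfl <;>
      rcases key f e hef.symm (hsymm _ _ hp) with rfl | rfl
    · exact absurd rfl hef
    · exact .inl ⟨rfl, rfl⟩
    · exact .inr ⟨rfl, rfl⟩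
    · exact absurd rfl hef

end Tree

namespace HalfTable

variable {d : ℕ} {conj : Equiv.Perm (Fin d)} {C : BWCode} (H : HalfTable conj C)

/-- The rotation system of a table. -/
theorem exists_rot : ∃ rot : BWRotation d, ∀ v ∈ H.full, Cyc (rot v.1) v.2 := by
  have h : ∀ c : BWColour, ∃ σ : Equiv.Perm (Fin d),
      ∀ v ∈ H.full, v.1 = c → Cyc σ v.2 := by
    intro c
    have h1 := H.nodup_full c
    rw [tableAt, List.flatMap_def] at h1
    obtain ⟨σ, hσ, -⟩ := exists_cyc _ h1
    refine ⟨σ, fun v hv hvc => hσ _ (List.mem_map_of_mem (List.mem_filter.2 ⟨hv, by simp [hvc]⟩))⟩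
  choose rot hrot using h
  exact ⟨rot, fun v hv => hrot v.1 v hv rfl⟩

/-- The mirror image of a vertex of a table is a vertex, with the opposite cyclic order. -/
theorem exists_mirror (hc : ∀ e, conj (conj e) = e) {v : BWColour × List (Fin d)}
    (hv : v ∈ H.full) : ∃ u ∈ H.full, u.1 = v.1 ∧ (v.2.map conj) ~r u.2.reverse := by
  have hv0 := hv
  simp only [full, fullTable, List.mem_append, List.mem_map] at hv
  rcases hv with ⟨u, hu, rfl⟩ | ⟨u, hu, rfl⟩ | hv | ⟨u, hu, rfl⟩
  · exact ⟨_, hv0, rfl, H.sideL.map_dbl hc u hu⟩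
  · refine ⟨_, hv0, rfl, ?_⟩
    have := H.sideR.map_dbl hc u hu
    dsimp only
    rw [List.map_reverse]
    exact this.reverse
  · refine ⟨(v.1, (v.2.map conj).reverse), ?_, rfl, by simpa using List.IsRotated.refl _⟩
    simp only [full, fullTable, List.mem_append, List.mem_map]
    exact .inr (.inr (.inr ⟨v, hv, rfl⟩))
  · refine ⟨u, by simp [full, fullTable, hu], rfl, ?_⟩
    have h1 : (u.2.map conj).map conj = u.2 := by
      rw [List.map_map]
      exact (List.map_congr_left (g := id) fun e _ => hc e).trans (List.map_id _)
    rw [List.map_reverse, h1]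

/-- Conjugation reverses the rotation. -/
theorem conj_rot (hc : ∀ e, conj (conj e) = e) {rot : BWRotation d}
    (hr : ∀ v ∈ H.full, Cyc (rot v.1) v.2) (k : BWColour) (e : Fin d) :
    conj (rot k e) = (rot k).symm (conj e) := by
  obtain ⟨v, hv, rfl, he⟩ := H.mem_full hc k e
  obtain ⟨u, hu, hk, huv⟩ := H.exists_mirror hc hv
  have h1 : Cyc (rot v.1)⁻¹ (v.2.map conj) := by
    rw [← hk]
    exact (hr u hu).reverse.rotated huv.symm
  have h2 : Cyc (conj * rot v.1 * conj⁻¹) (v.2.map conj) :=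
    (hr v hv).map (τ := conj) fun e => by simp [Equiv.Perm.mul_apply]
  have hm : conj e ∈ v.2.map conj := List.mem_map_of_mem he
  have h3 := (h2.2 _ hm).trans (h1.2 _ hm).symm
  simpa [Equiv.Perm.mul_apply] using h3

end HalfTable


namespace HalfTable

variable {d : ℕ} {conj : Equiv.Perm (Fin d)} {C : BWCode} (H : HalfTable conj C)

/-- The real vertices of the table, from left to right. -/
def spineList : List (BWVertex d) :=
  (H.SL.reverse ++ H.SR).map fun v => (v.1, (dbl conj v.2).toFinset)

theorem spineList_perm : (H.spineList ++ ((H.T ++ H.T.map fun v =>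
    (v.1, (v.2.map conj).reverse)).map fun u => (u.1, u.2.toFinset))).Perm
    (H.full.map fun u => ((u.1, u.2.toFinset) : BWVertex d)) := by
  have h1 : H.full.map (fun u => ((u.1, u.2.toFinset) : BWVertex d)) =
      (H.SL ++ H.SR).map (fun v => (v.1, (dbl conj v.2).toFinset)) ++ ((H.T ++ H.T.map fun v =>
        (v.1, (v.2.map conj).reverse)).map fun u => (u.1, u.2.toFinset)) := by
    simp [full, fullTable, Function.comp_def]
  rw [h1, spineList]
  exact (((List.reverse_perm _).append_right _).map _).append_right _

theorem nodup_spineList : H.spineList.Nodup :=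
  (List.nodup_append'.1 (H.spineList_perm.nodup_iff.2 H.nodup_verts)).1

/-- The real vertices are those which are invariant under conjugation. -/
theorem mem_spineList (hc : ∀ e, conj (conj e) = e) {rot : BWRotation d}
    (hr : ∀ v ∈ H.full, Cyc (rot v.1) v.2) (v : BWVertex d) :
    v ∈ H.spineList ↔ rot.IsVertex v ∧ v.relabel conj = v := by
  have hdbl : ∀ U : List (Fin d), (dbl conj U).toFinset.map conj.toEmbedding =
      (dbl conj U).toFinset := by
    intro U
    ext e
    rw [Finset.mem_map_equiv, List.mem_toFinset, List.mem_toFinset, mem_dbl hc, mem_dbl hc]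
    have h1 : conj.symm e = conj e := by rw [Equiv.symm_apply_eq, hc]
    rw [h1, hc, or_comm]
  have hiff : rot.IsVertex v ↔ v ∈ H.full.map fun u => ((u.1, u.2.toFinset) : BWVertex d) := by
    rw [H.isVertex_iff hc hr, List.mem_map]
  rw [hiff, ← H.spineList_perm.mem_iff, List.mem_append]
  constructor
  · intro hv
    refine ⟨.inl hv, ?_⟩
    obtain ⟨u, -, rfl⟩ := List.mem_map.1 hv
    exact Prod.ext rfl (hdbl _)
  · rintro ⟨hv | hv, hrel⟩
    · exact hv
    -- a vertex off the real line is disjoint from its mirror image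
    exfalso
    have hp := H.pairwise_full
    rw [full, fullTable, List.pairwise_append, List.pairwise_append, List.pairwise_append] at hp
    have hp := hp.2.1.2.1.2.2
    obtain ⟨u, hu, rfl⟩ := List.mem_map.1 hv
    have hrel' : u.2.toFinset.map conj.toEmbedding = u.2.toFinset := congrArg Prod.snd hrel
    have hmem : ∀ e, conj e ∈ u.2 ↔ e ∈ u.2 := by
      intro e
      rw [← List.mem_toFinset, ← List.mem_toFinset]
      conv_rhs => rw [← hrel', Finset.mem_map_equiv]
      rw [show conj.symm e = conj e by rw [Equiv.symm_apply_eq, hc]]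
    have hu0 : u ∈ H.full := by
      rw [full, fullTable]
      exact List.mem_append_right _ (List.mem_append_right _ hu)
    obtain ⟨e, he⟩ := List.exists_mem_of_ne_nil _ (H.ne_nil_of_mem_full hu0)
    rcases List.mem_append.1 hu with hu | hu
    · refine hp u hu _ (List.mem_map_of_mem hu) rfl he ?_
      rw [List.mem_reverse, List.mem_map]
      exact ⟨conj e, (hmem e).2 he, hc e⟩
    · obtain ⟨t, ht, rfl⟩ := List.mem_map.1 hu
      refine hp t ht _ (List.mem_map_of_mem ht) rfl ?_ he
      have := (hmem e).2 he
      simp only [List.mem_reverse, List.mem_map] at this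
      obtain ⟨f, hf, hfe⟩ := this
      rwa [← conj.injective hfe]

theorem isChain_spineList (hc : ∀ e, conj (conj e) = e) {g : Fin d} (hg : g = H.h ∨ g = conj H.h) :
    H.spineList.IsChain fun u v => ∃ e, e ∈ u.2 ∧ e ∈ v.2 ∧ (conj e = e ∨ e = g) := by
  have hm : ∀ {U : List (Fin d)} {e}, e ∈ U → e ∈ dbl conj U := fun h => (mem_dbl hc).2 (.inl h)
  have hg' : ∀ U, g ∈ dbl conj (H.h :: U) := fun U => (mem_dbl hc).2 (by
    rcases hg with rfl | rfl
    · exact .inl (by simp)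
    · exact .inr (by simp [hc]))
  rw [spineList, List.isChain_map, List.isChain_append, List.isChain_reverse]
  refine ⟨H.sideL.isChain.imp ?_, H.sideR.isChain.imp ?_, ?_⟩
  · rintro u v ⟨e, hu, hv, he⟩
    exact ⟨e, List.mem_toFinset.2 (hm hv), List.mem_toFinset.2 (hm hu), .inl he⟩
  · rintro u v ⟨e, hu, hv, he⟩
    exact ⟨e, List.mem_toFinset.2 (hm hu), List.mem_toFinset.2 (hm hv), .inl he⟩
  · obtain ⟨l, S, ⟨U, rfl⟩, hS⟩ := H.sideL.ne_nil
    obtain ⟨l', S', ⟨U', rfl⟩, hS'⟩ := H.sideR.ne_nil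
    rw [List.getLast?_reverse, hS, hS']
    intro x hx y hy
    obtain rfl : _ = x := Option.some_injective _ hx
    obtain rfl : _ = y := Option.some_injective _ hy
    exact ⟨g, List.mem_toFinset.2 (hg' _), List.mem_toFinset.2 (hg' _), .inr rfl⟩

theorem connected (hc : ∀ e, conj (conj e) = e) {rot : BWRotation d}
    (hr : ∀ v ∈ H.full, Cyc (rot v.1) v.2) : rot.skeleton.Connected := by
  let V : BWColour → Fin d → {v // rot.IsVertex v} := fun k e =>
    ⟨vert rot k e, isVertex_vert _ _ _⟩
  have h1 : ∀ k k' e, rot.skeleton.Reachable (V k e) (V k' e) := by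
    intro k k' e
    have h2 := (skeleton_adj_vert rot e).reachable
    cases k <;> cases k'
    · exact SimpleGraph.Reachable.refl _
    · exact h2
    · exact h2.symm
    · exact SimpleGraph.Reachable.refl _
  have h3 : ∀ e, rot.skeleton.Reachable (V white H.h) (V white e) := by
    refine H.induction_edges hc (fun v hv e he f hf h => ?_) (SimpleGraph.Reachable.refl _)
    have h4 : V v.1 e = V v.1 f :=
      Subtype.ext (vert_eq_iff.2 (((hr v hv).sameCycle_iff he).2 hf))
    refine h.trans ((h1 white v.1 e).trans ?_)
    rw [h4]
    exact h1 v.1 white f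
  have h5 : ∀ v, rot.skeleton.Reachable (V white H.h) v := by
    rintro ⟨v, hv⟩
    obtain ⟨e, he⟩ := hv.exists_mem
    have h6 : (⟨v, hv⟩ : {v // rot.IsVertex v}) = V v.1 e := Subtype.ext he
    rw [h6]
    exact (h3 e).trans (h1 _ _ _)
  exact { preconnected := fun u v => (h5 u).symm.trans (h5 v), nonempty := ⟨V white H.h⟩ }

/-- Every table is a table of a real graph. -/
theorem exists_graph (hc : ∀ e, conj (conj e) = e) (hd : H.full.length = d) :
    ∃ G : RealBWGraph d, Nonempty (Presentation G C) := by
  obtain ⟨rot, hr⟩ := H.exists_rot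
  have hR : rot C.cR H.h = conj H.h := by
    obtain ⟨l, S, ⟨U, rfl⟩, hS⟩ := H.sideR.ne_nil
    have h1 := hr (C.cR, (dbl conj (H.h :: U)).reverse) (by simp [full, fullTable, hS])
    have h2 : (dbl conj (H.h :: U)).reverse =
        conj H.h :: ((U.filter fun x => conj x ≠ x).map conj ++ (U.reverse ++ [H.h])) := by
      simp [dbl, H.conj_h]
    dsimp only at h1
    rw [h2] at h1
    rw [h1.2 _ (by simp)]
    have h3 := List.formPerm_apply_getLast (conj H.h)
      ((U.filter fun x => conj x ≠ x).map conj ++ (U.reverse ++ [H.h]))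
    simpa using h3
  have hL : rot C.cR.other (conj H.h) = H.h := by
    obtain ⟨l, S, ⟨U, rfl⟩, hS⟩ := H.sideL.ne_nil
    have h1 := hr (C.cR.other, dbl conj (H.h :: U)) (by simp [full, fullTable, hS])
    have h2 : dbl conj (H.h :: U) =
        H.h :: (U ++ (((U.filter fun x => conj x ≠ x).map conj).reverse ++ [conj H.h])) := by
      simp [dbl, H.conj_h]
    dsimp only at h1
    rw [h2] at h1
    rw [h1.2 _ (by simp)]
    have h3 := List.formPerm_apply_getLast H.h
      (U ++ (((U.filter fun x => conj x ≠ x).map conj).reverse ++ [conj H.h]))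
    simpa using h3
  -- the edge that has the bounded face on its counterclockwise side at the black vertex
  set g := if C.cR = black then H.h else conj H.h with hg
  have hgg : g = H.h ∨ g = conj H.h := by
    rw [hg]
    split_ifs <;> simp
  have hgb : rot black g = conj g := by
    cases hb : C.cR with
    | black => rw [hg, hb, if_pos rfl, ← hR, hb]
    | white =>
      rw [hg, hb, if_neg (by simp), hc]
      rw [hb] at hL
      exact hL
  have hgw : rot white (conj g) = g := by
    cases hb : C.cR with
    | black =>
      rw [hg, hb, if_pos rfl]
      rw [hb] at hL
      exact hL
    | white =>
      rw [hg, hb, if_neg (by simp), hc, ← hR, hb]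
  have hgne : g ≠ conj g := by
    rcases hgg with h | h
    · rw [h]
      exact H.conj_h.symm
    · rw [h, hc]
      exact H.conj_h
  have hpar : rot.Parallel g (conj g) := by
    intro k
    cases k with
    | black =>
      rw [← hgb]
      exact Equiv.Perm.sameCycle_apply_right.2 (Equiv.Perm.SameCycle.refl _ _)
    | white =>
      conv_lhs => rw [← hgw]
      exact Equiv.Perm.sameCycle_apply_left.2 (Equiv.Perm.SameCycle.refl _ _)
  have hconn := H.connected hc hr
  classical
  have hcard : (Finset.univ.filter fun v => rot.IsVertex v).card = d := by
    have h1 : (Finset.univ.filter fun v => rot.IsVertex v) =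
        ⟨((H.full.map fun u => ((u.1, u.2.toFinset) : BWVertex d) : List _) : Multiset _),
          Multiset.coe_nodup.2 H.nodup_verts⟩ := by
      ext v
      simp only [Finset.mem_filter, Finset.mem_univ, true_and, Finset.mem_mk, Multiset.mem_coe,
        H.isVertex_iff hc hr, List.mem_map]
    rw [h1, Finset.card_mk, Multiset.coe_card, List.length_map, hd]
  obtain ⟨hacyc, hpar'⟩ := tree_of_card hconn (by convert hcard) hgne hpar
  let G : RealBWGraph d := {
    rot := rot
    connected := hconn
    acyclic := hacyc
    hole := g
    hole_ne := by rw [hgb]; exact hgne.symm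
    hole_face := by rw [hgb]; exact hgw
    parallel := by rw [hgb]; exact hpar'
    conj := conj
    conj_conj := hc
    conj_rot := H.conj_rot hc hr
    conj_hole := hgb.symm
    spine := H.spineList
    spine_nodup := H.nodup_spineList
    mem_spine := H.mem_spineList hc hr
    spine_chain := H.isChain_spineList hc hgg }
  exact ⟨G, ⟨{ H with hole := rfl, cyc := hr, spine := rfl }⟩⟩

end HalfTable

theorem BWCode.length_forestVerts : ∀ {st : List BWColour} {w : List ℕ}, BWCode.Luk st w →
    (BWCode.forestVerts st w).length = w.length := by
  intro st w
  induction w generalizing st with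
  | nil => cases st <;> simp [forestVerts]
  | cons s w ih => cases st with
    | nil => exact fun h => h.elim
    | cons c st => exact fun h => by simp [forestVerts, ih h.2]

/-- Every valid code is the code of a real graph. -/
theorem BWCode.Valid.exists_graph {d : ℕ} {C : BWCode} (hC : C.Valid d) :
    ∃ G : RealBWGraph d, Nonempty (Presentation G C) := by
  obtain ⟨conj, hc, ⟨H⟩⟩ := hC.exists_halfTable
  refine H.exists_graph hc ?_
  have h1 := congrArg List.length H.map_full
  rw [List.length_map] at h1
  rw [h1]
  simp only [List.length_append, length_altern, length_forestVerts hC.2.2.1]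
  have := hC.2.2.2
  omega


/-! ### The identity in the algebra of the real line -/

theorem pow_mul_of_anticommute {B : Type*} [Ring B] {a b : B} (h : a * b = -(b * a)) (j : ℕ) :
    a ^ j * b = (-1) ^ j * (b * a ^ j) := by
  induction j with
  | zero => simp
  | succ j ih =>
    rw [pow_succ', mul_assoc, ih, ← mul_assoc a, ← ((Commute.neg_one_left a).pow_left j).eq,
      mul_assoc, ← mul_assoc a, h, pow_succ, mul_assoc]
    simp only [neg_mul, mul_neg, one_mul, mul_assoc]

/-- Elements of a ring that stand for the real vertices of both colours in a signed sum over real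
graphs.  In a real graph, a vertex inside a side has even degree, and so has a cycle vertex with no
real vertex beyond it; a vertex at the end of a side has odd degree, and so has a cycle vertex with
real vertices beyond it. -/
structure SpineAlgebra (B : Type*) [Ring B] where
  /-- A real vertex of even degree. -/
  E : BWColour → B
  /-- A vertex of odd degree on the cycle. -/
  C : BWColour → B
  /-- The leftmost real vertex, off the cycle. -/
  L : BWColour → B
  /-- The rightmost real vertex, off the cycle. -/
  R : BWColour → B
  /-- A tree whose root has the given colour, with its mirror image. -/
  x : BWColour → B
  E_mul_C : ∀ c, E c * C c = -(C c * E c)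
  E_mul_R : ∀ c, E c * R c = -(R c * E c)
  L_mul_C : ∀ c, L c * C c = C c * R c
  L_add_R : ∀ c, L c + R c = 2 * (x c.other * C c)
  R_mul_R : ∀ c, R c * R c = x c - x c.other * (E c * E c)
  comm_EE : ∀ c, Commute (E c) (E c.other)
  comm_EC : ∀ c, Commute (E c) (C c.other)
  comm_ER : ∀ c, Commute (E c) (R c.other)
  comm_CC : ∀ c, Commute (C c) (C c.other)
  comm_CR : ∀ c, Commute (C c) (R c.other)
  comm_RR : ∀ c, Commute (R c) (R c.other)
  comm_x : ∀ k c, Commute (x k) (E c) ∧ Commute (x k) (C c)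

/-- The colour of the vertex at distance `i` from one of colour `k` in an alternating chain. -/
def BWColour.alt (k : BWColour) : ℕ → BWColour
  | 0 => k
  | i + 1 => (k.alt i).other

theorem BWColour.alt_two_mul (k : BWColour) (i : ℕ) : k.alt (2 * i) = k := by
  induction i with
  | zero => rfl
  | succ i ih => rw [Nat.mul_succ, alt, alt, other_other, ih]

theorem BWColour.alt_two_mul_add_one (k : BWColour) (i : ℕ) : k.alt (2 * i + 1) = k.other := by
  rw [alt, alt_two_mul]

namespace SpineAlgebra

variable {B : Type*} [Ring B] (S : SpineAlgebra B)

/-- The real vertices to the right of the cycle, from left to right; there are `q + 1` of them, and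
the first has colour `c`. -/
def tailR : BWColour → ℕ → B
  | c, 0 => S.R c
  | c, q + 1 => S.E c * tailR c.other q

/-- The right cycle vertex, of colour `c`, and the `q` real vertices to the right of it. -/
def right (c : BWColour) : ℕ → B
  | 0 => S.E c
  | q + 1 => S.C c * S.tailR c.other q

/-- The real vertices to the left of the cycle, from left to right; there are `p + 1` of them, and
the last has colour `c`. -/
def tailL : BWColour → ℕ → B
  | c, 0 => S.L c
  | c, p + 1 => tailL c.other p * S.E c

/-- The `p` real vertices to the left of the left cycle vertex, which has colour `c`, and this
vertex. -/
def left (c : BWColour) : ℕ → B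
  | 0 => S.E c
  | p + 1 => S.tailL c.other p * S.C c

/-- The term for graphs with `p` real vertices to the left and `q` to the right of the cycle, the
rightmost real vertex having colour `k`. -/
def term (k : BWColour) (p q : ℕ) : B :=
  (-1) ^ (p + 1) * (S.left (k.alt (q + 1)) p * S.right (k.alt q) q)

theorem E_pow_mul_C (c : BWColour) (j : ℕ) :
    S.E c ^ j * S.C c = (-1) ^ j * (S.C c * S.E c ^ j) :=
  pow_mul_of_anticommute (S.E_mul_C c) j

theorem E_pow_mul_R (c : BWColour) (j : ℕ) :
    S.E c ^ j * S.R c = (-1) ^ j * (S.R c * S.E c ^ j) :=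
  pow_mul_of_anticommute (S.E_mul_R c) j

theorem tailR_even (c : BWColour) (j : ℕ) :
    S.tailR c (2 * j) = S.E c.other ^ j * (S.E c ^ j * S.R c) := by
  induction j with
  | zero => simp [tailR]
  | succ j ih =>
    rw [Nat.mul_succ, tailR, tailR, other_other, ih, pow_succ', pow_succ']
    have h := (S.comm_EE c).pow_right (j + 1)
    rw [pow_succ'] at h
    rw [← mul_assoc (S.E c.other), ← mul_assoc, h.eq]
    simp only [mul_assoc]

theorem tailR_odd (c : BWColour) (j : ℕ) :
    S.tailR c (2 * j + 1) = S.E c ^ (j + 1) * (S.E c.other ^ j * S.R c.other) := by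
  rw [tailR, tailR_even, other_other, pow_succ', mul_assoc]

theorem tailL_even (c : BWColour) (j : ℕ) :
    S.tailL c (2 * j) = S.L c * S.E c ^ j * S.E c.other ^ j := by
  induction j with
  | zero => simp [tailL]
  | succ j ih =>
    rw [Nat.mul_succ, tailL, tailL, other_other, ih, pow_succ (S.E c), pow_succ (S.E c.other)]
    have h := (S.comm_EE c).pow_right (j + 1)
    rw [pow_succ] at h
    simp only [mul_assoc]
    rw [h.eq]
    simp only [mul_assoc]

theorem tailL_odd (c : BWColour) (j : ℕ) :
    S.tailL c (2 * j + 1) = S.L c.other * S.E c.other ^ j * S.E c ^ (j + 1) := by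
  rw [tailL, tailL_even, other_other, pow_succ]
  simp only [mul_assoc]

/-- The cycle can be moved along the real line.  Moving it past one vertex of even degree changes the
sign of the product, and the number of vertices on the left changes by one. -/
theorem term_slide (k : BWColour) (p q : ℕ) :
    S.term k (p + 1) (q + 2) = S.term k (p + 2) (q + 1) := by
  have h : ∀ c, S.left c (p + 1) * S.right c.other (q + 2) =
      -(S.left c.other (p + 2) * S.right c (q + 1)) := by
    intro c
    simp only [left, right, tailR, tailL, other_other]
    have h1 : S.C c * (S.C c.other * S.E c) = -(S.E c * (S.C c.other * S.C c)) := by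
      rw [(S.comm_CC c).left_comm, show S.C c * S.E c = -(S.E c * S.C c) by rw [S.E_mul_C, neg_neg],
        mul_neg, ← mul_assoc, ← (S.comm_EC c).eq, mul_assoc]
    calc _ = S.tailL c.other p * (S.C c * (S.C c.other * S.E c)) * S.tailR c.other q := by
          simp only [mul_assoc]
      _ = _ := by
          rw [h1]
          simp only [mul_assoc, neg_mul, mul_neg]
  have h2 := h (k.alt (q + 3))
  simp only [BWColour.alt, other_other] at h2
  simp only [term, BWColour.alt, other_other]
  rw [h2, pow_succ _ (p + 2)]
  simp only [neg_mul, mul_neg, mul_one]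

/-- All terms in which the cycle has real vertices on both sides are equal. -/
theorem sum_term (k : BWColour) (n : ℕ) :
    ∑ i ∈ Finset.range (n + 2), S.term k i (n + 1 - i) =
      S.term k 0 (n + 1) + S.term k (n + 1) 0 + n * S.term k 1 n := by
  have h : ∀ i < n, S.term k (i + 1) (n - i) = S.term k 1 n := by
    intro i
    induction i with
    | zero => intro; rfl
    | succ i ih =>
      intro hi
      rw [← ih (by omega)]
      have := S.term_slide k i (n - (i + 2))
      rw [show n - (i + 2) + 2 = n - i by omega,
        show n - (i + 2) + 1 = n - (i + 1) by omega] at this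
      exact this.symm
  rw [Finset.sum_range_succ, Finset.sum_range_succ', Finset.sum_congr rfl fun i hi => by
    rw [show n + 1 - (i + 1) = n - i by omega, h i (Finset.mem_range.1 hi)]]
  simp only [Finset.sum_const, Finset.card_range, nsmul_eq_mul, Nat.sub_zero, Nat.sub_self]
  abel

/-- The sum of the terms for graphs with an odd number of real vertices is the difference of two of
these. -/
def remainder (k : BWColour) (j : ℕ) : B :=
  (-1) ^ j * (2 * j * (S.x k.other * (S.C k * S.E k ^ j * (S.C k.other * S.E k.other ^ (j - 1)))))

/-- All real vertices of one colour, if there is an even number of real vertices. -/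
def block (c : BWColour) (i : ℕ) : B := S.C c * S.E c ^ i * S.R c

/-- The cycle vertex can be exchanged with the end vertex, which becomes the leftmost one. -/
theorem block_eq (c : BWColour) (i : ℕ) : S.block c i = S.L c * S.E c ^ i * S.C c := by
  have h1 := S.E_pow_mul_R c i
  have h2 := S.E_pow_mul_C c i
  rw [block, mul_assoc, h1, mul_assoc, h2, ← mul_assoc (S.C c), ← mul_assoc (S.L c),
    ← ((Commute.neg_one_left (S.C c)).pow_left i).eq,
    ← ((Commute.neg_one_left (S.L c)).pow_left i).eq, mul_assoc, mul_assoc, ← mul_assoc (S.C c),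
    ← mul_assoc (S.L c), S.L_mul_C]

theorem L_mul_C_mul_E_pow (c : BWColour) (i : ℕ) :
    S.L c * (S.C c * S.E c ^ i) = (-1) ^ i * S.block c i := by
  rw [block_eq, mul_assoc, S.E_pow_mul_C, ← mul_assoc (S.L c) ((-1) ^ i),
    ← ((Commute.neg_one_left (S.L c)).pow_left i).eq, mul_assoc, ← mul_assoc ((-1) ^ i), ← pow_add,
    Even.neg_one_pow ⟨i, rfl⟩, one_mul]

theorem comm_E_block (c : BWColour) (i j : ℕ) :
    Commute (S.E c ^ j) (S.block c.other i) :=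
  ((((S.comm_EC c).mul_right ((S.comm_EE c).pow_right i))).mul_right (S.comm_ER c)).pow_left j

/-- With an even number of real vertices, the sum does not depend on the rightmost colour. -/
theorem sum_term_even (k : BWColour) (j : ℕ) :
    ∑ i ∈ Finset.range (2 * j + 1), S.term k i (2 * j - i) =
      ∑ i ∈ Finset.range (2 * j + 1), S.term k.other i (2 * j - i) := by
  cases j with
  | zero =>
    have h : ∀ k, S.term k 0 0 = -(S.E k.other * S.E k) := fun k => by
      simp [term, left, right, BWColour.alt]
    simp only [Nat.mul_zero, zero_add, Finset.sum_range_one, h, other_other, (S.comm_EE k).eq]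
  | succ i =>
    have h0 : ∀ k, S.term k 0 (2 * i + 1 + 1) = -(S.E k.other ^ (i + 2) * S.block k i) := by
      intro k
      have h1 : k.alt (2 * i + 1 + 1) = k := k.alt_two_mul (i + 1)
      have h2 : k.alt (2 * i + 1 + 1 + 1) = k.other := k.alt_two_mul_add_one (i + 1)
      simp only [term, left, right, h1, h2, tailR_odd, other_other, block]
      have h3 := ((S.comm_EC k.other).pow_left (i + 1)).eq
      rw [other_other] at h3
      rw [← mul_assoc (S.C k), ← h3, pow_succ' _ (i + 1)]
      simp only [mul_assoc, zero_add, pow_one, neg_mul, one_mul]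
    have hn : ∀ k, S.term k (2 * i + 1 + 1) 0 = -(S.E k ^ (i + 2) * S.block k.other i) := by
      intro k
      simp only [term, left, right, BWColour.alt, tailL_odd, other_other]
      have h3 := (S.comm_E_block k i (i + 2)).eq
      have h4 := ((S.comm_EC k).pow_left (i + 1)).eq
      have h5 := (S.comm_EC k).eq
      rw [h3, block_eq, pow_succ (S.E k) (i + 1)]
      rw [mul_assoc (S.L k.other * _) _ (S.C k.other), h4]
      have h6 : (-1 : B) ^ (2 * i + 1 + 1 + 1) = -1 := Odd.neg_one_pow ⟨i + 1, by ring⟩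
      rw [h6]
      simp only [mul_assoc, neg_mul, one_mul]
    have h1 : ∀ k, S.term k 1 (2 * i + 1) = (-1) ^ i * (S.block k.other i * S.block k i) := by
      intro k
      have h2 : k.alt (2 * i + 1) = k.other := k.alt_two_mul_add_one i
      have h3 : k.alt (2 * i + 1 + 1) = k := k.alt_two_mul (i + 1)
      simp only [term, left, right, tailL, h2, h3, other_other, tailR_even]
      have h4 : S.L k.other * S.C k * (S.C k.other * (S.E k.other ^ i * (S.E k ^ i * S.R k))) =
          (S.L k.other * (S.C k.other * S.E k.other ^ i)) * S.block k i := by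
        have h5 := ((S.comm_EC k.other).pow_left i).eq
        have h6 := (S.comm_CC k).eq
        rw [other_other] at h5
        simp only [block, mul_assoc]
        rw [← mul_assoc (S.C k), h6, mul_assoc, ← mul_assoc (S.C k) (S.E k.other ^ i), ← h5]
        simp only [mul_assoc]
      rw [h4, S.L_mul_C_mul_E_pow]
      simp only [mul_assoc]
      simp
    have h2 := S.sum_term k (2 * i + 1)
    have h3 := S.sum_term k.other (2 * i + 1)
    rw [Nat.mul_succ]
    refine h2.trans (Eq.trans ?_ h3.symm)
    have h4 : Commute (S.block k.other i) (S.block k i) := by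
      have e1 : ∀ c, Commute (S.E c ^ i) (S.block c.other i) := fun c => S.comm_E_block c i i
      have e2 := S.comm_EC k.other
      have e3 := S.comm_ER k.other
      have e4 := S.comm_CC k.other
      have e5 := S.comm_CR k.other
      have e6 := S.comm_RR k.other
      have e7 := S.comm_EC k
      have e8 := S.comm_CR k
      rw [other_other] at e2 e3 e4 e5 e6
      have e9 := e1 k.other
      rw [other_other] at e9
      refine Commute.mul_left (Commute.mul_left ?_ e9) ?_
      · exact (e4.mul_right (e7.symm.pow_right i)).mul_right e5
      · exact (e8.symm.mul_right ((S.comm_ER k).symm.pow_right i)).mul_right e6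
    rw [h0, h0, hn, hn, h1, h1, other_other, h4.eq, add_comm (-_) (-_)]

/-- With an odd number of real vertices, the sums telescope. -/
theorem sum_term_odd (k : BWColour) (j : ℕ) :
    ∑ i ∈ Finset.range (2 * j + 1 + 1), S.term k i (2 * j + 1 - i) =
      -S.remainder k (j + 1) - S.remainder k.other j := by
  set p := S.C k.other * S.E k.other ^ j with hp
  have c1 : ∀ i, Commute (S.E k ^ i) p := fun i =>
    ((S.comm_EC k).mul_right ((S.comm_EE k).pow_right j)).pow_left i
  have c2 : Commute (S.C k) p := (S.comm_CC k).mul_right (by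
    have := S.comm_EC k.other
    rw [other_other] at this
    exact this.symm.pow_right j)
  have c3 : Commute p (S.R k) := by
    have h1 := S.comm_CR k.other
    have h2 := S.comm_ER k.other
    rw [other_other] at h1 h2
    exact h1.mul_left (h2.pow_left j)
  have h0 : S.term k 0 (2 * j + 1) = -(S.E k ^ (j + 1) * S.R k * p) := by
    have h1 : k.alt (2 * j + 1) = k.other := k.alt_two_mul_add_one j
    have h2 : k.alt (2 * j + 1 + 1) = k := k.alt_two_mul (j + 1)
    simp only [term, left, right, h1, h2, tailR_even, other_other]
    have h3 := (S.comm_EE k).symm.pow_pow j j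
    have h4 : S.C k.other * (S.E k.other ^ j * (S.E k ^ j * S.R k)) = S.E k ^ j * (S.R k * p) := by
      rw [← c3.eq, ← mul_assoc (S.C k.other), ← hp, ← mul_assoc, ← (c1 j).eq, mul_assoc]
    rw [h4, pow_succ' _ j]
    simp [mul_assoc]
  have hn : S.term k (2 * j + 1) 0 = (-1) ^ j * (S.L k * S.E k ^ (j + 1) * p) := by
    simp only [term, left, right, BWColour.alt, tailL_even, other_other]
    have h6 : (-1 : B) ^ (2 * j + 1 + 1) = 1 := Even.neg_one_pow ⟨j + 1, by ring⟩
    have h7 : S.E k.other ^ j * (S.C k.other * S.E k) = (-1) ^ j * (S.E k * p) := by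
      have := c1 1
      rw [pow_one] at this
      rw [this.eq, ← mul_assoc, S.E_pow_mul_C, mul_assoc]
    have h8 := ((Commute.neg_one_left (S.L k * S.E k ^ j)).pow_left j).eq
    rw [h6, one_mul, mul_assoc _ (S.C k.other), mul_assoc _ (S.E k.other ^ j), h7, pow_succ,
      ← mul_assoc _ ((-1) ^ j), ← h8]
    simp only [mul_assoc]
  have h1 : (j : B) * S.term k 1 (2 * j) = (-1) ^ j * (j *
      (S.x k.other * (S.C k * S.E k ^ (j + 1) * p) - S.x k * (S.C k * S.E k ^ (j - 1) * p))) := by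
    cases j with
    | zero => simp
    | succ i =>
      have h1 : k.alt (2 * (i + 1)) = k := k.alt_two_mul (i + 1)
      have h2 : k.alt (2 * (i + 1) + 1) = k.other := k.alt_two_mul_add_one (i + 1)
      have h3 : S.term k 1 (2 * (i + 1)) = S.L k * (S.C k * (S.E k ^ i * S.R k)) * p := by
        simp only [term, h1, h2]
        rw [Nat.mul_succ]
        simp only [left, right, tailL, tailR_odd, other_other]
        have h4 : S.C k.other * (S.C k * (S.E k.other ^ (i + 1) * (S.E k ^ i * S.R k))) =
            S.C k * (S.E k ^ i * S.R k) * p := by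
          have h5 := S.comm_EC k.other
          rw [other_other] at h5
          rw [← mul_assoc (S.C k), ← (h5.pow_left (i + 1)).eq, mul_assoc, ← mul_assoc (S.C k.other),
            ← hp, ← mul_assoc p, ← c2.eq, mul_assoc, ← mul_assoc p, ← (c1 i).eq, mul_assoc, c3.eq]
          simp only [mul_assoc]
        rw [mul_assoc (S.L k), h4]
        simp [mul_assoc]
      have h5 : S.L k * (S.C k * (S.E k ^ i * S.R k)) =
          (-1) ^ i * (S.x k * (S.C k * S.E k ^ i) - S.x k.other * (S.C k * S.E k ^ (i + 2))) := by
        have h6 := (S.comm_x k k).2.eq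
        have h7 := (S.comm_x k.other k).2.eq
        have h8 := ((Commute.neg_one_left (S.C k * S.R k)).pow_left i).eq
        rw [← mul_assoc (S.L k), S.L_mul_C, S.E_pow_mul_R, ← mul_assoc _ ((-1) ^ i), ← h8,
          mul_assoc, mul_assoc, ← mul_assoc (S.R k), S.R_mul_R, pow_add (S.E k) i 2, sub_mul,
          mul_sub, ← mul_assoc (S.C k), ← h6, ← mul_assoc (S.C k), ← mul_assoc (S.C k), ← h7,
          (Commute.refl (S.E k)).pow_pow i 2, pow_two]
        simp only [mul_assoc]
      rw [h3, h5, pow_succ, Nat.add_sub_cancel, mul_assoc ((-1) ^ i), (Nat.cast_commute (i + 1)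
        ((-1 : B) ^ i)).left_comm]
      noncomm_ring
  have h2 := S.sum_term k (2 * j)
  refine h2.trans ?_
  have h3 : S.term k 0 (2 * j + 1) + S.term k (2 * j + 1) 0 =
      (-1) ^ j * (2 * (S.x k.other * (S.C k * S.E k ^ (j + 1) * p))) := by
    have h4 := S.L_add_R k
    rw [h0, hn, S.E_pow_mul_R]
    have h5 : (2 : B) * (S.x k.other * (S.C k * S.E k ^ (j + 1) * p)) =
        (S.L k + S.R k) * S.E k ^ (j + 1) * p := by
      rw [h4]
      simp only [mul_assoc]
    rw [h5, pow_succ]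
    noncomm_ring
  have h4 : S.remainder k (j + 1) = -((-1) ^ j * ((2 * j + 2) *
      (S.x k.other * (S.C k * S.E k ^ (j + 1) * p)))) := by
    rw [remainder, Nat.add_sub_cancel, ← hp, pow_succ]
    push_cast
    noncomm_ring
  have h5 : S.remainder k.other j = (-1) ^ j * (2 * j *
      (S.x k * (S.C k * S.E k ^ (j - 1) * p))) := by
    rw [remainder, other_other, ← hp, (c2.mul_left (c1 (j - 1))).eq]
  rw [h3, h4, h5, Nat.cast_mul, mul_assoc _ (j : B), h1]
  push_cast
  noncomm_ring

/-- In the sum over all graphs, everything but the two last remainders cancels. -/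
theorem sum_sum_term (k : BWColour) (M : ℕ) :
    ∑ n ∈ Finset.range (2 * M), ∑ i ∈ Finset.range (n + 1), S.term k i (n - i) + S.remainder k M =
      ∑ n ∈ Finset.range (2 * M), ∑ i ∈ Finset.range (n + 1), S.term k.other i (n - i) +
        S.remainder k.other M := by
  induction M with
  | zero => simp [remainder]
  | succ M ih =>
    have h : ∀ k, ∑ n ∈ Finset.range (2 * (M + 1)), ∑ i ∈ Finset.range (n + 1), S.term k i (n - i) =
        ∑ n ∈ Finset.range (2 * M), ∑ i ∈ Finset.range (n + 1), S.term k i (n - i) +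
          ∑ i ∈ Finset.range (2 * M + 1), S.term k i (2 * M - i) +
            ∑ i ∈ Finset.range (2 * M + 1 + 1), S.term k i (2 * M + 1 - i) := fun k => by
      rw [Nat.mul_succ, Finset.sum_range_succ _ (2 * M + 1), Finset.sum_range_succ _ (2 * M)]
    rw [h, h, S.sum_term_even, S.sum_term_odd, S.sum_term_odd, other_other, ← sub_eq_zero]
    rw [← sub_eq_zero] at ih
    rw [← ih]
    abel

end SpineAlgebra


/-! ### Operators that count disorders -/

/-- A sign for every colour and degree: the parity of the number of disorders which a further vertex
of that colour and degree has with the vertices to the left of it. -/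
abbrev SignState : Type := BWColour × ℕ → ℤˣ

/-- The change of signs that records the disorders with a vertex `v`. -/
def twist (v : BWColour × ℕ) : SignState := fun u => if u.1 = v.1 ∧ u.2 < v.2 then -1 else 1

theorem twist_mul_self (v : BWColour × ℕ) : twist v * twist v = 1 := by
  funext u
  rw [Pi.mul_apply, twist]
  split_ifs <;> rfl

theorem levelDisorders_cons (v : BWColour × ℕ) (l : List (BWColour × ℕ)) :
    levelDisorders (v :: l) =
      levelDisorders l + l.countP fun u => u.1 = v.1 ∧ u.2 < v.2 := by
  have h : ∀ c n, ((l.filter fun v => v.1 = c).map Prod.snd).countP (fun b => b < n) =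
      l.countP fun u => u.1 = c ∧ u.2 < n := by
    intro c n
    rw [List.countP_map, List.countP_filter]
    refine List.countP_congr fun u _ => ?_
    simp [and_comm]
  obtain ⟨c, n⟩ := v
  cases c
  · simp only [levelDisorders, List.filter_cons]
    simp only [decide_true, if_true, List.map_cons, disorders, h, reduceCtorEq, decide_false,
      Bool.false_eq_true, if_false]
    omega
  · simp only [levelDisorders, List.filter_cons]
    simp only [decide_true, if_true, List.map_cons, disorders, h, reduceCtorEq, decide_false,
      Bool.false_eq_true, if_false]
    omega

section Operators

variable (R : Type*) [CommRing R]

/-- The operator that belongs to a real vertex of given colour and degree: it multiplies with the sign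
that the state prescribes, and updates the state.  A product of such operators, taken in the order
of the vertices from left to right, yields the sign of the disorders. -/
def vertexOp (v : BWColour × ℕ) : Module.End R (SignState → R) where
  toFun φ σ := ((σ v : ℤ) : R) * φ (σ * twist v)
  map_add' φ ψ := by
    funext σ
    simp [mul_add]
  map_smul' r φ := by
    funext σ
    simp [mul_left_comm]

variable {R}

theorem vertexOp_apply (v : BWColour × ℕ) (φ : SignState → R) (σ : SignState) :
    vertexOp R v φ σ = ((σ v : ℤ) : R) * φ (σ * twist v) := rfl

theorem vertexOp_mul_apply (u v : BWColour × ℕ) (φ : SignState → R) (σ : SignState) :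
    (vertexOp R u * vertexOp R v) φ σ =
      ((twist u v : ℤ) : R) * (((σ u : ℤ) : R) * ((σ v : ℤ) : R) * φ (σ * twist u * twist v)) := by
  rw [Module.End.mul_apply, vertexOp_apply, vertexOp_apply, Pi.mul_apply]
  push_cast
  ring

theorem vertexOp_mul_self (v : BWColour × ℕ) : vertexOp R v * vertexOp R v = 1 := by
  refine LinearMap.ext fun φ => funext fun σ => ?_
  rw [vertexOp_mul_apply, mul_assoc σ, twist_mul_self, mul_one, Module.End.one_apply]
  have h : ((σ v : ℤ) : R) * ((σ v : ℤ) : R) = 1 := by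
    rw [← Int.cast_mul, ← Units.val_mul, Int.units_mul_self]
    simp
  simp [h, twist]

/-- Operators of different colours commute. -/
theorem vertexOp_comm {u v : BWColour × ℕ} (h : u.1 ≠ v.1) :
    Commute (vertexOp R u) (vertexOp R v) := by
  refine LinearMap.ext fun φ => funext fun σ => ?_
  rw [vertexOp_mul_apply, vertexOp_mul_apply, mul_right_comm σ,
    mul_comm ((σ u : ℤ) : R)]
  simp [twist, h, h.symm]

/-- Different operators of the same colour anticommute. -/
theorem vertexOp_anticomm {c : BWColour} {m n : ℕ} (h : m ≠ n) :
    vertexOp R (c, m) * vertexOp R (c, n) + vertexOp R (c, n) * vertexOp R (c, m) = 0 := by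
  refine LinearMap.ext fun φ => funext fun σ => ?_
  rw [LinearMap.add_apply, Pi.add_apply, vertexOp_mul_apply, vertexOp_mul_apply,
    mul_right_comm σ (twist (c, n))]
  rcases h.lt_or_gt with h | h
  · simp [twist, h, h.not_gt, mul_comm]
  · simp [twist, h, h.not_gt, mul_comm]

/-- The product of the operators of the vertices in a list counts the disorders. -/
theorem prod_vertexOp_apply (l : List (BWColour × ℕ)) (σ : SignState) :
    (l.map (vertexOp R)).prod (fun _ => 1) σ =
      (-1) ^ levelDisorders l * (((l.map σ).prod : ℤˣ) : ℤ) := by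
  induction l generalizing σ with
  | nil => simp [levelDisorders, disorders]
  | cons v l ih =>
    have h : (l.map (σ * twist v)).prod =
        (l.map σ).prod * (-1) ^ l.countP fun u => u.1 = v.1 ∧ u.2 < v.2 := by
      clear ih
      induction l with
      | nil => simp
      | cons u l ih =>
        rw [List.map_cons, List.prod_cons, ih, List.map_cons, List.prod_cons, List.countP_cons]
        by_cases hu : u.1 = v.1 ∧ u.2 < v.2
        · simp [hu, twist, pow_succ, mul_assoc]
        · simp [hu, twist, mul_assoc]
    rw [List.map_cons, List.prod_cons, Module.End.mul_apply, vertexOp_apply, ih, h,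
      levelDisorders_cons, List.map_cons, List.prod_cons]
    push_cast
    ring

/-- The operator for a real vertex of colour `c` whose degree `s` ranges over `S`, with the weight
`f s`. -/
def weightedOp (S : Finset ℕ) (c : BWColour) (f : ℕ → R) : Module.End R (SignState → R) :=
  ∑ s ∈ S, f s • vertexOp R (c, s)

theorem weightedOp_comm (S : Finset ℕ) {c k : BWColour} (h : c ≠ k) (f g : ℕ → R) :
    Commute (weightedOp S c f) (weightedOp S k g) :=
  Commute.sum_left _ _ _ fun _ _ => Commute.sum_right _ _ _ fun _ _ =>
    ((vertexOp_comm h).smul_left _).smul_right _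

/-- The mixed products in the square of a sum of anticommuting operators cancel. -/
theorem weightedOp_mul_self (S : Finset ℕ) (c : BWColour) (f : ℕ → R) :
    weightedOp S c f * weightedOp S c f = (∑ s ∈ S, f s * f s) • 1 := by
  classical
  induction S using Finset.induction_on with
  | empty => simp [weightedOp]
  | insert a S ha ih =>
    have h : weightedOp S c f * vertexOp R (c, a) + vertexOp R (c, a) * weightedOp S c f = 0 := by
      rw [weightedOp, Finset.sum_mul, Finset.mul_sum, ← Finset.sum_add_distrib]
      refine Finset.sum_eq_zero fun s hs => ?_
      have hsa : s ≠ a := fun h => ha (h ▸ hs)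
      rw [smul_mul_assoc, mul_smul_comm, ← smul_add, vertexOp_anticomm hsa, smul_zero]
    have h1 : weightedOp (insert a S) c f = f a • vertexOp R (c, a) + weightedOp S c f := by
      rw [weightedOp, Finset.sum_insert ha]
      rfl
    rw [h1, Finset.sum_insert ha, add_smul, ← ih, add_mul, mul_add, mul_add, smul_mul_smul_comm,
      vertexOp_mul_self, smul_mul_assoc, mul_smul_comm]
    have h2 : f a • (weightedOp S c f * vertexOp R (c, a)) +
        f a • (vertexOp R (c, a) * weightedOp S c f) = 0 := by rw [← smul_add, h, smul_zero]
    rw [add_assoc, ← add_assoc (f a • _), add_comm (f a • _) (f a • _), h2, zero_add]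

theorem weightedOp_mul_add (S : Finset ℕ) (c : BWColour) (f g : ℕ → R) :
    weightedOp S c f * weightedOp S c g + weightedOp S c g * weightedOp S c f =
      (2 * ∑ s ∈ S, f s * g s) • 1 := by
  have h := weightedOp_mul_self S c fun s => f s + g s
  have h1 : weightedOp S c (fun s => f s + g s) = weightedOp S c f + weightedOp S c g := by
    rw [weightedOp, weightedOp, weightedOp, ← Finset.sum_add_distrib]
    exact Finset.sum_congr rfl fun s _ => add_smul _ _ _
  have h2 : ∑ s ∈ S, (f s + g s) * (f s + g s) =
      ∑ s ∈ S, f s * f s + ∑ s ∈ S, g s * g s + 2 * ∑ s ∈ S, f s * g s := by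
    rw [Finset.mul_sum, ← Finset.sum_add_distrib, ← Finset.sum_add_distrib]
    exact Finset.sum_congr rfl fun s _ => by ring
  rw [h1, h2, add_smul, add_smul, ← weightedOp_mul_self, ← weightedOp_mul_self, add_mul, mul_add,
    mul_add] at h
  refine add_left_cancel (a := weightedOp S c f * weightedOp S c f +
    weightedOp S c g * weightedOp S c g) (Eq.trans ?_ h)
  abel

/-- The value of an operator at the constant function `1` and the trivial state. -/
def evalOp : Module.End R (SignState → R) →ₗ[R] R where
  toFun b := b (fun _ => 1) 1
  map_add' _ _ := rfl
  map_smul' _ _ := rfl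

theorem evalOp_prod (l : List (BWColour × ℕ)) :
    evalOp ((l.map (vertexOp R)).prod) = (-1) ^ levelDisorders l := by
  change (l.map (vertexOp R)).prod (fun _ => 1) 1 = _
  have h : (l.map (1 : SignState)).prod = 1 := List.prod_eq_one fun u hu => by
    obtain ⟨v, -, rfl⟩ := List.mem_map.1 hu
    rfl
  rw [prod_vertexOp_apply, h, Units.val_one, Int.cast_one, mul_one]

/-- The values of the function `b φ` are divisible by a higher power of `z` than those of `φ`. -/
def RaisesOrder (z : R) (n : ℕ) (b : Module.End R (SignState → R)) : Prop :=
  ∀ j φ, (∀ σ, z ^ j ∣ φ σ) → ∀ σ, z ^ (n + j) ∣ b φ σ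

theorem RaisesOrder.mul {z : R} {m n : ℕ} {a b : Module.End R (SignState → R)}
    (ha : RaisesOrder z m a) (hb : RaisesOrder z n b) : RaisesOrder z (m + n) (a * b) := by
  intro j φ hφ σ
  rw [add_assoc]
  exact ha _ _ (hb _ _ hφ) σ

theorem RaisesOrder.pow {z : R} {a : Module.End R (SignState → R)}
    (ha : RaisesOrder z 1 a) (n : ℕ) : RaisesOrder z n (a ^ n) := by
  induction n with
  | zero =>
    intro j φ hφ σ
    simpa using hφ σ
  | succ n ih =>
    rw [pow_succ]
    exact ih.mul ha

theorem RaisesOrder.algebraMap (z r : R) : RaisesOrder z 0 (algebraMap R _ r) := by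
  intro j φ hφ σ
  rw [zero_add]
  exact Dvd.dvd.mul_left (hφ σ) r

theorem RaisesOrder.dvd_evalOp {z : R} {n : ℕ} {a : Module.End R (SignState → R)}
    (ha : RaisesOrder z n a) : z ^ n ∣ evalOp a := by
  have := ha 0 (fun _ => 1) (fun _ => by simp) 1
  rwa [add_zero] at this

theorem raisesOrder_weightedOp {z : R} {S : Finset ℕ} {c : BWColour} {f : ℕ → R}
    (hf : ∀ s ∈ S, z ∣ f s) : RaisesOrder z 1 (weightedOp S c f) := by
  intro j φ hφ σ
  rw [weightedOp, LinearMap.sum_apply, Finset.sum_apply]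
  refine Finset.dvd_sum fun s hs => ?_
  rw [LinearMap.smul_apply, Pi.smul_apply, vertexOp_apply, pow_add, pow_one, smul_eq_mul]
  exact mul_dvd_mul (hf s hs) (Dvd.dvd.mul_left (hφ _) _)

end Operators


/-! ### Generating functions -/

section Lists

/-- The lists of length `n` with entries in `S`. -/
def listsOf (S : Finset ℕ) : ℕ → Finset (List ℕ)
  | 0 => {[]}
  | n + 1 => (S ×ˢ listsOf S n).image fun p => p.1 :: p.2

theorem sum_listsOf_succ {M : Type*} [AddCommMonoid M] (S : Finset ℕ) (n : ℕ) (f : List ℕ → M) :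
    ∑ l ∈ listsOf S (n + 1), f l = ∑ s ∈ S, ∑ l ∈ listsOf S n, f (s :: l) := by
  rw [listsOf, Finset.sum_image, Finset.sum_product]
  rintro ⟨a, l⟩ _ ⟨b, l'⟩ _ h
  simpa using h

theorem mem_listsOf {S : Finset ℕ} {n : ℕ} {l : List ℕ} :
    l ∈ listsOf S n ↔ l.length = n ∧ ∀ s ∈ l, s ∈ S := by
  induction n generalizing l with
  | zero => cases l <;> simp [listsOf]
  | succ n ih =>
    cases l with
    | nil => simp [listsOf]
    | cons a l =>
      simp only [listsOf, Finset.mem_image, Finset.mem_product, Prod.exists, List.cons.injEq,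
        List.length_cons, Nat.add_right_cancel_iff, List.mem_cons, forall_eq_or_imp]
      constructor
      · rintro ⟨_, _, ⟨h1, h2⟩, rfl, rfl⟩
        exact ⟨(ih.1 h2).1, h1, (ih.1 h2).2⟩
      · exact fun h => ⟨a, l, ⟨h.2.1, ih.2 ⟨h.1, h.2.2⟩⟩, rfl, rfl⟩

theorem ne_nil_of_mem_listsOf {S : Finset ℕ} {n : ℕ} {l : List ℕ} (h : l ∈ listsOf S (n + 1)) :
    l ≠ [] := by
  rintro rfl
  simp [mem_listsOf] at h

end Lists

/-- Polynomials in variables that mark the colours and degrees of the vertices. -/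
abbrev DegreeRing : Type := MvPolynomial (BWColour × ℕ) ℤ

/-- The monomial of a list of vertices. -/
noncomputable def degreeMonomial (l : List (BWColour × ℕ)) : DegreeRing :=
  (l.map MvPolynomial.X).prod

theorem degreeMonomial_append (l l' : List (BWColour × ℕ)) :
    degreeMonomial (l ++ l') = degreeMonomial l * degreeMonomial l' := by
  simp [degreeMonomial]

theorem degreeMonomial_cons (v : BWColour × ℕ) (l : List (BWColour × ℕ)) :
    degreeMonomial (v :: l) = MvPolynomial.X v * degreeMonomial l := by
  simp [degreeMonomial]

section Forests

variable (S : Finset ℕ)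

/-- The generating polynomial of pairs of a plane forest with root colours `st` and its mirror
image, with `n` vertices together and degrees in `S`. -/
noncomputable def forestCoeff : ℕ → List BWColour → DegreeRing
  | 0, [] => 1
  | 0, _ :: _ => 0
  | 1, _ => 0
  | _ + 2, [] => 0
  | n + 2, c :: st => ∑ s ∈ S, MvPolynomial.X (c, s) ^ 2 *
      forestCoeff n (List.replicate (s - 1) c.other ++ st)

open Classical in
/-- The recursion for `forestCoeff` is that of the words in `BWCode.Luk`. -/
theorem forestCoeff_two_mul (hS : 0 ∉ S) (m : ℕ) (st : List BWColour) :
    forestCoeff S (2 * m) st = ∑ w ∈ listsOf S m, if BWCode.Luk st w then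
      degreeMonomial (BWCode.forestVerts st w ++ BWCode.forestVerts st w) else 0 := by
  induction m generalizing st with
  | zero =>
    cases st with
    | nil =>
      rw [listsOf, Finset.sum_singleton, if_pos (show BWCode.Luk [] [] from trivial)]
      simp [forestCoeff, BWCode.forestVerts, degreeMonomial]
    | cons => simp [forestCoeff, listsOf, BWCode.Luk]
  | succ m ih =>
    rw [sum_listsOf_succ, Nat.mul_succ]
    cases st with
    | nil => simp [forestCoeff, BWCode.Luk]
    | cons c st =>
      rw [forestCoeff]
      refine Finset.sum_congr rfl fun s hs => ?_
      have h1 : 1 ≤ s := Nat.one_le_iff_ne_zero.2 fun h => hS (h ▸ hs)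
      rw [ih, Finset.mul_sum]
      refine Finset.sum_congr rfl fun w _ => ?_
      rw [mul_ite, mul_zero]
      simp only [BWCode.Luk, h1, true_and, BWCode.forestVerts, degreeMonomial_append,
        degreeMonomial_cons]
      congr 1
      ring

theorem forestCoeff_odd (m : ℕ) (st : List BWColour) : forestCoeff S (2 * m + 1) st = 0 := by
  induction m generalizing st with
  | zero => rfl
  | succ m ih =>
    rw [show 2 * (m + 1) + 1 = 2 * m + 1 + 2 by ring]
    cases st with
    | nil => rfl
    | cons c st => simp [forestCoeff, ih]

/-- The generating function of plane forests with root colours `st`, together with their mirror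
images. -/
noncomputable def forestSeries (st : List BWColour) : PowerSeries DegreeRing :=
  PowerSeries.mk fun n => forestCoeff S n st

theorem forestSeries_nil : forestSeries S [] = 1 := by
  ext1 n
  rw [forestSeries, PowerSeries.coeff_mk, PowerSeries.coeff_one]
  match n with
  | 0 => rfl
  | 1 => rfl
  | n + 2 => rfl

theorem forestSeries_cons (c : BWColour) (st : List BWColour) :
    forestSeries S (c :: st) = PowerSeries.X ^ 2 * ∑ s ∈ S,
      PowerSeries.C (MvPolynomial.X (c, s) ^ 2) *
        forestSeries S (List.replicate (s - 1) c.other ++ st) := by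
  ext1 n
  rw [PowerSeries.coeff_X_pow_mul', forestSeries, PowerSeries.coeff_mk]
  match n with
  | 0 => rfl
  | 1 => rfl
  | n + 2 =>
    rw [if_pos (by omega), map_sum, Nat.add_sub_cancel, forestCoeff]
    refine Finset.sum_congr rfl fun s _ => ?_
    rw [PowerSeries.coeff_C_mul, forestSeries, PowerSeries.coeff_mk]

theorem forestSeries_append (st st' : List BWColour) :
    forestSeries S (st ++ st') = forestSeries S st * forestSeries S st' := by
  ext1 n
  induction n using Nat.strong_induction_on generalizing st st' with
  | _ n ih =>
    cases st with
    | nil => rw [List.nil_append, forestSeries_nil, one_mul]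
    | cons c st =>
      rw [List.cons_append, forestSeries_cons, forestSeries_cons, mul_assoc,
        PowerSeries.coeff_X_pow_mul', PowerSeries.coeff_X_pow_mul']
      split_ifs with h
      · rw [Finset.sum_mul, map_sum, map_sum]
        refine Finset.sum_congr rfl fun s _ => ?_
        rw [mul_assoc, PowerSeries.coeff_C_mul, PowerSeries.coeff_C_mul, ← List.append_assoc,
          ih _ (by omega)]
      · rfl

theorem forestSeries_replicate (n : ℕ) (c : BWColour) :
    forestSeries S (List.replicate n c) = forestSeries S [c] ^ n := by
  induction n with
  | zero => simp [forestSeries_nil]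
  | succ n ih =>
    rw [List.replicate_succ, ← List.singleton_append, forestSeries_append, ih, pow_succ']

/-- The functional equation of the generating function of plane trees. -/
theorem forestSeries_singleton (c : BWColour) :
    forestSeries S [c] = PowerSeries.X ^ 2 * ∑ s ∈ S,
      PowerSeries.C (MvPolynomial.X (c, s) ^ 2) * forestSeries S [c.other] ^ (s - 1) := by
  rw [forestSeries_cons]
  simp only [List.append_nil, forestSeries_replicate]

end Forests

section SideWeights

variable (S : Finset ℕ)

open Classical in
/-- The weight of the real vertices with the degrees `D` on one side of the bounded face, and of
all that hangs on them. -/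
noncomputable def sideWeight (t : ℕ) (c : BWColour) (D : List ℕ) : PowerSeries DegreeRing :=
  if BWCode.SideOK t D then PowerSeries.X ^ D.length *
    PowerSeries.C (degreeMonomial (BWCode.altern c D)) *
      forestSeries S (BWCode.slotCols t c D) else 0

open Classical in
/-- The weight of a real vertex of degree `s` which is not the last one on its side. -/
noncomputable def midWeight (t : ℕ) (c : BWColour) (s : ℕ) : PowerSeries DegreeRing :=
  if ∃ k, s = 2 * k + 2 + t then PowerSeries.X * PowerSeries.C (MvPolynomial.X (c, s)) *
    forestSeries S [c.other] ^ ((s - 2 - t) / 2) else 0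

open Classical in
/-- The weight of the last real vertex on its side. -/
noncomputable def lastWeight (t : ℕ) (c : BWColour) (s : ℕ) : PowerSeries DegreeRing :=
  if ∃ k, s = 2 * k + 1 + t then PowerSeries.X * PowerSeries.C (MvPolynomial.X (c, s)) *
    forestSeries S [c.other] ^ ((s - 1 - t) / 2) else 0

theorem sideWeight_singleton (t : ℕ) (c : BWColour) (s : ℕ) :
    sideWeight S t c [s] = lastWeight S t c s := by
  by_cases h : ∃ k, s = 2 * k + 1 + t
  · rw [sideWeight, lastWeight, if_pos h, if_pos (show BWCode.SideOK t [s] from h),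
      BWCode.slotCols, forestSeries_replicate, List.length_singleton, pow_one]
    simp [BWCode.altern, degreeMonomial]
  · rw [sideWeight, lastWeight, if_neg h, if_neg (show ¬ BWCode.SideOK t [s] from h)]

theorem sideWeight_cons (t : ℕ) (c : BWColour) (s : ℕ) {D : List ℕ} (hD : D ≠ []) :
    sideWeight S t c (s :: D) = midWeight S t c s * sideWeight S 0 c.other D := by
  obtain ⟨s', D, rfl⟩ := List.exists_cons_of_ne_nil hD
  by_cases h1 : ∃ k, s = 2 * k + 2 + t
  · by_cases h2 : BWCode.SideOK 0 (s' :: D)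
    · rw [sideWeight, midWeight, sideWeight, if_pos h1, if_pos h2,
        if_pos (show BWCode.SideOK t (s :: s' :: D) from ⟨h1, h2⟩), BWCode.slotCols,
        forestSeries_append, forestSeries_replicate, BWCode.altern, degreeMonomial_cons,
        List.length_cons, pow_succ', map_mul]
      ring
    · rw [sideWeight, sideWeight, if_neg h2, mul_zero,
        if_neg (show ¬ BWCode.SideOK t (s :: s' :: D) from fun h => h2 h.2)]
  · rw [sideWeight, midWeight, if_neg h1, zero_mul,
      if_neg (show ¬ BWCode.SideOK t (s :: s' :: D) from fun h => h1 h.1)]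

/-- A cycle vertex with no real vertex beyond it has the weight of a vertex inside a side. -/
theorem lastWeight_one (c : BWColour) (s : ℕ) : lastWeight S 1 c s = midWeight S 0 c s := by
  unfold lastWeight midWeight
  congr 1

/-- The generating operator of the real vertices on the right of the bounded face. -/
noncomputable def rightOp (t : ℕ) (c : BWColour) (q : ℕ) :
    Module.End (PowerSeries DegreeRing) (SignState → PowerSeries DegreeRing) :=
  ∑ D ∈ listsOf S (q + 1), sideWeight S t c D • ((BWCode.altern c D).map (vertexOp _)).prod

/-- The generating operator of the real vertices on the left of the bounded face.  A vertex is
counted with the sign `-1` if its degree is one: this differs from the contribution of the vertex to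
`BWCode.pol` by a factor `-1` for every vertex, which `SpineAlgebra.term` puts right. -/
noncomputable def leftOp (t : ℕ) (c : BWColour) (p : ℕ) :
    Module.End (PowerSeries DegreeRing) (SignState → PowerSeries DegreeRing) :=
  ∑ D ∈ listsOf S (p + 1), ((-1) ^ (D.length + D.countP fun s => 1 < s) * sideWeight S t c D) •
    ((BWCode.altern c D).reverse.map (vertexOp _)).prod

theorem rightOp_zero (t : ℕ) (c : BWColour) :
    rightOp S t c 0 = weightedOp S c (lastWeight S t c) := by
  rw [rightOp, sum_listsOf_succ, weightedOp]
  refine Finset.sum_congr rfl fun s _ => ?_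
  simp [listsOf, sideWeight_singleton, BWCode.altern]

theorem rightOp_succ (t : ℕ) (c : BWColour) (q : ℕ) :
    rightOp S t c (q + 1) = weightedOp S c (midWeight S t c) * rightOp S 0 c.other q := by
  rw [rightOp, sum_listsOf_succ, weightedOp, rightOp, Finset.sum_mul]
  refine Finset.sum_congr rfl fun s _ => ?_
  rw [Finset.mul_sum]
  refine Finset.sum_congr rfl fun D hD => ?_
  rw [sideWeight_cons S t c s (ne_nil_of_mem_listsOf hD), smul_mul_smul_comm, BWCode.altern,
    List.map_cons, List.prod_cons]

/-- The weight of the leftmost real vertex, with a sign if its degree is one. -/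
noncomputable def firstWeight (t : ℕ) (c : BWColour) (s : ℕ) : PowerSeries DegreeRing :=
  if s = 1 then -lastWeight S t c s else lastWeight S t c s

theorem leftOp_zero (hS : 0 ∉ S) (t : ℕ) (c : BWColour) :
    leftOp S t c 0 = weightedOp S c (firstWeight S t c) := by
  rw [leftOp, sum_listsOf_succ, weightedOp]
  refine Finset.sum_congr rfl fun s hs => ?_
  have h1 : 1 ≤ s := Nat.one_le_iff_ne_zero.2 fun h => hS (h ▸ hs)
  rw [listsOf, Finset.sum_singleton, sideWeight_singleton, firstWeight]
  by_cases h : s = 1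
  · simp [h, BWCode.altern]
  · have : 1 < s := by omega
    simp [h, this, BWCode.altern]

theorem leftOp_succ (t : ℕ) (c : BWColour) (p : ℕ) :
    leftOp S t c (p + 1) = leftOp S 0 c.other p * weightedOp S c (midWeight S t c) := by
  rw [leftOp, sum_listsOf_succ, weightedOp, leftOp, Finset.mul_sum]
  refine Finset.sum_congr rfl fun s _ => ?_
  rw [Finset.sum_mul]
  refine Finset.sum_congr rfl fun D hD => ?_
  rw [sideWeight_cons S t c s (ne_nil_of_mem_listsOf hD), smul_mul_smul_comm, BWCode.altern,
    List.reverse_cons, List.map_append, List.prod_append, List.map_singleton, List.prod_singleton]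
  congr 1
  by_cases h : ∃ k, s = 2 * k + 2 + t
  · have h1 : 1 < s := by
      obtain ⟨k, rfl⟩ := h
      omega
    rw [List.countP_cons_of_pos (by simpa using h1), List.length_cons,
      show D.length + 1 + (D.countP (fun s => decide (1 < s)) + 1) =
        D.length + D.countP (fun s => decide (1 < s)) + 2 by ring, pow_add]
    ring
  · simp [midWeight, h]

end SideWeights


/-! ### The operators of the real vertices -/

section SpineSeries

variable (S : Finset ℕ)

/-- The degree of a vertex inside a side is even, and that of a cycle vertex with real vertices beyond
it is odd. -/
theorem midWeight_mul_midWeight (c : BWColour) (s : ℕ) :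
    midWeight S 0 c s * midWeight S 1 c s = 0 := by
  unfold midWeight
  split_ifs with h h'
  · obtain ⟨k, hk⟩ := h
    obtain ⟨k', hk'⟩ := h'
    omega
  all_goals simp

theorem midWeight_mul_lastWeight (c : BWColour) (s : ℕ) :
    midWeight S 0 c s * lastWeight S 0 c s = 0 := by
  unfold midWeight lastWeight
  split_ifs with h h'
  · obtain ⟨k, hk⟩ := h
    obtain ⟨k', hk'⟩ := h'
    omega
  all_goals simp

/-- Vertices of degree one cancel, and each other vertex at the end of a side becomes a vertex on the
cycle by replacing one tree and its mirror image by the cycle. -/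
theorem firstWeight_add_lastWeight (c : BWColour) (s : ℕ) :
    firstWeight S 0 c s + lastWeight S 0 c s =
      2 * (forestSeries S [c.other] * midWeight S 1 c s) := by
  unfold firstWeight
  by_cases h1 : s = 1
  · have h : ¬ ∃ k, s = 2 * k + 2 + 1 := by
      rintro ⟨k, hk⟩
      omega
    rw [if_pos h1, midWeight, if_neg h]
    simp
  · rw [if_neg h1, lastWeight, midWeight]
    by_cases h : ∃ k, s = 2 * k + 1 + 0
    · obtain ⟨k, rfl⟩ := h
      obtain ⟨k, rfl⟩ : ∃ j, k = j + 1 := ⟨k - 1, by omega⟩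
      rw [if_pos ⟨_, rfl⟩, if_pos ⟨k, by ring⟩,
        show (2 * (k + 1) + 1 + 0 - 1 - 0) / 2 = k + 1 by omega,
        show (2 * (k + 1) + 1 + 0 - 2 - 1) / 2 = k by omega]
      ring
    · rw [if_neg h, if_neg]
      · simp
      · rintro ⟨k, rfl⟩
        exact h ⟨k + 1, by ring⟩

theorem lastWeight_mul_midWeight (c : BWColour) (s : ℕ) :
    lastWeight S 0 c s * midWeight S 1 c s =
      forestSeries S [c.other] * (midWeight S 1 c s * midWeight S 1 c s) := by
  rw [lastWeight, midWeight]
  by_cases h : ∃ k, s = 2 * k + 2 + 1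
  · obtain ⟨k, rfl⟩ := h
    rw [if_pos (show ∃ j, 2 * k + 2 + 1 = 2 * j + 1 + 0 from ⟨k + 1, by ring⟩),
      if_pos (show ∃ j, 2 * k + 2 + 1 = 2 * j + 2 + 1 from ⟨k, rfl⟩),
      show (2 * k + 2 + 1 - 1 - 0) / 2 = k + 1 by omega,
      show (2 * k + 2 + 1 - 2 - 1) / 2 = k by omega]
    ring
  · rw [if_neg h]
    simp

theorem lastWeight_sq_add {s : ℕ} (hs : s ≠ 0) (c : BWColour) :
    lastWeight S 0 c s * lastWeight S 0 c s +
      forestSeries S [c.other] * (midWeight S 0 c s * midWeight S 0 c s) =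
      PowerSeries.X ^ 2 * (PowerSeries.C (MvPolynomial.X (c, s) ^ 2) *
        forestSeries S [c.other] ^ (s - 1)) := by
  rw [lastWeight, midWeight]
  rcases Nat.even_or_odd' s with ⟨k, rfl | rfl⟩
  · obtain ⟨k, rfl⟩ : ∃ j, k = j + 1 := ⟨k - 1, by omega⟩
    rw [if_neg, if_pos ⟨k, by ring⟩, show (2 * (k + 1) - 2 - 0) / 2 = k by omega,
      show 2 * (k + 1) - 1 = 2 * k + 1 by omega, map_pow]
    · ring
    · rintro ⟨j, hj⟩
      omega
  · rw [if_pos ⟨k, rfl⟩, if_neg, show (2 * k + 1 - 1 - 0) / 2 = k by omega, Nat.add_sub_cancel,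
      map_pow]
    · ring
    · rintro ⟨j, hj⟩
      omega

/-- The functional equation for plane trees relates the weights of the real vertices. -/
theorem sum_lastWeight_sq (hS : 0 ∉ S) (c : BWColour) :
    ∑ s ∈ S, lastWeight S 0 c s * lastWeight S 0 c s = forestSeries S [c] -
      forestSeries S [c.other] * ∑ s ∈ S, midWeight S 0 c s * midWeight S 0 c s := by
  rw [eq_sub_iff_add_eq, Finset.mul_sum, ← Finset.sum_add_distrib, forestSeries_singleton S c,
    Finset.mul_sum]
  exact Finset.sum_congr rfl fun s hs => lastWeight_sq_add S (fun h => hS (h ▸ hs)) c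

theorem algebraMap_mul_weightedOp {R : Type*} [CommRing R] (S : Finset ℕ) (c : BWColour) (r : R)
    (f : ℕ → R) : algebraMap R _ r * weightedOp S c f = weightedOp S c fun s => r * f s := by
  rw [← Algebra.smul_def, weightedOp, weightedOp, Finset.smul_sum]
  exact Finset.sum_congr rfl fun s _ => smul_smul _ _ _

theorem weightedOp_mul_eq_neg {R : Type*} [CommRing R] {S : Finset ℕ} {c : BWColour} {f g : ℕ → R}
    (h : ∀ s, f s * g s = 0) :
    weightedOp S c f * weightedOp S c g = -(weightedOp S c g * weightedOp S c f) := by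
  rw [eq_neg_iff_add_eq_zero, weightedOp_mul_add]
  simp [h]

/-- The operators of the real vertices, with the generating functions of trees as scalars. -/
noncomputable def spineAlgebra (hS : 0 ∉ S) :
    SpineAlgebra (Module.End (PowerSeries DegreeRing) (SignState → PowerSeries DegreeRing)) where
  E c := weightedOp S c (midWeight S 0 c)
  C c := weightedOp S c (midWeight S 1 c)
  L c := weightedOp S c (firstWeight S 0 c)
  R c := weightedOp S c (lastWeight S 0 c)
  x c := algebraMap _ _ (forestSeries S [c])
  E_mul_C c := weightedOp_mul_eq_neg (midWeight_mul_midWeight S c)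
  E_mul_R c := weightedOp_mul_eq_neg (midWeight_mul_lastWeight S c)
  L_mul_C c := by
    have h1 : weightedOp S c (firstWeight S 0 c) = (2 : PowerSeries DegreeRing) •
        (forestSeries S [c.other] • weightedOp S c (midWeight S 1 c)) -
          weightedOp S c (lastWeight S 0 c) := by
      rw [eq_sub_iff_add_eq, weightedOp, weightedOp, weightedOp, ← Finset.sum_add_distrib,
        Finset.smul_sum, Finset.smul_sum]
      refine Finset.sum_congr rfl fun s _ => ?_
      rw [← add_smul, firstWeight_add_lastWeight, mul_smul, mul_smul]
    have h2 := weightedOp_mul_add S c (lastWeight S 0 c) (midWeight S 1 c)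
    have h3 : ∑ s ∈ S, lastWeight S 0 c s * midWeight S 1 c s = forestSeries S [c.other] *
        ∑ s ∈ S, midWeight S 1 c s * midWeight S 1 c s := by
      rw [Finset.mul_sum]
      exact Finset.sum_congr rfl fun s _ => lastWeight_mul_midWeight S c s
    rw [h3, mul_smul, mul_smul, ← weightedOp_mul_self] at h2
    rw [h1, sub_mul, smul_mul_assoc, smul_mul_assoc, ← h2, add_sub_cancel_left]
  L_add_R c := by
    rw [algebraMap_mul_weightedOp, two_mul, weightedOp, weightedOp, weightedOp,
      ← Finset.sum_add_distrib, ← Finset.sum_add_distrib]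
    refine Finset.sum_congr rfl fun s _ => ?_
    rw [← add_smul, ← add_smul, firstWeight_add_lastWeight, two_mul]
  R_mul_R c := by
    rw [weightedOp_mul_self, weightedOp_mul_self, sum_lastWeight_sq S hS,
      ← Algebra.algebraMap_eq_smul_one, ← Algebra.algebraMap_eq_smul_one, map_sub, map_mul]
  comm_EE c := weightedOp_comm S (ne_other c) _ _
  comm_EC c := weightedOp_comm S (ne_other c) _ _
  comm_ER c := weightedOp_comm S (ne_other c) _ _
  comm_CC c := weightedOp_comm S (ne_other c) _ _
  comm_CR c := weightedOp_comm S (ne_other c) _ _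
  comm_RR c := weightedOp_comm S (ne_other c) _ _
  comm_x k c := ⟨Algebra.commute_algebraMap_left _ _, Algebra.commute_algebraMap_left _ _⟩

variable {S} (hS : 0 ∉ S)

theorem rightOp_eq_tailR (c : BWColour) (q : ℕ) :
    rightOp S 0 c q = (spineAlgebra S hS).tailR c q := by
  induction q generalizing c with
  | zero => exact rightOp_zero S 0 c
  | succ q ih =>
    rw [rightOp_succ, ih]
    rfl

theorem rightOp_eq_right (c : BWColour) (q : ℕ) :
    rightOp S 1 c q = (spineAlgebra S hS).right c q := by
  cases q with
  | zero =>
    rw [rightOp_zero, funext (lastWeight_one S c)]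
    rfl
  | succ q =>
    rw [rightOp_succ, rightOp_eq_tailR hS]
    rfl

theorem leftOp_eq_tailL (c : BWColour) (p : ℕ) :
    leftOp S 0 c p = (spineAlgebra S hS).tailL c p := by
  induction p generalizing c with
  | zero => exact leftOp_zero S hS 0 c
  | succ p ih =>
    rw [leftOp_succ, ih]
    rfl

theorem leftOp_eq_left (c : BWColour) (p : ℕ) :
    leftOp S 1 c p = (spineAlgebra S hS).left c p := by
  cases p with
  | zero =>
    have h : firstWeight S 1 c = midWeight S 0 c := by
      funext s
      rw [firstWeight, lastWeight_one]
      split_ifs with h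
      · have h' : ¬ ∃ k, s = 2 * k + 2 + 0 := by
          rintro ⟨k, hk⟩
          omega
        rw [midWeight, if_neg h', neg_zero]
      · rfl
    rw [leftOp_zero S hS, h]
    rfl
  | succ p =>
    rw [leftOp_succ, leftOp_eq_tailL hS]
    rfl

/-- The signed sum over the degrees of the real vertices. -/
theorem evalOp_term (k : BWColour) (p q : ℕ) :
    evalOp ((spineAlgebra S hS).term k p q) = ∑ DL ∈ listsOf S (p + 1), ∑ DR ∈ listsOf S (q + 1),
      (-1) ^ (levelDisorders ((BWCode.altern (k.alt (q + 1)) DL).reverse ++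
        BWCode.altern (k.alt q) DR) + DL.countP fun s => 1 < s) *
          (sideWeight S 1 (k.alt (q + 1)) DL * sideWeight S 1 (k.alt q) DR) := by
  have h : ∀ (n : ℕ) (b : Module.End (PowerSeries DegreeRing) (SignState → PowerSeries DegreeRing)),
      (-1) ^ n * b = ((-1 : PowerSeries DegreeRing) ^ n) • b := by
    intro n b
    rw [Algebra.smul_def, map_pow, map_neg, map_one]
  rw [SpineAlgebra.term, ← rightOp_eq_right, ← leftOp_eq_left, h, map_smul, leftOp, rightOp,
    Finset.sum_mul, map_sum, Finset.smul_sum]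
  refine Finset.sum_congr rfl fun DL hDL => ?_
  rw [Finset.mul_sum, map_sum, Finset.smul_sum]
  refine Finset.sum_congr rfl fun DR _ => ?_
  rw [smul_mul_smul_comm, map_smul, ← List.prod_append, ← List.map_append, evalOp_prod,
    (mem_listsOf.1 hDL).1, smul_eq_mul, smul_eq_mul, pow_add _ (p + 1),
    pow_add _ (levelDisorders _)]
  have h2 : (-1 : PowerSeries DegreeRing) ^ (p + 1) * (-1) ^ (p + 1) = 1 := by
    rw [← pow_add, Even.neg_one_pow ⟨p + 1, rfl⟩]
  linear_combination ((-1) ^ (DL.countP fun s => 1 < s) * sideWeight S 1 (k.alt (q + 1)) DL *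
    sideWeight S 1 (k.alt q) DR * (-1) ^ levelDisorders
      ((BWCode.altern (k.alt (q + 1)) DL).reverse ++ BWCode.altern (k.alt q) DR)) * h2

/-- The remainder is a product of more than `d` operators of real vertices, each of which is divisible
by the variable that counts the edges. -/
theorem coeff_evalOp_remainder (k : BWColour) {d M : ℕ} (hd : d < 2 * M) :
    PowerSeries.coeff d (evalOp ((spineAlgebra S hS).remainder k M)) = 0 := by
  have hmid : ∀ t c, RaisesOrder (PowerSeries.X : PowerSeries DegreeRing) 1
      (weightedOp S c (midWeight S t c)) := by
    intro t c
    refine raisesOrder_weightedOp fun s _ => ?_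
    rw [midWeight]
    split_ifs
    · rw [mul_assoc]
      exact dvd_mul_right _ _
    · exact dvd_zero _
  have h1 : RaisesOrder (PowerSeries.X : PowerSeries DegreeRing) (0 + (0 + (0 + ((1 + M) +
      (1 + (M - 1)))))) ((spineAlgebra S hS).remainder k M) := by
    rw [SpineAlgebra.remainder]
    refine RaisesOrder.mul ?_ (RaisesOrder.mul ?_ (RaisesOrder.mul (RaisesOrder.algebraMap _ _)
      (((hmid 1 _).mul ((hmid 0 _).pow _)).mul ((hmid 1 _).mul ((hmid 0 _).pow _)))))
    · rw [show (-1 : Module.End (PowerSeries DegreeRing) (SignState → PowerSeries DegreeRing)) ^ M =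
        algebraMap (PowerSeries DegreeRing) _ ((-1) ^ M) by rw [map_pow, map_neg, map_one]]
      exact RaisesOrder.algebraMap _ _
    · rw [show (2 * M : Module.End (PowerSeries DegreeRing) (SignState → PowerSeries DegreeRing)) =
        algebraMap (PowerSeries DegreeRing) _ (2 * M) by rw [map_mul, map_ofNat, map_natCast]]
      exact RaisesOrder.algebraMap _ _
  exact PowerSeries.X_pow_dvd_iff.1 h1.dvd_evalOp d (by omega)

/-- The generating functions of both kinds of graphs agree. -/
theorem coeff_sum_evalOp_term (k : BWColour) {d M : ℕ} (hd : d < 2 * M) :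
    ∑ n ∈ Finset.range (2 * M), ∑ i ∈ Finset.range (n + 1),
        PowerSeries.coeff d (evalOp ((spineAlgebra S hS).term k i (n - i))) =
      ∑ n ∈ Finset.range (2 * M), ∑ i ∈ Finset.range (n + 1),
        PowerSeries.coeff d (evalOp ((spineAlgebra S hS).term k.other i (n - i))) := by
  have h := congrArg (fun b => PowerSeries.coeff d (evalOp b))
    ((spineAlgebra S hS).sum_sum_term k M)
  simpa only [map_add, map_sum, coeff_evalOp_remainder hS _ hd, add_zero] using h

end SpineSeries


/-! ### The sum over codes -/

section Monomials

theorem degreeMonomial_eq (l : List (BWColour × ℕ)) :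
    degreeMonomial l =
      MvPolynomial.monomial (Multiset.toFinsupp (l : Multiset (BWColour × ℕ))) 1 := by
  induction l with
  | nil => simp [degreeMonomial]
  | cons v l ih =>
    rw [degreeMonomial_cons, ih, ← Multiset.cons_coe, ← Multiset.singleton_add, map_add,
      Multiset.toFinsupp_singleton, MvPolynomial.X, MvPolynomial.monomial_mul, one_mul]

theorem coeff_degreeMonomial (l : List (BWColour × ℕ)) (m : Multiset (BWColour × ℕ)) :
    MvPolynomial.coeff (Multiset.toFinsupp m) (degreeMonomial l) =
      if (l : Multiset (BWColour × ℕ)) = m then 1 else 0 := by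
  rw [degreeMonomial_eq, MvPolynomial.coeff_monomial]
  congr 1
  rw [EmbeddingLike.apply_eq_iff_eq]

/-- A list of vertices is determined, up to order, by the degrees of both colours. -/
theorem coe_eq_map_add_map_iff (l : List (BWColour × ℕ)) (mw mb : Multiset ℕ) :
    (l : Multiset (BWColour × ℕ)) = mw.map (Prod.mk white) + mb.map (Prod.mk black) ↔
      (((l.filter fun v => v.1 = white).map Prod.snd : List ℕ) : Multiset ℕ) = mw ∧
        (((l.filter fun v => v.1 = black).map Prod.snd : List ℕ) : Multiset ℕ) = mb := by
  have h1 : ∀ c, (((l.filter fun v => v.1 = c).map Prod.snd : List ℕ) : Multiset ℕ) =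
      ((l : Multiset (BWColour × ℕ)).filter fun v => v.1 = c).map Prod.snd := fun c => by simp
  have h2 : ∀ (c k : BWColour) (m : Multiset ℕ),
      ((m.map (Prod.mk c)).filter fun v => v.1 = k).map Prod.snd = if c = k then m else 0 := by
    intro c k m
    rw [Multiset.filter_map, Multiset.map_map]
    by_cases hck : c = k <;> simp [hck]
  constructor
  · intro h
    rw [h1, h1, h, Multiset.filter_add, Multiset.filter_add, Multiset.map_add, Multiset.map_add,
      h2, h2, h2, h2]
    simp
  · rintro ⟨rfl, rfl⟩
    have h3 : ∀ c, Multiset.map (Prod.mk c)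
        (((l.filter fun v => v.1 = c).map Prod.snd : List ℕ) : Multiset ℕ) =
        (l : Multiset (BWColour × ℕ)).filter fun v => v.1 = c := by
      intro c
      rw [h1, Multiset.map_map]
      refine (Multiset.map_congr rfl fun v hv => ?_).trans (Multiset.map_id _)
      exact Prod.ext (Multiset.mem_filter.1 hv).2.symm rfl
    rw [h3, h3]
    conv_lhs => rw [← Multiset.filter_add_not (fun v : BWColour × ℕ => v.1 = white) l]
    congr 1
    refine Multiset.filter_congr fun v _ => ?_
    cases v.1 <;> simp

end Monomials

section Codes

variable (S : Finset ℕ)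

/-- The lists of length at most `d` with entries in `S`. -/
def wordsUpTo (d : ℕ) : Finset (List ℕ) := (Finset.range (d + 1)).biUnion (listsOf S)

theorem sum_wordsUpTo {M : Type*} [AddCommMonoid M] (d : ℕ) (f : List ℕ → M) :
    ∑ w ∈ wordsUpTo S d, f w = ∑ m ∈ Finset.range (d + 1), ∑ w ∈ listsOf S m, f w := by
  rw [wordsUpTo, Finset.sum_biUnion]
  intro m _ n _ hmn
  refine Finset.disjoint_left.2 fun l h1 h2 => hmn ?_
  rw [← (mem_listsOf.1 h1).1, (mem_listsOf.1 h2).1]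

open Classical in
/-- The product of the weights of both sides is the generating function of the codes with given real
vertices. -/
theorem coeff_sideWeight_mul (hS : 0 ∉ S) (d : ℕ) (c : BWColour) (DL DR : List ℕ) :
    PowerSeries.coeff d (sideWeight S 1 c.other DL * sideWeight S 1 c DR) =
      ∑ w ∈ wordsUpTo S d, if BWCode.Valid d ⟨c, DL, DR, w⟩ then
        degreeMonomial (BWCode.verts ⟨c, DL, DR, w⟩) else 0 := by
  by_cases hL : BWCode.SideOK 1 DL
  swap
  · rw [sideWeight, if_neg hL, zero_mul, map_zero]
    exact (Finset.sum_eq_zero fun w _ => if_neg fun h => hL h.1).symm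
  by_cases hR : BWCode.SideOK 1 DR
  swap
  · rw [sideWeight, sideWeight, if_neg hR, mul_zero, map_zero]
    exact (Finset.sum_eq_zero fun w _ => if_neg fun h => hR h.2.1).symm
  have h1 : sideWeight S 1 c.other DL * sideWeight S 1 c DR =
      PowerSeries.X ^ (DL.length + DR.length) * (PowerSeries.C (degreeMonomial
        (BWCode.altern c.other DL ++ BWCode.altern c DR)) *
          forestSeries S (BWCode.stack ⟨c, DL, DR, []⟩)) := by
    rw [sideWeight, sideWeight, if_pos hL, if_pos hR, BWCode.stack, forestSeries_append,
      degreeMonomial_append, map_mul]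
    ring
  have h2 : ∀ w, BWCode.Valid d ⟨c, DL, DR, w⟩ ↔ BWCode.Luk (BWCode.stack ⟨c, DL, DR, []⟩) w ∧
      DL.length + DR.length + 2 * w.length = d := fun w =>
    ⟨fun h => h.2.2, fun h => ⟨hL, hR, h⟩⟩
  rw [h1, PowerSeries.coeff_X_pow_mul', PowerSeries.coeff_C_mul, forestSeries, PowerSeries.coeff_mk,
    sum_wordsUpTo]
  simp only [h2]
  by_cases h : ∃ m, DL.length + DR.length + 2 * m = d
  · obtain ⟨m, hm⟩ := h
    rw [if_pos (by omega), show d - (DL.length + DR.length) = 2 * m by omega,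
      forestCoeff_two_mul S hS, Finset.sum_eq_single m, Finset.mul_sum]
    · refine Finset.sum_congr rfl fun w hw => ?_
      have h3 := (mem_listsOf.1 hw).1
      rw [mul_ite, mul_zero, ← degreeMonomial_append, List.append_assoc]
      simp only [h3, hm, and_true]
      rfl
    · intro n _ hn
      refine Finset.sum_eq_zero fun w hw => if_neg fun h => hn ?_
      have h3 := (mem_listsOf.1 hw).1
      have := h.2
      omega
    · intro h
      exact absurd (Finset.mem_range.2 (by omega)) h
  · rw [Finset.sum_eq_zero fun n _ => Finset.sum_eq_zero fun w _ => if_neg fun h' => h ⟨_, h'.2⟩]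
    split_ifs with h4
    · rcases Nat.even_or_odd' (d - (DL.length + DR.length)) with ⟨m, hm | hm⟩
      · exact absurd ⟨m, by omega⟩ h
      · rw [hm, forestCoeff_odd, mul_zero]
    · rfl

open Classical in
/-- The codes in which the rightmost real vertex has colour `k`, there are fewer than `2 * M + 2`
real vertices, at most `d` vertices in the upper half plane, and all degrees lie in `S`. -/
noncomputable def codes (k : BWColour) (d M : ℕ) : Finset BWCode :=
  ((((Finset.range (2 * M)).sigma fun n => Finset.range (n + 1)).biUnion fun x =>
    listsOf S (x.2 + 1) ×ˢ listsOf S (x.1 - x.2 + 1)) ×ˢ wordsUpTo S d).image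
      fun p => ⟨k.alt (p.1.2.length - 1), p.1.1, p.1.2, p.2⟩

theorem sum_codes {A : Type*} [AddCommMonoid A] (k : BWColour) (d M : ℕ) (f : BWCode → A) :
    ∑ C ∈ codes S k d M, f C = ∑ n ∈ Finset.range (2 * M), ∑ i ∈ Finset.range (n + 1),
      ∑ DL ∈ listsOf S (i + 1), ∑ DR ∈ listsOf S (n - i + 1), ∑ w ∈ wordsUpTo S d,
        f ⟨k.alt (n - i), DL, DR, w⟩ := by
  classical
  rw [codes, Finset.sum_image, Finset.sum_product, Finset.sum_biUnion, Finset.sum_sigma]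
  · refine Finset.sum_congr rfl fun n _ => Finset.sum_congr rfl fun i _ => ?_
    rw [Finset.sum_product]
    refine Finset.sum_congr rfl fun DL _ => Finset.sum_congr rfl fun DR hDR =>
      Finset.sum_congr rfl fun w _ => ?_
    dsimp only
    rw [(mem_listsOf.1 hDR).1, Nat.add_sub_cancel]
  · rintro ⟨n, i⟩ hx ⟨n', i'⟩ hy hxy
    refine Finset.disjoint_left.2 fun p h1 h2 => hxy ?_
    have h3 := Finset.mem_range.1 (Finset.mem_sigma.1 hx).2
    have h4 := Finset.mem_range.1 (Finset.mem_sigma.1 hy).2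
    obtain ⟨h5, h6⟩ := Finset.mem_product.1 h1
    obtain ⟨h7, h8⟩ := Finset.mem_product.1 h2
    have e5 := (mem_listsOf.1 h5).1
    have e6 := (mem_listsOf.1 h6).1
    have e7 := (mem_listsOf.1 h7).1
    have e8 := (mem_listsOf.1 h8).1
    dsimp only at h3 h4 e5 e6 e7 e8
    obtain rfl : i = i' := by omega
    obtain rfl : n = n' := by omega
    rfl
  · rintro ⟨⟨DL, DR⟩, w⟩ _ ⟨⟨DL', DR'⟩, w'⟩ _ h
    simp only [BWCode.mk.injEq] at h
    obtain ⟨-, rfl, rfl, rfl⟩ := h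
    rfl

open Classical in
/-- The generating function of the signed codes is the one computed with operators. -/
theorem sum_codes_eq (hS : 0 ∉ S) (k : BWColour) (d M : ℕ) :
    ∑ C ∈ codes S k d M, (if C.Valid d then C.sign • degreeMonomial C.verts else 0) =
      ∑ n ∈ Finset.range (2 * M), ∑ i ∈ Finset.range (n + 1),
        PowerSeries.coeff d (evalOp ((spineAlgebra S hS).term k i (n - i))) := by
  rw [sum_codes]
  refine Finset.sum_congr rfl fun n _ => Finset.sum_congr rfl fun i _ => ?_
  rw [evalOp_term, map_sum]
  refine Finset.sum_congr rfl fun DL _ => ?_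
  rw [map_sum]
  refine Finset.sum_congr rfl fun DR _ => ?_
  have h : ∀ (a : ℕ) (f : PowerSeries DegreeRing), PowerSeries.coeff d ((-1) ^ a * f) =
      ((-1 : ℤ) ^ a) • PowerSeries.coeff d f := by
    intro a f
    rcases Nat.even_or_odd a with ha | ha <;> simp [ha.neg_one_pow]
  rw [h, BWColour.alt, coeff_sideWeight_mul S hS, Finset.smul_sum]
  refine Finset.sum_congr rfl fun w _ => ?_
  split_ifs
  · rfl
  · rw [smul_zero]

theorem BWColour.alt_alt (k : BWColour) (n : ℕ) : (k.alt n).alt n = k := by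
  rcases Nat.even_or_odd' n with ⟨m, rfl | rfl⟩
  · rw [alt_two_mul, alt_two_mul]
  · rw [alt_two_mul_add_one, alt_two_mul_add_one, other_other]

theorem BWColour.alt_other (k : BWColour) (n : ℕ) : k.other.alt n = (k.alt n).other := by
  induction n with
  | zero => rfl
  | succ n ih => rw [alt, alt, ih]

/-- The rightmost real vertex. -/
theorem BWCode.map_getLast?_altern (c : BWColour) {D : List ℕ} (hD : D ≠ []) :
    ((altern c D).getLast?).map Prod.fst = some (c.alt (D.length - 1)) := by
  induction D generalizing c with
  | nil => exact absurd rfl hD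
  | cons s D ih =>
    cases D with
    | nil => rfl
    | cons s' D =>
      have h1 := ih c.other (by simp)
      have h2 : (altern c (s :: s' :: D)).getLast? = (altern c.other (s' :: D)).getLast? := by
        simp only [altern]
        rw [List.getLast?_cons_cons]
      rw [h2, h1, BWColour.alt_other]
      rfl

theorem BWCode.SideOK.ne_nil {t : ℕ} {D : List ℕ} (h : BWCode.SideOK t D) : D ≠ [] := by
  rintro rfl
  exact h

variable {S}

theorem BWCode.Valid.mem_codes {d M : ℕ} {C : BWCode} (hC : C.Valid d) {k : BWColour}
    (hk : C.Sided k) (hM : d ≤ 2 * M) (hdeg : ∀ v ∈ C.verts, v.2 ∈ S) :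
    C ∈ codes S k d M := by
  classical
  obtain ⟨c, DL, DR, w⟩ := C
  have hL := hC.1.ne_nil
  have hR := hC.2.1.ne_nil
  have hd := hC.2.2.2
  dsimp only at hL hR hd
  rw [Sided, map_getLast?_altern _ hR, Option.some_inj] at hk
  have hLp := List.length_pos_of_ne_nil hL
  have hRp := List.length_pos_of_ne_nil hR
  have hmem : ∀ c D s, s ∈ D → ∃ v ∈ altern c D, v.2 = s := by
    intro c D s hs
    rw [← map_snd_altern c D] at hs
    exact List.mem_map.1 hs
  have hw : ∀ st w, Luk st w → ∀ s ∈ w, ∃ v ∈ forestVerts st w, v.2 = s := by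
    intro st w
    induction w generalizing st with
    | nil => simp
    | cons s w ih =>
      cases st with
      | nil => exact fun h => h.elim
      | cons c st =>
        intro h s' hs'
        rcases List.mem_cons.1 hs' with rfl | hs'
        · exact ⟨(c, s'), by simp [forestVerts], rfl⟩
        · obtain ⟨v, hv, hvs⟩ := ih _ h.2 s' hs'
          exact ⟨v, by simp [forestVerts, hv], hvs⟩
  rw [codes, Finset.mem_image]
  refine ⟨((DL, DR), w), Finset.mem_product.2 ⟨Finset.mem_biUnion.2
    ⟨⟨DL.length + DR.length - 2, DL.length - 1⟩, ?_, Finset.mem_product.2 ⟨?_, ?_⟩⟩, ?_⟩, ?_⟩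
  · exact Finset.mem_sigma.2 ⟨Finset.mem_range.2 (by dsimp only; omega),
      Finset.mem_range.2 (by dsimp only; omega)⟩
  · refine mem_listsOf.2 ⟨by dsimp only; omega, fun s hs => ?_⟩
    obtain ⟨v, hv, rfl⟩ := hmem c.other DL s hs
    exact hdeg v (by simp [verts, hv])
  · refine mem_listsOf.2 ⟨by dsimp only; omega, fun s hs => ?_⟩
    obtain ⟨v, hv, rfl⟩ := hmem c DR s hs
    exact hdeg v (by simp [verts, hv])
  · refine Finset.mem_biUnion.2 ⟨w.length, Finset.mem_range.2 (by omega),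
      mem_listsOf.2 ⟨rfl, fun s hs => ?_⟩⟩
    obtain ⟨v, hv, rfl⟩ := hw _ _ hC.2.2.1 s hs
    exact hdeg v (by simp [verts, hv])
  · rw [← hk, BWColour.alt_alt]

theorem sided_of_mem_codes {d M : ℕ} {C : BWCode} {k : BWColour} (h : C ∈ codes S k d M) :
    C.Sided k := by
  classical
  rw [codes, Finset.mem_image] at h
  obtain ⟨⟨⟨DL, DR⟩, w⟩, hp, rfl⟩ := h
  obtain ⟨x, -, hx⟩ := Finset.mem_biUnion.1 (Finset.mem_product.1 hp).1
  have hR := ne_nil_of_mem_listsOf (Finset.mem_product.1 hx).2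
  dsimp only at hR
  rw [BWCode.Sided, BWCode.map_getLast?_altern _ hR, BWColour.alt_alt]

end Codes

/-! ### Isomorphism classes and codes -/

namespace RealBWGraph

variable {d : ℕ}

/-- The code of an isomorphism class. -/
noncomputable def IsoClass.code (q : IsoClass d) : BWCode := (exists_presentation q.out).choose

theorem IsoClass.presentation (q : IsoClass d) : Nonempty (Presentation q.out q.code) :=
  (exists_presentation q.out).choose_spec

theorem IsoClass.code_injective : Function.Injective (IsoClass.code (d := d)) := by
  intro q q' h
  obtain ⟨P⟩ := q.presentation
  obtain ⟨P'⟩ := q'.presentation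
  rw [← h] at P'
  rw [← q.out_eq, ← q'.out_eq]
  exact Quotient.sound (P.exists_isIso P')

theorem IsoClass.exists_code_eq {C : BWCode} (hC : C.Valid d) : ∃ q : IsoClass d, q.code = C := by
  obtain ⟨G, ⟨P⟩⟩ := hC.exists_graph
  obtain ⟨Q⟩ := IsoClass.presentation ⟦G⟧
  obtain ⟨τ, hτ⟩ : ∃ τ, IsIso (Quotient.out (⟦G⟧ : IsoClass d)) G τ := Quotient.mk_out G
  exact ⟨⟦G⟧, (Q.code_unique P hτ).symm⟩

theorem IsoClass.valid_code (q : IsoClass d) : q.code.Valid d := by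
  obtain ⟨P⟩ := q.presentation
  exact P.valid

theorem IsoClass.sign_eq (q : IsoClass d) : q.sign = q.code.sign := by
  obtain ⟨P⟩ := q.presentation
  conv_lhs => rw [← q.out_eq]
  exact P.sign_eq

theorem IsoClass.sided_iff (q : IsoClass d) (k : BWColour) : q.Sided k ↔ q.code.Sided k := by
  obtain ⟨P⟩ := q.presentation
  conv_lhs => rw [← q.out_eq]
  exact P.sided_iff k

theorem IsoClass.degrees_eq (q : IsoClass d) (k : BWColour) : q.degrees k =
    ((q.code.verts.filter fun v => v.1 = k).map Prod.snd : Multiset ℕ) := by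
  obtain ⟨P⟩ := q.presentation
  conv_lhs => rw [← q.out_eq]
  exact P.degrees_eq k

/-- The signed number of graphs is a coefficient of the generating function of the codes. -/
theorem signedCount_eq (Λw Λb : d.Partition) (k : BWColour) :
    signedCount {q | q ∈ classes Λw Λb ∧ q.Sided k} =
      MvPolynomial.coeff (Multiset.toFinsupp
        (Λw.parts.map (Prod.mk white) + Λb.parts.map (Prod.mk black)))
        (∑ n ∈ Finset.range (2 * d), ∑ i ∈ Finset.range (n + 1), PowerSeries.coeff d
          (evalOp ((spineAlgebra (Finset.Icc 1 d) (by simp)).term k i (n - i)))) := by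
  classical
  rw [← sum_codes_eq, MvPolynomial.coeff_sum]
  set m := Λw.parts.map (Prod.mk white) + Λb.parts.map (Prod.mk black) with hm
  have h1 : ∀ C : BWCode, MvPolynomial.coeff (Multiset.toFinsupp m)
      (if C.Valid d then C.sign • degreeMonomial C.verts else 0) =
      if C.Valid d ∧ (C.verts : Multiset (BWColour × ℕ)) = m then C.sign else 0 := by
    intro C
    by_cases hC : C.Valid d
    · rw [if_pos hC, MvPolynomial.coeff_smul, coeff_degreeMonomial]
      by_cases hv : (C.verts : Multiset (BWColour × ℕ)) = m <;> simp [hC, hv]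
    · simp [hC]
  rw [Finset.sum_congr rfl fun C _ => h1 C, ← Finset.sum_filter, signedCount,
    ← finsum_mem_coe_finset]
  refine finsum_mem_eq_of_bijOn IsoClass.code ⟨?_, IsoClass.code_injective.injOn, ?_⟩
    fun q _ => q.sign_eq
  · rintro q ⟨⟨hw, hb⟩, hs⟩
    have hv : (q.code.verts : Multiset (BWColour × ℕ)) = m := by
      rw [hm, coe_eq_map_add_map_iff, ← q.degrees_eq, ← q.degrees_eq]
      exact ⟨hw, hb⟩
    refine Finset.mem_coe.2 (Finset.mem_filter.2 ⟨?_, q.valid_code, hv⟩)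
    refine q.valid_code.mem_codes ((q.sided_iff k).1 hs) (by omega) fun v hvm => ?_
    rw [← Multiset.mem_coe, hv, hm, Multiset.mem_add, Multiset.mem_map, Multiset.mem_map] at hvm
    have h2 : ∀ (Λ : d.Partition), ∀ s ∈ Λ.parts, s ∈ Finset.Icc 1 d := fun Λ s hs =>
      Finset.mem_Icc.2 ⟨Λ.parts_pos hs, by
        have := Multiset.single_le_sum (fun _ _ => Nat.zero_le _) s hs
        rwa [Λ.parts_sum] at this⟩
    rcases hvm with ⟨s, hs, rfl⟩ | ⟨s, hs, rfl⟩
    · exact h2 _ s hs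
    · exact h2 _ s hs
  · intro C hC
    obtain ⟨hC, hval, hv⟩ := Finset.mem_filter.1 (Finset.mem_coe.1 hC)
    obtain ⟨q, rfl⟩ := IsoClass.exists_code_eq hval
    refine ⟨q, ⟨?_, (q.sided_iff k).2 (sided_of_mem_codes hC)⟩, rfl⟩
    rw [hm, coe_eq_map_add_map_iff, ← q.degrees_eq, ← q.degrees_eq] at hv
    exact hv

end RealBWGraph

theorem mainTheorem1 (d : ℕ) (hd : 0 < d) (Λw Λb : d.Partition) :
    RealBWGraph.signedCount (RealBWGraph.whiteSided Λw Λb) =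
      RealBWGraph.signedCount (RealBWGraph.blackSided Λw Λb) := by
  have hw : RealBWGraph.whiteSided Λw Λb =
      {q | q ∈ RealBWGraph.classes Λw Λb ∧ q.Sided white} := rfl
  have hb : RealBWGraph.blackSided Λw Λb =
      {q | q ∈ RealBWGraph.classes Λw Λb ∧ q.Sided black} := rfl
  rw [hw, hb, RealBWGraph.signedCount_eq, RealBWGraph.signedCount_eq,
    coeff_sum_evalOp_term _ white (by omega)]
  rfl
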